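/- Let $q\in\mathbb C$ with $0<|q|<1$. For $|p|<1$ write $(a;q)_\infty=\prod_{j\ge0}(1-aq^j)$, $\theta(a;q)=(a,q/a;q)_\infty$ and $\Gamma_e(z;p,q)=\prod_{j,k\ge0}\frac{1-z^{-1}p^{j+1}q^{k+1}}{1-zp^jq^k}$. Several arguments, or an argument $az^{\pm1}$, stand for products: $(a,b;q)_\infty=(a;q)_\infty(b;q)_\infty$, $(az^{\pm1};q)_\infty=(az,az^{-1};q)_\infty$, and likewise for $\theta$ and $\Gamma_e$. For $p\neq0$, $|p|<1$ and $t\in\mathbb C^8$ with $\prod_{j=1}^8t_j=p^2q^2$ and $t_it_j\notin p^{\mathbb Z_{\le0}}q^{\mathbb Z_{\le0}}$ for all $1\le i,j\le8$ (possibly equal), let $$S_e(t)=S_e(t;p,q)=\int_{\mathcal C}\frac{\prod_{j=1}^8\Gamma_e(t_jz^{\pm1};p,q)}{\Gamma_e(z^{\pm2};p,q)}\frac{dz}{2\pi iz},$$ where $\mathcal C$ is a deformation in $\mathbb C\setminus\{0\}$ of the positively oriented unit circle that includes the points $t_jp^{\mathbb Z_{\ge0}}q^{\mathbb Z_{\ge0}}$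 and excludes the points $t_j^{-1}p^{\mathbb Z_{\le0}}q^{\mathbb Z_{\le0}}$ ($1\le j\le8$). Let $t\in\mathbb C^8$ with $\prod_{j=1}^8t_j=1$. (1) Suppose that $t_it_j\notin q^{\mathbb Z_{\le0}}$ for $2\le i,j\le7$ (possibly equal), and let $$S_t(t)=\int_{\mathcal C}\frac{(z^{\pm2},t_1^{-1}z^{\pm1},t_8^{-1}z^{\pm1};q)_\infty}{\prod_{j=2}^7(t_jz^{\pm1};q)_\infty}\frac{dz}{2\pi iz},$$ where $\mathcal C$ is a deformation of the positively oriented unit circle in $\mathbb C\setminus\{0\}$ that includes the points $t_jq^{\mathbb Z_{\ge0}}$ ($2\le j\le7$) and excludes their reciprocals. Then $S_e(pqt_1,t_2,\ldots,t_7,pqt_8)$ is defined for all sufficiently small $p\ne0$, and $$\lim_{p\to0}S_e(pqt_1,t_2,\ldots,t_7,pqt_8)=S_t(t).$$ (2) Suppose that $t_it_j\notin q^{\mathbb Z_{\le1}}$ for $i,j\in\{1,8\}$ (possibly equal) and $t_it_j\notin q^{\mathbb Z_{\le0}}$ for $i\in\{1,8\}$, $2\le j\le7$. Let $\mu\in\mathbb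 C\setminus\{0\}$ with $\mu\notin t_1q^{\mathbb Z}\cup t_8q^{\mathbb Z}$, and let $$U_t(t)=U_t^\mu(t)=\int_{\mathcal C'}2\,\frac{\theta(t_1t_8/\mu z,z/\mu;q)}{\theta(t_1/\mu,t_8/\mu;q)}\Bigl(1-\frac{z^2}q\Bigr)\prod_{i=2}^7\frac{(z/t_i;q)_\infty}{(t_iz;q)_\infty}\prod_{j=1,8}\frac1{(t_jz/q,t_j/z;q)_\infty}\frac{dz}{2\pi iz},$$ where $\mathcal C'$ is a deformation of the positively oriented unit circle in $\mathbb C\setminus\{0\}$ that includes the points $t_jq^{\mathbb Z_{\ge0}}$ ($j=1,8$) and excludes the points $t_j^{-1}q^{\mathbb Z_{\le1}}$ ($j=1,8$) and $t_i^{-1}q^{\mathbb Z_{\le0}}$ ($2\le i\le7$). Then $$\lim_{p\to0}\theta\bigl(t_1t_8/pq;q\bigr)\,S_e\bigl((pq)^{-\frac12}t_1,(pq)^{\frac12}t_2,\ldots,(pq)^{\frac12}t_7,(pq)^{-\frac12}t_8\bigr)=U_t(t),$$ for either choice of the square root $(pq)^{\frac12}$. Here the function of $p$ under the limit is defined by the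 integral for $S_e$ for all small $p\ne0$ outside the three sequences $t_1^2q^{\mathbb Z_{\ge-1}}$, $t_1t_8q^{\mathbb Z_{\ge-1}}$, $t_8^2q^{\mathbb Z_{\ge-1}}$; it is part of the claim that it extends continuously to all sufficiently small $p\neq0$, and the limit is that of the extension. -/

import Mathlib

open Filter Topology

noncomputable section

/-! ### Infinite products -/

/-- The `q`-shifted factorial `(a; q)_∞ = ∏_{j ≥ 0} (1 - a q ^ j)`. -/
def qShiftedFactorial (a q : ℂ) : ℂ := ∏' j : ℕ, (1 - a * q ^ j)

/-- The renormalized Jacobi theta function `θ(a; q) = (a, q / a; q)_∞`. -/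
def jacobiThetaR (a q : ℂ) : ℂ := qShiftedFactorial a q * qShiftedFactorial (q / a) q

/-- The elliptic gamma function
`Γ_e(z; p, q) = ∏_{j, k ≥ 0} (1 - z⁻¹ p ^ (j + 1) q ^ (k + 1)) / (1 - z p ^ j q ^ k)`. -/
def ellipticGamma (z p q : ℂ) : ℂ :=
  (∏' m : ℕ × ℕ, (1 - z⁻¹ * p ^ (m.1 + 1) * q ^ (m.2 + 1))) /
    ∏' m : ℕ × ℕ, (1 - z * p ^ m.1 * q ^ m.2)

/-! ### Contours -/

/-- The contour integral `∮_γ f(z) dz` over a closed curve `γ` parametrized by `[0, 1]`. -/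
def loopIntegral (γ : ℝ → ℂ) (f : ℂ → ℂ) : ℂ := ∫ x in (0 : ℝ)..1, deriv γ x * f (γ x)

/-- The winding number of the closed curve `γ` around a point `a` which is not on `γ`. -/
def loopWinding (γ : ℝ → ℂ) (a : ℂ) : ℂ :=
  (2 * Real.pi * Complex.I)⁻¹ * loopIntegral γ (fun z => (z - a)⁻¹)

/-- `γ` is a deformation in `ℂ \ {0}` of the positively oriented unit circle which includes all
points of `D` and excludes all points of `E`: a closed `C¹` curve that avoids `0`, `D` and `E` and
winds exactly once around `0` and around every point of `D`, and zero times around every point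
of `E`. -/
structure IsSeparatingContour (D E : Set ℂ) (γ : ℝ → ℂ) : Prop where
  contDiff : ContDiff ℝ 1 γ
  periodic : Function.Periodic γ 1
  ne_zero : ∀ x, γ x ≠ 0
  notMem_included : ∀ x, γ x ∉ D
  notMem_excluded : ∀ x, γ x ∉ E
  winding_zero : loopWinding γ 0 = 1
  winding_included : ∀ a ∈ D, loopWinding γ a = 1
  winding_excluded : ∀ a ∈ E, loopWinding γ a = 0

open Classical in
/-- `∫_C f(z) dz / (2 π i z)`, where `C` is a deformation of the positively oriented unit circle
which includes `D` and excludes `E` (for the integrands below the value does not depend on the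
choice of `C`, by Cauchy's theorem; the value is `0` if there is no such contour). -/
def separatedIntegral (D E : Set ℂ) (f : ℂ → ℂ) : ℂ :=
  if h : ∃ γ, IsSeparatingContour D E γ then
    (2 * Real.pi * Complex.I)⁻¹ * loopIntegral h.choose (fun z => f z / z)
  else 0

/-! ### The elliptic hypergeometric function

The parameters `t_1, …, t_8` are indexed by `Fin 8`, so that `t_j` is `t (j - 1)`. -/

/-- The integrand `I_e(t; z; p, q) = ∏_{j = 1}^8 Γ_e(t_j z^{±1}) / Γ_e(z^{±2})`. -/
def ellipticIntegrand (p q : ℂ) (t : Fin 8 → ℂ) (z : ℂ) : ℂ :=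
  (∏ j, ellipticGamma (t j * z) p q * ellipticGamma (t j / z) p q) /
    (ellipticGamma (z ^ 2) p q * ellipticGamma (z ^ 2)⁻¹ p q)

/-- The downward sequences `t_j p^{ℤ ≥ 0} q^{ℤ ≥ 0}`. -/
def ellipticDownward (p q : ℂ) (t : Fin 8 → ℂ) : Set ℂ :=
  {z | ∃ (j : Fin 8) (a b : ℕ), z = t j * p ^ a * q ^ b}

/-- The upward sequences `t_j⁻¹ p^{ℤ ≤ 0} q^{ℤ ≤ 0}`. -/
def ellipticUpward (p q : ℂ) (t : Fin 8 → ℂ) : Set ℂ :=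
  {z | ∃ (j : Fin 8) (a b : ℕ), z = (t j * p ^ a * q ^ b)⁻¹}

/-- The condition `t_i t_j ∉ p^{ℤ ≤ 0} q^{ℤ ≤ 0}` for all `i, j` (possibly equal). -/
def EllipticAdmissible (p q : ℂ) (t : Fin 8 → ℂ) : Prop :=
  ∀ (i j : Fin 8) (a b : ℕ), t i * t j * p ^ a * q ^ b ≠ 1

/-- The elliptic hypergeometric function `S_e(t; p, q) = ∫_C I_e(t; z; p, q) dz / (2 π i z)`. -/
def ellipticS (p q : ℂ) (t : Fin 8 → ℂ) : ℂ :=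
  separatedIntegral (ellipticDownward p q t) (ellipticUpward p q t) (ellipticIntegrand p q t)

/-! ### The trigonometric hypergeometric integrals -/

/-- The positions of `t_2, …, t_7`. -/
def midIdx : Finset (Fin 8) := {1, 2, 3, 4, 5, 6}

/-- The positions of `t_1` and `t_8`. -/
def endIdx : Finset (Fin 8) := {0, 7}

/-- The integrand
`I_t(t; z) = (z^{±2}, t_1⁻¹ z^{±1}, t_8⁻¹ z^{±1}; q)_∞ / ∏_{j = 2}^7 (t_j z^{±1}; q)_∞`. -/
def trigIntegrandS (q : ℂ) (t : Fin 8 → ℂ) (z : ℂ) : ℂ :=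
  (qShiftedFactorial (z ^ 2) q * qShiftedFactorial (z ^ 2)⁻¹ q *
      ∏ j ∈ endIdx, qShiftedFactorial ((t j)⁻¹ * z) q * qShiftedFactorial ((t j)⁻¹ / z) q) /
    ∏ j ∈ midIdx, qShiftedFactorial (t j * z) q * qShiftedFactorial (t j / z) q

/-- `S_t(t) = ∫_C I_t(t; z) dz / (2 π i z)`, where `C` includes the sequences `t_j q^{ℤ ≥ 0}`
(`2 ≤ j ≤ 7`) and excludes their reciprocals. -/
def trigS (q : ℂ) (t : Fin 8 → ℂ) : ℂ :=
  separatedIntegral {z | ∃ j ∈ midIdx, ∃ n : ℕ, z = t j * q ^ n}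
    {z | ∃ j ∈ midIdx, ∃ n : ℕ, z = (t j * q ^ n)⁻¹} (trigIntegrandS q t)

/-- The integrand
`J_t^μ(t; z) = 2 θ(t_1 t_8 / (μ z), z / μ; q) / θ(t_1 / μ, t_8 / μ; q) * (1 - z² / q)
  * ∏_{i = 2}^7 (z / t_i; q)_∞ / (t_i z; q)_∞ * ∏_{j = 1, 8} 1 / (t_j z / q, t_j / z; q)_∞`. -/
def trigIntegrandU (q μ : ℂ) (t : Fin 8 → ℂ) (z : ℂ) : ℂ :=
  2 * ((jacobiThetaR (t 0 * t 7 / (μ * z)) q * jacobiThetaR (z / μ) q) /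
      (jacobiThetaR (t 0 / μ) q * jacobiThetaR (t 7 / μ) q)) *
    (1 - z ^ 2 / q) *
    (∏ i ∈ midIdx, qShiftedFactorial (z / t i) q / qShiftedFactorial (t i * z) q) *
    ∏ j ∈ endIdx, 1 / (qShiftedFactorial (t j * z / q) q * qShiftedFactorial (t j / z) q)

/-- `U_t^μ(t) = ∫_{C'} J_t^μ(t; z) dz / (2 π i z)`, where `C'` includes the sequences
`t_j q^{ℤ ≥ 0}` (`j = 1, 8`) and excludes the sequences `t_j⁻¹ q^{ℤ ≤ 1}` (`j = 1, 8`) and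
`t_i⁻¹ q^{ℤ ≤ 0}` (`2 ≤ i ≤ 7`). -/
def trigU (q μ : ℂ) (t : Fin 8 → ℂ) : ℂ :=
  separatedIntegral {z | ∃ j ∈ endIdx, ∃ n : ℕ, z = t j * q ^ n}
    ({z | ∃ j ∈ endIdx, ∃ n : ℕ, z = q * (t j * q ^ n)⁻¹} ∪
      {z | ∃ i ∈ midIdx, ∃ n : ℕ, z = (t i * q ^ n)⁻¹})
    (trigIntegrandU q μ t)

/-! ### Genericity -/

/-- The included and excluded pole sequences in `S_t(t)` are disjoint:
`t_i t_j ∉ q^{ℤ ≤ 0}` for `2 ≤ i, j ≤ 7` (possibly equal). -/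
def GenericS (q : ℂ) (t : Fin 8 → ℂ) : Prop :=
  ∀ i ∈ midIdx, ∀ j ∈ midIdx, ∀ n : ℕ, t i * t j * q ^ n ≠ 1

/-- The included and excluded pole sequences in `U_t(t)` are disjoint:
`t_i t_j ∉ q^{ℤ ≤ 1}` for `i, j ∈ {1, 8}` (possibly equal), and `t_i t_j ∉ q^{ℤ ≤ 0}` for
`i ∈ {1, 8}`, `2 ≤ j ≤ 7`. -/
def GenericU (q : ℂ) (t : Fin 8 → ℂ) : Prop :=
  (∀ i ∈ endIdx, ∀ j ∈ endIdx, ∀ n : ℕ, t i * t j * q ^ n ≠ q) ∧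
    ∀ i ∈ endIdx, ∀ j ∈ midIdx, ∀ n : ℕ, t i * t j * q ^ n ≠ 1

/-- The `μ`-dependent denominator of `J_t^μ` does not vanish: `μ ∉ t_1 q^ℤ ∪ t_8 q^ℤ`. -/
def GenericMu (q μ : ℂ) (t : Fin 8 → ℂ) : Prop :=
  μ ≠ 0 ∧ ∀ j ∈ endIdx, ∀ n : ℤ, μ ≠ t j * q ^ n

/-! ### The degenerating parameters -/

/-- `(p q t_1, t_2, …, t_7, p q t_8)`. -/
def paramsS (p q : ℂ) (t : Fin 8 → ℂ) : Fin 8 → ℂ :=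
  ![p * q * t 0, t 1, t 2, t 3, t 4, t 5, t 6, p * q * t 7]

/-- `(s⁻¹ t_1, s t_2, …, s t_7, s⁻¹ t_8)`; it is used with a square root `s` of `p q`. -/
def paramsU (s : ℂ) (t : Fin 8 → ℂ) : Fin 8 → ℂ :=
  ![s⁻¹ * t 0, s * t 1, s * t 2, s * t 3, s * t 4, s * t 5, s * t 6, s⁻¹ * t 7]

end

/-! ### Infinite products -/

/-! Both limits are taken under the integral sign, along one contour that serves for all small `p`,
including `p = 0`. The integrand is written as `N / ∏ (α_j z, β_j / z; p, q)_∞` with `N` jointly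
continuous in `p` and `z`. A pole sequence either does not depend on `p` or carries a positive power
of `p`; in the latter case it is swallowed by `0` or `∞`, where every contour already has the right
winding number. This is `exists_degeneration`. At `p = 0` a double product collapses to a single
`q`-factorial, which yields the trigonometric integrands.

For the first limit this applies directly: the factors `p q` turn the numerators of the
corresponding gamma functions into `(1 / (t_j z^{±1}); p, q)_∞`, and their poles disappear at `p =
0`.

For the second limit the contour would be pinched: after `z = s w` with `s² = p q`, the excluded
points `p q / t_j` (`j = 1, 8`) tend to `0`, while the included points `t_j` stay fixed. The
integrand is invariant under `w ↦ 1 / w`, so this symmetry may be broken at will. By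
`jacobiThetaR_four_term`, `θ(t_1 t_8 / p q)` times a constant is the sum over `w ↔ 1 / w` of a
product of four theta functions divided by `θ(w²)`. The two terms contribute equally, and in one of
them the factors `θ(T_1 w) θ(T_8 w)`, with `T_j = t_j / s`, cancel exactly the dangerous excluded
points, since `Γ_e(p x) = θ(x; q) Γ_e(x)`. What remains depends on `s` only through `s²`, and its
integral over the fixed contour is continuous in `p`; it is both the required extension and the
source of the limit.

Contours are arbitrary `C¹` loops prescribed by winding numbers. Their existence comes from
composing small circles in the complement of a countable set. Independence of the choice comes from
lifting loops through `exp` and subtracting principal parts. -/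

theorem continuousOn_tprod_one_sub {X ι : Type*} [TopologicalSpace X] [LocallyCompactSpace X]
    {c : X → ι → ℂ} {U : Set X} (hU : IsOpen U) {u : ι → ℝ} (hu : Summable u)
    (hb : ∀ x ∈ U, ∀ i, ‖c x i‖ ≤ u i) (hc : ∀ i, ContinuousOn (fun x => c x i) U) :
    ContinuousOn (fun x => ∏' i, (1 - c x i)) U := by
  have h := Summable.hasProdLocallyUniformlyOn_one_add (f := fun i x => -c x i) hU hu
    (Eventually.of_forall fun i x hx => by simpa using hb x hx i) (fun i => (hc i).neg)
  have h2 := (hasProdLocallyUniformlyOn_iff_tendstoLocallyUniformlyOn.mp h).continuousOn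
    (Eventually.of_forall fun s => continuousOn_finsetProd _ fun i _ =>
      continuousOn_const.add (hc i).neg).frequently
  simpa only [← sub_eq_add_neg] using h2

theorem differentiableOn_tprod_one_sub {ι : Type*}
    {c : ℂ → ι → ℂ} {U : Set ℂ} (hU : IsOpen U) {u : ι → ℝ} (hu : Summable u)
    (hb : ∀ x ∈ U, ∀ i, ‖c x i‖ ≤ u i) (hc : ∀ i, DifferentiableOn ℂ (fun x => c x i) U) :
    DifferentiableOn ℂ (fun x => ∏' i, (1 - c x i)) U := by
  have h := Summable.hasProdLocallyUniformlyOn_one_add (f := fun i x => -c x i) hU hu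
    (Eventually.of_forall fun i x hx => by simpa using hb x hx i) (fun i => (hc i).neg.continuousOn)
  have h2 := (hasProdLocallyUniformlyOn_iff_tendstoLocallyUniformlyOn.mp h).differentiableOn
    (Eventually.of_forall fun s => DifferentiableOn.fun_finsetProd fun i _ =>
      (differentiableOn_const _).add (hc i).neg) hU
  simpa only [← sub_eq_add_neg] using h2

theorem tprod_one_sub_eq_zero_iff {ι : Type*} {c : ι → ℂ} (hc : Summable fun i => ‖c i‖) :
    ∏' i, (1 - c i) = 0 ↔ ∃ i, c i = 1 := by
  constructor
  · intro h
    by_contra! hne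
    refine tprod_one_add_ne_zero_of_summable (f := fun i => -c i) (fun i hi => hne i ?_)
      (by simpa using hc) (by simpa only [← sub_eq_add_neg] using h)
    linear_combination -hi
  · rintro ⟨i, hi⟩
    exact tprod_of_exists_eq_zero ⟨i, by simp [hi]⟩

theorem multipliable_one_sub {ι : Type*} {c : ι → ℂ} (hc : Summable fun i => ‖c i‖) :
    Multipliable fun i => 1 - c i := by
  simpa only [← sub_eq_add_neg] using
    multipliable_one_add_of_summable (f := fun i => -c i) (by simpa using hc)

/-! ### The `q`-shifted factorial -/

theorem summable_norm_mul_pow (a : ℂ) {q : ℂ} (hq : ‖q‖ < 1) :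
    Summable fun j : ℕ => ‖a * q ^ j‖ := by
  simpa [norm_mul, norm_pow] using
    (summable_geometric_of_lt_one (norm_nonneg q) hq).mul_left ‖a‖

theorem qShiftedFactorial_eq_zero_iff {a q : ℂ} (hq : ‖q‖ < 1) :
    qShiftedFactorial a q = 0 ↔ ∃ j : ℕ, a * q ^ j = 1 :=
  tprod_one_sub_eq_zero_iff (summable_norm_mul_pow a hq)

theorem qShiftedFactorial_rec (a : ℂ) {q : ℂ} (hq : ‖q‖ < 1) :
    qShiftedFactorial a q = (1 - a) * qShiftedFactorial (a * q) q := by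
  unfold qShiftedFactorial
  rw [tprod_eq_zero_mul']
  · simp [pow_succ', mul_assoc]
  · simpa [pow_succ', mul_assoc] using multipliable_one_sub (summable_norm_mul_pow (a * q) hq)

theorem differentiable_qShiftedFactorial {q : ℂ} (hq : ‖q‖ < 1) :
    Differentiable ℂ fun a => qShiftedFactorial a q := by
  intro a
  have h := differentiableOn_tprod_one_sub (c := fun a (j : ℕ) => a * q ^ j)
    (U := Metric.ball 0 (‖a‖ + 1)) Metric.isOpen_ball
    ((summable_geometric_of_lt_one (norm_nonneg q) hq).mul_left (‖a‖ + 1))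
    (fun x hx i => by
      rw [norm_mul, norm_pow]
      have : ‖x‖ < ‖a‖ + 1 := by simpa using hx
      gcongr) (fun i => by fun_prop)
  exact h.differentiableAt (Metric.isOpen_ball.mem_nhds (by simp))

/-- Continuity in both variables is needed because factors `(·; p)_∞`, whose base is the varying
nome, survive in the integrands. -/
theorem continuousAt_qShiftedFactorial {a q : ℂ} (hq : ‖q‖ < 1) :
    ContinuousAt (fun x : ℂ × ℂ => qShiftedFactorial x.1 x.2) (a, q) := by
  obtain ⟨ρ, hρ, hρ1⟩ := exists_between hq
  have h0 : 0 ≤ ρ := (norm_nonneg q).trans hρ.le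
  have hU : IsOpen {x : ℂ × ℂ | ‖x.1‖ < ‖a‖ + 1 ∧ ‖x.2‖ < ρ} :=
    IsOpen.and (isOpen_lt (by fun_prop) (by fun_prop)) (isOpen_lt (by fun_prop) (by fun_prop))
  have h := continuousOn_tprod_one_sub (c := fun (x : ℂ × ℂ) (j : ℕ) => x.1 * x.2 ^ j) hU
    ((summable_geometric_of_lt_one h0 hρ1).mul_left (‖a‖ + 1))
    (fun x hx i => by
      rw [norm_mul, norm_pow]
      have := hx.1
      have := hx.2
      gcongr) (fun i => by fun_prop)
  exact h.continuousAt (hU.mem_nhds ⟨by simp, hρ⟩)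

theorem qShiftedFactorial_zero_right (a : ℂ) : qShiftedFactorial a 0 = 1 - a := by
  rw [qShiftedFactorial_rec a (by simp)]
  simp [qShiftedFactorial]

theorem qShiftedFactorial_zero_left (q : ℂ) : qShiftedFactorial 0 q = 1 := by
  simp [qShiftedFactorial]

/-! ### The double shifted factorial -/

/-- The double shifted factorial `∏_{j, k ≥ 0} (1 - a p ^ j q ^ k)`. -/
noncomputable def doubleShifted (a p q : ℂ) : ℂ := ∏' m : ℕ × ℕ, (1 - a * p ^ m.1 * q ^ m.2)

theorem summable_pow_mul_pow {x y : ℝ} (hx0 : 0 ≤ x) (hx : x < 1) (hy0 : 0 ≤ y) (hy : y < 1) :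
    Summable fun m : ℕ × ℕ => x ^ m.1 * y ^ m.2 :=
  (summable_geometric_of_lt_one hx0 hx).mul_of_nonneg (summable_geometric_of_lt_one hy0 hy)
    (fun _ => by positivity) (fun _ => by positivity)

theorem summable_norm_mul_pow_mul_pow (a : ℂ) {p q : ℂ} (hp : ‖p‖ < 1) (hq : ‖q‖ < 1) :
    Summable fun m : ℕ × ℕ => ‖a * p ^ m.1 * q ^ m.2‖ := by
  simpa [norm_mul, norm_pow, mul_assoc] using
    (summable_pow_mul_pow (norm_nonneg p) hp (norm_nonneg q) hq).mul_left ‖a‖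

theorem doubleShifted_eq_zero_iff {a p q : ℂ} (hp : ‖p‖ < 1) (hq : ‖q‖ < 1) :
    doubleShifted a p q = 0 ↔ ∃ j k : ℕ, a * p ^ j * q ^ k = 1 := by
  rw [doubleShifted, tprod_one_sub_eq_zero_iff (summable_norm_mul_pow_mul_pow a hp hq)]
  simp

theorem differentiable_doubleShifted {p q : ℂ} (hp : ‖p‖ < 1) (hq : ‖q‖ < 1) :
    Differentiable ℂ fun a => doubleShifted a p q := by
  intro a
  have h := differentiableOn_tprod_one_sub (c := fun a (m : ℕ × ℕ) => a * p ^ m.1 * q ^ m.2)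
    (U := Metric.ball 0 (‖a‖ + 1)) Metric.isOpen_ball
    ((summable_pow_mul_pow (norm_nonneg p) hp (norm_nonneg q) hq).mul_left (‖a‖ + 1))
    (fun x hx i => by
      rw [norm_mul, norm_mul, norm_pow, norm_pow, mul_assoc]
      have : ‖x‖ < ‖a‖ + 1 := by simpa using hx
      gcongr) (fun i => by fun_prop)
  exact h.differentiableAt (Metric.isOpen_ball.mem_nhds (by simp))

theorem continuousAt_doubleShifted {a p q : ℂ} (hp : ‖p‖ < 1) (hq : ‖q‖ < 1) :
    ContinuousAt (fun x : ℂ × ℂ => doubleShifted x.1 x.2 q) (a, p) := by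
  obtain ⟨ρ, hρ, hρ1⟩ := exists_between hp
  have h0 : 0 ≤ ρ := (norm_nonneg p).trans hρ.le
  have hU : IsOpen {x : ℂ × ℂ | ‖x.1‖ < ‖a‖ + 1 ∧ ‖x.2‖ < ρ} :=
    IsOpen.and (isOpen_lt (by fun_prop) (by fun_prop)) (isOpen_lt (by fun_prop) (by fun_prop))
  have h := continuousOn_tprod_one_sub
    (c := fun (x : ℂ × ℂ) (m : ℕ × ℕ) => x.1 * x.2 ^ m.1 * q ^ m.2) hU
    ((summable_pow_mul_pow h0 hρ1 (norm_nonneg q) hq).mul_left (‖a‖ + 1))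
    (fun x hx i => by
      rw [norm_mul, norm_mul, norm_pow, norm_pow, mul_assoc]
      have := hx.1
      have := hx.2
      gcongr) (fun i => by fun_prop)
  exact h.continuousAt (hU.mem_nhds ⟨by simp, hρ⟩)

/-- Splitting off the row `j = 0` shifts `a` to `a p`. Together with the column version
`doubleShifted_rec'` this is the source of all cancellations between elliptic gamma functions below.
-/
theorem doubleShifted_rec (a : ℂ) {p q : ℂ} (hp : ‖p‖ < 1) (hq : ‖q‖ < 1) :
    doubleShifted a p q = qShiftedFactorial a q * doubleShifted (a * p) p q := by
  have key : ∀ b : ℂ, doubleShifted b p q = ∏' j : ℕ, qShiftedFactorial (b * p ^ j) q ∧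
      Multipliable fun j : ℕ => qShiftedFactorial (b * p ^ j) q := by
    intro b
    have h := multipliable_one_sub (summable_norm_mul_pow_mul_pow b hp hq)
    have h' := fun j : ℕ => multipliable_one_sub (summable_norm_mul_pow (b * p ^ j) hq)
    refine ⟨?_, (h.hasProd.prod_fiberwise (fun j => (h' j).hasProd)).multipliable⟩
    exact h.tprod_prod' h'
  have h1 : ∀ j : ℕ, a * p ^ (j + 1) = a * p * p ^ j := fun j => by ring
  rw [(key a).1, (key (a * p)).1, tprod_eq_zero_mul']
  · simp [h1]
  · simpa only [h1] using (key (a * p)).2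

theorem doubleShifted_symm (a p q : ℂ) : doubleShifted a p q = doubleShifted a q p := by
  unfold doubleShifted
  rw [← (Equiv.prodComm ℕ ℕ).tprod_eq]
  simp [mul_right_comm]

theorem doubleShifted_rec' (a : ℂ) {p q : ℂ} (hp : ‖p‖ < 1) (hq : ‖q‖ < 1) :
    doubleShifted a p q = qShiftedFactorial a p * doubleShifted (a * q) p q := by
  rw [doubleShifted_symm a, doubleShifted_symm (a * q), doubleShifted_rec a hq hp]

theorem doubleShifted_zero_left (p q : ℂ) : doubleShifted 0 p q = 1 := by
  simp [doubleShifted]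

/-- Since `0 ^ 0 = 1`, only the row `j = 0` survives. Every trigonometric integrand is obtained by
this evaluation. -/
theorem doubleShifted_zero_mid (a : ℂ) {q : ℂ} (hq : ‖q‖ < 1) :
    doubleShifted a 0 q = qShiftedFactorial a q := by
  rw [doubleShifted_rec a (by simp) hq, mul_zero, doubleShifted_zero_left, mul_one]

theorem ellipticGamma_eq (z p q : ℂ) :
    ellipticGamma z p q = doubleShifted (p * q / z) p q / doubleShifted z p q := by
  unfold ellipticGamma doubleShifted
  congr 2
  ext m
  ring

/-! ### The theta function -/

/-- The factor `(a; q)_∞` accounts for the powers `n ≤ 0`, the factor `(q / a; q)_∞` for `n ≥ 1`. -/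
theorem jacobiThetaR_eq_zero_iff {a q : ℂ} (hq0 : q ≠ 0) (hq : ‖q‖ < 1) (ha : a ≠ 0) :
    jacobiThetaR a q = 0 ↔ ∃ n : ℤ, a = q ^ n := by
  rw [jacobiThetaR, mul_eq_zero, qShiftedFactorial_eq_zero_iff hq, qShiftedFactorial_eq_zero_iff hq]
  constructor
  · rintro (⟨j, hj⟩ | ⟨j, hj⟩)
    · exact ⟨-j, by rw [zpow_neg, zpow_natCast]; exact eq_inv_of_mul_eq_one_left hj⟩
    · refine ⟨j + 1, ?_⟩
      field_simp at hj
      rw [← hj]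
      norm_cast
      ring
  · rintro ⟨n, hn⟩
    obtain ⟨m, rfl | rfl⟩ := n.eq_nat_or_neg
    · rcases m with _ | m
      · left
        exact ⟨0, by simp [hn]⟩
      · right
        refine ⟨m, ?_⟩
        rw [hn]
        norm_cast
        field_simp
        ring
    · left
      refine ⟨m, ?_⟩
      rw [hn, zpow_neg, zpow_natCast]
      field_simp

theorem jacobiThetaR_q_div (a : ℂ) {q : ℂ} (hq0 : q ≠ 0) :
    jacobiThetaR (q / a) q = jacobiThetaR a q := by
  unfold jacobiThetaR
  rw [div_div_cancel₀ hq0, mul_comm]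

theorem jacobiThetaR_inv {a q : ℂ} (hq : ‖q‖ < 1) (ha : a ≠ 0) :
    jacobiThetaR a⁻¹ q = -a⁻¹ * jacobiThetaR a q := by
  unfold jacobiThetaR
  rw [qShiftedFactorial_rec a⁻¹ hq, qShiftedFactorial_rec a hq, div_inv_eq_mul, mul_comm q a,
    inv_mul_eq_div]
  field_simp
  ring

theorem jacobiThetaR_mul_q {a q : ℂ} (hq0 : q ≠ 0) (hq : ‖q‖ < 1) (ha : a ≠ 0) :
    jacobiThetaR (a * q) q = -a⁻¹ * jacobiThetaR a q := by
  rw [← jacobiThetaR_inv hq ha, ← jacobiThetaR_q_div (a * q) hq0]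
  congr 1
  field_simp

theorem jacobiThetaR_one {q : ℂ} (hq : ‖q‖ < 1) : jacobiThetaR 1 q = 0 := by
  simp [jacobiThetaR, qShiftedFactorial_rec 1 hq]

theorem differentiableAt_jacobiThetaR {a q : ℂ} (hq : ‖q‖ < 1) (ha : a ≠ 0) :
    DifferentiableAt ℂ (fun a => jacobiThetaR a q) a := by
  have h := differentiable_qShiftedFactorial hq
  unfold jacobiThetaR
  exact (h a).mul ((h (q / a)).comp (f := fun a => q / a) a
    ((differentiableAt_const _).div differentiableAt_id ha))

/-! ### A four term identity for theta functions -/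

theorem exists_eq_sub_mul_of_eq_zero {f : ℂ → ℂ} {U : Set ℂ} {a : ℂ} (hf : DifferentiableOn ℂ f U)
    (hU : U ∈ 𝓝 a) (h0 : f a = 0) :
    ∃ g : ℂ → ℂ, DifferentiableOn ℂ g U ∧ ∀ w, f w = (w - a) * g w := by
  refine ⟨dslope f a, (Complex.differentiableOn_dslope hU).mpr hf, fun w => ?_⟩
  have := sub_smul_dslope f a w
  rw [h0, sub_zero, smul_eq_mul] at this
  exact this.symm

/-- The annulus is the image of a convex vertical strip under `exp`. -/
theorem isPreconnected_annulus {r R : ℝ} (hr : 0 < r) :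
    IsPreconnected {w : ℂ | r < ‖w‖ ∧ ‖w‖ < R} := by
  rcases le_or_gt R r with hR | hR
  · convert isPreconnected_empty using 1
    ext w
    simp only [Set.mem_ofPred_eq, Set.mem_empty_iff_false, iff_false]
    intro h
    linarith [h.1, h.2]
  have hc : Convex ℝ {u : ℂ | Real.log r < u.re ∧ u.re < Real.log R} :=
    (convex_halfSpace_re_gt _).inter (convex_halfSpace_re_lt _)
  convert hc.isPreconnected.image Complex.exp Complex.continuous_exp.continuousOn using 1
  ext w
  simp only [Set.mem_ofPred_eq, Set.mem_image]
  constructor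
  · rintro ⟨h1, h2⟩
    have hw : w ≠ 0 := by
      rintro rfl
      simp at h1
      linarith
    refine ⟨Complex.log w, ?_, Complex.exp_log hw⟩
    rw [Complex.log_re]
    exact ⟨Real.log_lt_log hr h1, Real.log_lt_log (hr.trans h1) h2⟩
  · rintro ⟨u, ⟨h1, h2⟩, rfl⟩
    rw [Complex.norm_exp]
    exact ⟨(Real.log_lt_iff_lt_exp hr).mp h1, (Real.lt_log_iff_exp_lt (hr.trans hR)).mp h2⟩

theorem exists_mul_zpow_norm_mem {q : ℂ} (hq0 : q ≠ 0) (hq : ‖q‖ < 1) {w : ℂ} (hw : w ≠ 0) :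
    ∃ n : ℤ, ‖q‖ < ‖w * q ^ n‖ ∧ ‖w * q ^ n‖ ≤ 1 := by
  have hqp : 0 < ‖q‖ := norm_pos_iff.mpr hq0
  obtain ⟨n, h1, h2⟩ := exists_mem_Ioc_zpow (norm_pos_iff.mpr hw) ((one_lt_inv₀ hqp).mpr hq)
  refine ⟨n + 1, ?_⟩
  rw [norm_mul, norm_zpow, zpow_add₀ hqp.ne', zpow_one]
  rw [inv_zpow] at h1
  rw [inv_zpow, zpow_add₀ hqp.ne', zpow_one] at h2
  have hn : 0 < ‖q‖ ^ n := zpow_pos hqp n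
  constructor
  · rw [inv_lt_iff_one_lt_mul₀ hn] at h1
    nlinarith
  · rw [le_inv_comm₀ (norm_pos_iff.mpr hw) (by positivity)] at h2
    calc ‖w‖ * (‖q‖ ^ n * ‖q‖) ≤ ‖w‖ * ‖w‖⁻¹ := by gcongr
      _ = 1 := mul_inv_cancel₀ (norm_ne_zero_iff.mpr hw)

/-- A holomorphic function on `ℂ \ {0}` with the quasi-periodicity and the zeros of `θ(w²; q)` is
a constant multiple of it. -/
theorem exists_eq_const_mul_jacobiThetaR_sq {q r : ℂ} (hq0 : q ≠ 0) (hq : ‖q‖ < 1) (hr : r ^ 2 = q)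
    {G : ℂ → ℂ} (hG : DifferentiableOn ℂ G {0}ᶜ)
    (hqG : ∀ w, w ≠ 0 → G (w * q) = q⁻¹ * (w ^ 4)⁻¹ * G w)
    (h1 : G 1 = 0) (h2 : G (-1) = 0) (h3 : G r = 0) (h4 : G (-r) = 0) :
    ∃ c, ∀ w, w ≠ 0 → G w = c * jacobiThetaR (w ^ 2) q := by
  have hqp : 0 < ‖q‖ := norm_pos_iff.mpr hq0
  have hr0 : r ≠ 0 := by
    rintro rfl
    exact hq0 (by simp [← hr])
  have hU : ∀ a : ℂ, a ≠ 0 → ({0}ᶜ : Set ℂ) ∈ 𝓝 a := fun a ha =>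
    isOpen_compl_singleton.mem_nhds ha
  have hr1 : r ^ 2 ≠ 1 := by
    rw [hr]
    rintro rfl
    simp at hq
  -- The four zeros are divided out one at a time; they are distinct because `r² = q ≠ 1` and `r ≠
  -- 0`.
  obtain ⟨G1, hG1, e1⟩ := exists_eq_sub_mul_of_eq_zero hG (hU _ one_ne_zero) h1
  obtain ⟨G2, hG2, e2⟩ := exists_eq_sub_mul_of_eq_zero hG1 (hU (-1) (by simp))
    (by have := e1 (-1); rw [h2] at this; norm_num at this; exact this)
  have e12 : ∀ w, G w = (w ^ 2 - 1) * G2 w := fun w => by rw [e1, e2]; ring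
  obtain ⟨G3, hG3, e3⟩ := exists_eq_sub_mul_of_eq_zero hG2 (hU r hr0)
    (by have := e12 r; rw [h3] at this; simpa [sub_eq_zero, hr1] using this.symm)
  obtain ⟨G4, hG4, e4⟩ := exists_eq_sub_mul_of_eq_zero hG3 (hU (-r) (by simpa))
    (by
      have := e12 (-r)
      rw [h4, e3, neg_sq] at this
      have hrr : -r - r ≠ 0 := by
        intro h
        exact hr0 (by linear_combination (-1 / 2 : ℂ) * h)
      simpa [sub_eq_zero, hr1, hrr] using this.symm)
  have eG : ∀ w, G w = (w ^ 2 - 1) * (w ^ 2 - q) * G4 w := fun w => by rw [e12, e3, e4, ← hr]; ring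
  set R : ℂ → ℂ := fun w => qShiftedFactorial (w ^ 2 * q) q * qShiftedFactorial (q / w ^ 2 * q) q
    with hR
  have eθ : ∀ w, jacobiThetaR (w ^ 2) q = (1 - w ^ 2) * (1 - q / w ^ 2) * R w := fun w => by
    rw [jacobiThetaR, qShiftedFactorial_rec (w ^ 2) hq, qShiftedFactorial_rec (q / w ^ 2) hq, hR]
    ring
  -- In this annulus `±1` and `±r` are the only zeros of `θ(w²)`: the remaining factor `R` vanishes
  -- only where `|w| ≤ |q|` or `|w|² ≥ |q|⁻¹`.
  set Ω : Set ℂ := {w : ℂ | ‖q‖ < ‖w‖ ∧ ‖w‖ < √(‖q‖⁻¹)} with hΩdef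
  have hΩ0 : ∀ w ∈ Ω, w ≠ 0 := fun w hw => norm_pos_iff.mp (hqp.trans hw.1)
  have hΩ2 : ∀ w ∈ Ω, ‖w‖ ^ 2 * ‖q‖ < 1 := fun w hw => by
    have := (Real.lt_sqrt (norm_nonneg w)).mp hw.2
    rwa [lt_inv_comm₀ (by have := hΩ0 w hw; positivity) hqp, ← one_div,
      lt_div_iff₀ (by have := hΩ0 w hw; positivity), mul_comm] at this
  have hΩ2' : ∀ w : ℂ, ‖q‖ < ‖w‖ → ‖w‖ ^ 2 * ‖q‖ < 1 → w ∈ Ω := fun w hw h => by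
    refine ⟨hw, (Real.lt_sqrt (norm_nonneg w)).mpr ?_⟩
    rwa [lt_inv_comm₀ (by have := hqp.trans hw; positivity) hqp, ← one_div,
      lt_div_iff₀ (by have := hqp.trans hw; positivity), mul_comm]
  have hΩo : IsOpen Ω := IsOpen.and (isOpen_lt (by fun_prop) (by fun_prop))
    (isOpen_lt (by fun_prop) (by fun_prop))
  have hR0 : ∀ w ∈ Ω, R w ≠ 0 := by
    intro w hw
    refine mul_ne_zero ?_ ?_
    · rw [Ne, qShiftedFactorial_eq_zero_iff hq]
      rintro ⟨j, hj⟩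
      have := congrArg norm hj
      rw [norm_mul, norm_mul, norm_pow, norm_pow, norm_one] at this
      nlinarith [hΩ2 w hw, pow_le_one₀ (norm_nonneg q) hq.le (n := j), pow_pos hqp j]
    · rw [Ne, qShiftedFactorial_eq_zero_iff hq]
      rintro ⟨j, hj⟩
      have hw0 := hΩ0 w hw
      have hj' : q ^ 2 * q ^ j = w ^ 2 := by
        field_simp at hj
        exact hj
      have := congrArg norm hj'
      rw [norm_mul, norm_pow, norm_pow, norm_pow] at this
      have h5 : ‖q‖ ^ 2 < ‖w‖ ^ 2 := by gcongr; exact hw.1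
      nlinarith [pow_le_one₀ (norm_nonneg q) hq.le (n := j), pow_pos hqp 2]
  -- The quotient `G(w) / θ(w²)` with its removable singularities filled in.
  set H : ℂ → ℂ := fun w => -w ^ 2 * G4 w / R w with hH
  have hHd : DifferentiableOn ℂ H Ω := by
    intro w hw
    have hw0 := hΩ0 w hw
    have hd := differentiable_qShiftedFactorial hq
    have hRd : DifferentiableAt ℂ R w := by
      refine ((hd _).comp (f := fun w : ℂ => w ^ 2 * q) w (by fun_prop)).mul
        ((hd _).comp (f := fun w : ℂ => q / w ^ 2 * q) w ?_)
      exact ((differentiableAt_const _).div (by fun_prop) (by positivity)).mul_const _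
    have hG4' : DifferentiableAt ℂ G4 w := hG4.differentiableAt (hU w hw0)
    exact ((by fun_prop : DifferentiableAt ℂ (fun w => -w ^ 2 * G4 w) w).div hRd
      (hR0 w hw)).differentiableWithinAt
  have hGH : ∀ w ∈ Ω, G w = H w * jacobiThetaR (w ^ 2) q := by
    intro w hw
    have hw0 := hΩ0 w hw
    have hRw := hR0 w hw
    rw [eG, eθ, hH]
    field_simp
    ring
  have θq : ∀ w, w ≠ 0 →
      jacobiThetaR ((w * q) ^ 2) q = q⁻¹ * (w ^ 4)⁻¹ * jacobiThetaR (w ^ 2) q := by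
    intro w hw
    rw [show (w * q) ^ 2 = w ^ 2 * q * q by ring, jacobiThetaR_mul_q hq0 hq (by positivity),
      jacobiThetaR_mul_q hq0 hq (by positivity)]
    field_simp
  -- If `w` and `w q` both lie in `Ω`, then `1 < |w| < |q|^{-1/2}`, so `θ(w²) ≠ 0` and the equal
  -- multipliers of `G` and `θ(w²)` can be cancelled.
  have hHq : ∀ w, w ∈ Ω → w * q ∈ Ω → H (w * q) = H w := by
    intro w hw hwq
    have hw0 := hΩ0 w hw
    have hw1 : 1 < ‖w‖ := by
      have := hwq.1
      rw [norm_mul] at this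
      nlinarith
    have hθ : jacobiThetaR (w ^ 2) q ≠ 0 := by
      rw [eθ]
      refine mul_ne_zero (mul_ne_zero ?_ ?_) (hR0 w hw)
      · intro h
        have := congrArg norm (sub_eq_zero.mp h)
        rw [norm_one, norm_pow] at this
        nlinarith
      · intro h
        have h' : w ^ 2 = q := by
          rw [sub_eq_zero, eq_div_iff (by positivity), one_mul] at h
          exact h
        have := congrArg norm h'
        rw [norm_pow] at this
        nlinarith
    have e := hGH _ hwq
    rw [hqG w hw0, θq w hw0, hGH w hw] at e
    have : q⁻¹ * (w ^ 4)⁻¹ * jacobiThetaR (w ^ 2) q ≠ 0 := by positivity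
    refine mul_right_cancel₀ this ?_
    rw [← e]
    ring
  -- Any `ρ > 1` with `|q| ρ < 1` and `ρ² |q| < 1` would do; for this one the last condition is `4
  -- |q| < (1 + |q|)²`.
  set ρ : ℝ := 2 / (1 + ‖q‖) with hρ
  have hρ1 : 1 < ρ := by
    rw [hρ, lt_div_iff₀ (by positivity)]
    linarith
  have hρq : ‖q‖ * ρ < 1 := by
    rw [hρ, mul_div_assoc', div_lt_one (by positivity)]
    linarith
  have hρ2 : ρ ^ 2 * ‖q‖ < 1 := by
    rw [hρ, div_pow, div_mul_eq_mul_div, div_lt_one (by positivity)]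
    nlinarith [sq_pos_of_pos (sub_pos.mpr hq)]
  set K : Set ℂ := {w : ℂ | ‖q‖ * ρ ≤ ‖w‖ ∧ ‖w‖ ≤ ρ} with hK
  have hKc : IsCompact K := by
    refine (isCompact_closedBall (0 : ℂ) ρ).of_isClosed_subset ?_ fun w hw => by simpa using hw.2
    exact IsClosed.and (isClosed_le (by fun_prop) (by fun_prop)) (isClosed_le (by fun_prop) (by fun_prop))
  have hKΩ : K ⊆ Ω := fun w hw => by
    refine hΩ2' w (by nlinarith [hw.1]) ?_
    have : ‖w‖ ^ 2 ≤ ρ ^ 2 := by gcongr; exact hw.2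
    nlinarith
  have hKne : K.Nonempty := ⟨1, by simpa [hK] using ⟨hρq.le, hρ1.le⟩⟩
  obtain ⟨w₀, hw₀, hmax⟩ := hKc.exists_isMaxOn hKne (hHd.mono hKΩ).continuousOn.norm
  -- The compact annulus `K` meets every orbit of `w ↦ w q` in `Ω`, so the maximum of `|H|` over `K`
  -- is attained in the open set `Ω` as a maximum over all of `Ω`, and the maximum principle
  -- applies.
  have hmaxΩ : IsMaxOn (norm ∘ H) Ω w₀ := by
    intro w hw
    change ‖H w‖ ≤ ‖H w₀‖
    rcases lt_or_ge ρ ‖w‖ with h | h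
    · have hlow : ‖q‖ * ρ ≤ ‖w * q‖ := by rw [norm_mul, mul_comm]; gcongr
      have hup : ‖w * q‖ ≤ ρ := by
        have := hΩ2 w hw
        rw [norm_mul]
        have : (‖w‖ * ‖q‖) ^ 2 < 1 := by nlinarith
        nlinarith [norm_nonneg w]
      have hm : w * q ∈ K := ⟨hlow, hup⟩
      rw [← hHq w hw (hKΩ hm)]
      exact hmax hm
    rcases lt_or_ge ‖w‖ (‖q‖ * ρ) with h' | h'
    · have hwq : w / q * q = w := div_mul_cancel₀ w hq0
      have hm : w / q ∈ K := by
        have hw1 := hw.1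
        refine ⟨?_, ?_⟩
        · rw [norm_div, le_div_iff₀ hqp]
          nlinarith
        · rw [norm_div, div_le_iff₀ hqp]
          linarith
      rw [← hwq, hHq (w / q) (hKΩ hm) (by rwa [hwq])]
      exact hmax hm
    · exact hmax ⟨h', h⟩
  have hconst := Complex.eqOn_of_isPreconnected_of_isMaxOn_norm (isPreconnected_annulus hqp) hΩo hHd
    (hKΩ hw₀) hmaxΩ
  refine ⟨H w₀, fun w hw => ?_⟩
  have step : ∀ v : ℂ, v ≠ 0 →
      (G (v * q) = H w₀ * jacobiThetaR ((v * q) ^ 2) q ↔ G v = H w₀ * jacobiThetaR (v ^ 2) q) := by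
    intro v hv
    rw [hqG v hv, θq v hv]
    have : q⁻¹ * (v ^ 4)⁻¹ ≠ 0 := by positivity
    rw [mul_left_comm (H w₀), mul_right_inj' this]
  have steps : ∀ n : ℤ, (G (w * q ^ n) = H w₀ * jacobiThetaR ((w * q ^ n) ^ 2) q ↔
      G w = H w₀ * jacobiThetaR (w ^ 2) q) := by
    intro n
    induction n with
    | zero => simp
    | succ n ih =>
      rw [← ih, zpow_add_one₀ hq0, ← mul_assoc, step _ (mul_ne_zero hw (zpow_ne_zero _ hq0))]
    | pred n ih =>
      rw [← ih, ← step _ (mul_ne_zero hw (zpow_ne_zero _ hq0)), mul_assoc, ← zpow_add_one₀ hq0,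
        sub_add_cancel]
  obtain ⟨n, hn1, hn2⟩ := exists_mul_zpow_norm_mem hq0 hq hw
  rw [← steps n]
  have hm : w * q ^ n ∈ Ω := hΩ2' _ hn1 (by nlinarith [norm_nonneg (w * q ^ n)])
  rw [hGH _ hm, hconst hm, Function.const_apply]

/-- The balancing condition gives the left side the multiplier `q⁻¹ w⁻⁴` of `θ(w²)` under `w ↦ w q`,
and the left side vanishes at the zeros of `θ(w²)`, so the two are proportional. Because `θ(w⁻²) =
-w⁻² θ(w²)`, division by `θ(w²)` turns the left side into a sum over `w ↔ 1 / w`; in this form the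
identity is used to break the symmetry of the integrand. -/
theorem jacobiThetaR_four_term {q A B ν ν' : ℂ} (hq0 : q ≠ 0) (hq : ‖q‖ < 1) (hA : A ≠ 0)
    (hB : B ≠ 0) (hν : ν ≠ 0) (hbal : A * B * ν * ν' = q) (hA2 : ∀ n : ℤ, A ^ 2 ≠ q ^ n)
    {w : ℂ} (hw : w ≠ 0) :
    jacobiThetaR (A * w) q * jacobiThetaR (B * w) q * jacobiThetaR (ν * w) q *
        jacobiThetaR (ν' * w) q -
      w ^ 2 * (jacobiThetaR (A * w⁻¹) q * jacobiThetaR (B * w⁻¹) q * jacobiThetaR (ν * w⁻¹) q *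
        jacobiThetaR (ν' * w⁻¹) q) =
    jacobiThetaR (A * B) q * jacobiThetaR (ν * A) q * jacobiThetaR (ν * B) q *
      jacobiThetaR (w ^ 2) q := by
  have hν' : ν' ≠ 0 := by
    rintro rfl
    exact hq0 (by simp [← hbal])
  obtain ⟨r, hr⟩ := IsAlgClosed.exists_pow_nat_eq q (n := 2) (by norm_num)
  have hr0 : r ≠ 0 := by
    rintro rfl
    exact hq0 (by simp [← hr])
  set T : ℂ → ℂ := fun w => jacobiThetaR (A * w) q * jacobiThetaR (B * w) q *
    jacobiThetaR (ν * w) q * jacobiThetaR (ν' * w) q with hT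
  have hTd : ∀ w, w ≠ 0 → DifferentiableAt ℂ T w := by
    intro w hw
    have h : ∀ c : ℂ, c ≠ 0 → DifferentiableAt ℂ (fun w => jacobiThetaR (c * w) q) w := fun c hc =>
      (differentiableAt_jacobiThetaR hq (mul_ne_zero hc hw)).comp (f := fun w => c * w) w
        (by fun_prop)
    exact (((h A hA).mul (h B hB)).mul (h ν hν)).mul (h ν' hν')
  have hTq : ∀ w, w ≠ 0 → T (w * q) = q⁻¹ * (w ^ 4)⁻¹ * T w := by
    intro w hw
    simp only [hT, ← mul_assoc _ w q]
    rw [jacobiThetaR_mul_q hq0 hq (mul_ne_zero hA hw), jacobiThetaR_mul_q hq0 hq (mul_ne_zero hB hw),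
      jacobiThetaR_mul_q hq0 hq (mul_ne_zero hν hw), jacobiThetaR_mul_q hq0 hq (mul_ne_zero hν' hw)]
    have : q⁻¹ = (A * B * ν * ν')⁻¹ := by rw [hbal]
    rw [this]
    field_simp
  have hTq' : ∀ w, w ≠ 0 → T (w * q)⁻¹ = q⁻¹ ^ 3 * (w ^ 4)⁻¹ * T w⁻¹ := by
    intro w hw
    have h := hTq (w * q)⁻¹ (by positivity)
    have e : (w * q)⁻¹ * q = w⁻¹ := by field_simp
    rw [e] at h
    rw [h]
    field_simp
  -- Vanishing at `±1` is the symmetry `w ↔ 1 / w`; vanishing at `±r` follows from quasi-periodicity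
  -- at `±r⁻¹`, since `r⁻¹ q = r`.
  obtain ⟨c, hc⟩ := exists_eq_const_mul_jacobiThetaR_sq (G := fun w => T w - w ^ 2 * T w⁻¹) hq0 hq hr
    (fun w hw => by
      have hw0 : w ≠ 0 := hw
      have h2 : DifferentiableAt ℂ (fun w => T w⁻¹) w :=
        (hTd w⁻¹ (inv_ne_zero hw0)).comp (f := fun w => w⁻¹) w (differentiableAt_inv hw0)
      have h1 := hTd w hw0
      exact (h1.sub ((by fun_prop : DifferentiableAt ℂ (fun w : ℂ => w ^ 2) w).mul
        h2)).differentiableWithinAt)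
    (fun w hw => by
      rw [hTq w hw, hTq' w hw]
      field_simp)
    (by simp) (by simp [inv_neg])
    (by
      have h := hTq r⁻¹ (by positivity)
      have e : r⁻¹ * q = r := by rw [← hr]; field_simp
      rw [e] at h
      simp only [h, ← hr]
      field_simp
      ring)
    (by
      have h := hTq (-r)⁻¹ (by simpa)
      have e : (-r)⁻¹ * q = -r := by rw [← hr]; field_simp
      rw [e] at h
      simp only [h, ← hr]
      field_simp
      ring)
  have hAne : jacobiThetaR (A ^ 2) q ≠ 0 := by
    rw [Ne, jacobiThetaR_eq_zero_iff hq0 hq (by positivity)]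
    rintro ⟨n, hn⟩
    exact hA2 n hn
  -- At `w = A⁻¹` the first product contains `θ(1) = 0`. In the second, `ν' A = q / (ν B)`, and the
  -- common factor `θ(A²)` is nonzero by `hA2`.
  have hcv : c = jacobiThetaR (A * B) q * jacobiThetaR (ν * A) q * jacobiThetaR (ν * B) q := by
    have h := hc A⁻¹ (inv_ne_zero hA)
    simp only [hT, inv_inv, mul_inv_cancel₀ hA, jacobiThetaR_one hq] at h
    have e : (A⁻¹) ^ 2 = (A ^ 2)⁻¹ := by simp
    have e2 : ν' * A = q / (ν * B) := by
      rw [← hbal]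
      field_simp
    rw [e, jacobiThetaR_inv hq (by positivity), e2, jacobiThetaR_q_div _ hq0, ← sq, mul_comm B A] at h
    have h3 : (-(A ^ 2)⁻¹ * jacobiThetaR (A ^ 2) q) ≠ 0 :=
      mul_ne_zero (neg_ne_zero.mpr (by positivity)) hAne
    refine mul_right_cancel₀ h3 ?_
    rw [← h]
    ring
  have := hc w hw
  rw [hcv] at this
  exact this

/-! ### Integrals along closed curves -/

theorem continuous_deriv_mul_comp {γ : ℝ → ℂ} (hγ : ContDiff ℝ 1 γ) {f : ℂ → ℂ}
    (hf : Continuous fun x => f (γ x)) : Continuous fun x => deriv γ x * f (γ x) :=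
  (hγ.continuous_deriv le_rfl).mul hf

theorem continuous_comp_of_differentiableAt {γ : ℝ → ℂ} (hγ : Continuous γ) {f : ℂ → ℂ}
    (hf : ∀ x, DifferentiableAt ℂ f (γ x)) : Continuous fun x => f (γ x) :=
  continuous_iff_continuousAt.mpr fun x =>
    ContinuousAt.comp (f := γ) (hf x).continuousAt hγ.continuousAt

theorem loopIntegral_congr {γ : ℝ → ℂ} {f g : ℂ → ℂ} (h : ∀ x, f (γ x) = g (γ x)) :
    loopIntegral γ f = loopIntegral γ g := by
  unfold loopIntegral
  simp_rw [h]

theorem loopIntegral_add {γ : ℝ → ℂ} (hγ : ContDiff ℝ 1 γ) {f g : ℂ → ℂ}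
    (hf : Continuous fun x => f (γ x)) (hg : Continuous fun x => g (γ x)) :
    loopIntegral γ (fun z => f z + g z) = loopIntegral γ f + loopIntegral γ g := by
  unfold loopIntegral
  rw [← intervalIntegral.integral_add
    ((continuous_deriv_mul_comp hγ hf).intervalIntegrable _ _)
    ((continuous_deriv_mul_comp hγ hg).intervalIntegrable _ _)]
  simp_rw [mul_add]

theorem loopIntegral_const_mul (γ : ℝ → ℂ) (c : ℂ) (f : ℂ → ℂ) :
    loopIntegral γ (fun z => c * f z) = c * loopIntegral γ f := by
  unfold loopIntegral
  rw [← intervalIntegral.integral_const_mul]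
  simp_rw [mul_left_comm]

theorem loopIntegral_eq_sub {γ : ℝ → ℂ} (hγ : ContDiff ℝ 1 γ) {f H : ℂ → ℂ}
    (hf : Continuous fun x => f (γ x)) (hH : ∀ x, HasDerivAt H (f (γ x)) (γ x)) :
    loopIntegral γ f = H (γ 1) - H (γ 0) := by
  unfold loopIntegral
  refine intervalIntegral.integral_eq_sub_of_hasDerivAt (f := fun x => H (γ x)) (fun x _ => ?_)
    ((continuous_deriv_mul_comp hγ hf).intervalIntegrable _ _)
  have h := (hγ.differentiable one_ne_zero x).hasDerivAt
  rw [mul_comm]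
  exact (hH x).comp x h

theorem loopIntegral_eq_zero_of_hasDerivAt {γ : ℝ → ℂ} (hγ : ContDiff ℝ 1 γ) (hc : γ 1 = γ 0)
    {f H : ℂ → ℂ} (hf : Continuous fun x => f (γ x)) (hH : ∀ x, HasDerivAt H (f (γ x)) (γ x)) :
    loopIntegral γ f = 0 := by
  rw [loopIntegral_eq_sub hγ hf hH, hc, sub_self]

theorem continuous_inv_sub_comp {γ : ℝ → ℂ} (hγ : Continuous γ) {a : ℂ} (ha : ∀ x, γ x ≠ a) :
    Continuous fun x => (γ x - a)⁻¹ :=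
  (hγ.sub continuous_const).inv₀ fun x => sub_ne_zero.mpr (ha x)

/-- On the disc about `c` containing the curve, `log (1 - (z - c) / (a - c))` is a primitive of `(z
- a)⁻¹`. -/
theorem loopWinding_eq_zero_of_norm_lt {γ : ℝ → ℂ} (hγ : ContDiff ℝ 1 γ) (hc : γ 1 = γ 0)
    {a c : ℂ} (h : ∀ x, ‖γ x - c‖ < ‖a - c‖) : loopWinding γ a = 0 := by
  have hne : ∀ x, γ x ≠ a := fun x hx => by simpa [hx] using h x
  unfold loopWinding
  rw [loopIntegral_eq_zero_of_hasDerivAt hγ hc (continuous_inv_sub_comp hγ.continuous hne)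
    (H := fun z => Complex.log (1 + -((z - c) / (a - c)))), mul_zero]
  intro x
  have hac : a - c ≠ 0 := norm_pos_iff.mp ((norm_nonneg _).trans_lt (h x))
  have hs : 1 + -((γ x - c) / (a - c)) ∈ Complex.slitPlane := by
    refine Complex.mem_slitPlane_of_norm_lt_one ?_
    rw [norm_neg, norm_div, div_lt_one (norm_pos_iff.mpr hac)]
    exact h x
  have h1 : HasDerivAt (fun z : ℂ => 1 + -((z - c) / (a - c))) (-(1 / (a - c))) (γ x) :=
    ((((hasDerivAt_id _).sub_const c).div_const (a - c)).neg).const_add 1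
  convert! h1.clog hs using 1
  have h3 : γ x - a ≠ 0 := sub_ne_zero.mpr (hne x)
  have h4 : 1 + -((γ x - c) / (a - c)) ≠ 0 := Complex.slitPlane_ne_zero hs
  have e : 1 + -((γ x - c) / (a - c)) = -(γ x - a) / (a - c) := by
    field_simp
    ring
  rw [e]
  field_simp

/-- The difference of the two integrands has the primitive `log ((z - a) / (z - c))`: along the
curve its argument stays within distance `1` of `1`. -/
theorem loopWinding_eq_of_norm_lt {γ : ℝ → ℂ} (hγ : ContDiff ℝ 1 γ) (hc : γ 1 = γ 0)
    {a c : ℂ} (h : ∀ x, ‖a - c‖ < ‖γ x - c‖) : loopWinding γ a = loopWinding γ c := by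
  have hne : ∀ x, γ x ≠ a := fun x hx => by simpa [hx] using h x
  have hne' : ∀ x, γ x ≠ c := fun x hx => by
    have := h x
    rw [hx, sub_self, norm_zero] at this
    exact absurd this (not_lt.mpr (norm_nonneg _))
  have hca := continuous_inv_sub_comp hγ.continuous hne
  have hcc := continuous_inv_sub_comp hγ.continuous hne'
  have h0 : loopIntegral γ (fun z => (z - a)⁻¹ + (-1) * (z - c)⁻¹) = 0 := by
    refine loopIntegral_eq_zero_of_hasDerivAt hγ hc (hca.add (continuous_const.mul hcc))
      (H := fun z => Complex.log (1 + -((a - c) / (z - c)))) fun x => ?_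
    have hzc : γ x - c ≠ 0 := sub_ne_zero.mpr (hne' x)
    have hza : γ x - a ≠ 0 := sub_ne_zero.mpr (hne x)
    have hs : 1 + -((a - c) / (γ x - c)) ∈ Complex.slitPlane := by
      refine Complex.mem_slitPlane_of_norm_lt_one ?_
      rw [norm_neg, norm_div, div_lt_one (norm_pos_iff.mpr hzc)]
      exact h x
    have h1 : HasDerivAt (fun z : ℂ => 1 + -((a - c) / (z - c)))
        (-((0 * (γ x - c) - (a - c) * 1) / (γ x - c) ^ 2)) (γ x) :=
      ((((hasDerivAt_const _ _)).div ((hasDerivAt_id _).sub_const c) hzc).neg).const_add 1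
    convert! h1.clog hs using 1
    have h4 : 1 + -((a - c) / (γ x - c)) ≠ 0 := Complex.slitPlane_ne_zero hs
    have e : 1 + -((a - c) / (γ x - c)) = (γ x - a) / (γ x - c) := by
      field_simp
      ring
    rw [e]
    field_simp
    ring
  rw [loopIntegral_add (f := fun z => (z - a)⁻¹) (g := fun z => (-1) * (z - c)⁻¹) hγ hca
    (continuous_const.mul hcc), loopIntegral_const_mul] at h0
  unfold loopWinding
  congr 1
  linear_combination h0

/-- Two functions which agree off a countable set have the same integral, even if the curve meets
that set. -/
theorem loopIntegral_congr_of_countable {γ : ℝ → ℂ} (hγ : Differentiable ℝ γ) {f g : ℂ → ℂ}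
    {J : Set ℂ} (hJ : J.Countable) (h : ∀ x, γ x ∉ J → f (γ x) = g (γ x)) :
    loopIntegral γ f = loopIntegral γ g := by
  -- Visits to `a` with nonzero velocity are isolated, hence countable. Visits with zero velocity
  -- are harmless because `deriv γ` is a factor of both integrands.
  have hc : ∀ a, {x | γ x = a ∧ deriv γ x ≠ 0}.Countable := by
    intro a
    rw [← Set.countable_coe_iff]
    have : DiscreteTopology {x | γ x = a ∧ deriv γ x ≠ 0} := by
      rw [discreteTopology_subtype_iff]
      intro x hx
      rw [← disjoint_iff, Filter.disjoint_principal_right]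
      filter_upwards [(hγ x).hasDerivAt.eventually_ne (c := a) hx.2] with y hy
      exact fun hy' => hy hy'.1
    exact countable_of_Lindelof_of_discrete
  have hcJ : (⋃ a ∈ J, {x | γ x = a ∧ deriv γ x ≠ 0}).Countable := hJ.biUnion fun a _ => hc a
  refine intervalIntegral.integral_congr_ae ?_
  filter_upwards [hcJ.ae_notMem MeasureTheory.volume] with x hx _
  by_cases hxJ : γ x ∈ J
  · have : deriv γ x = 0 := by
      by_contra hd
      exact hx (Set.mem_biUnion hxJ ⟨rfl, hd⟩)
    simp [this]
  · rw [h x hxJ]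

/-- The integral of a function that is holomorphic in an annulus is the same for all closed curves
which wind once around the origin. -/
theorem exists_loopIntegral_eq_of_annulus {r R : ℝ} (hr : 0 < r) {g : ℂ → ℂ}
    (hg : DifferentiableOn ℂ g {z | r < ‖z‖ ∧ ‖z‖ < R}) :
    ∃ C : ℂ, ∀ γ : ℝ → ℂ, ContDiff ℝ 1 γ → γ 1 = γ 0 → (∀ x, r < ‖γ x‖ ∧ ‖γ x‖ < R) →
      loopWinding γ 0 = 1 → loopIntegral γ g = C := by
  rcases le_or_gt R r with hR | hR
  · exact ⟨0, fun γ _ _ h _ => by linarith [(h 0).1, (h 0).2]⟩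
  set V : Set ℂ := {u : ℂ | Real.log r < u.re ∧ u.re < Real.log R} with hV
  have hVc : Convex ℝ V := (convex_halfSpace_re_gt _).inter (convex_halfSpace_re_lt _)
  have hVo : IsOpen V := IsOpen.and (isOpen_lt (by fun_prop) (by fun_prop))
    (isOpen_lt (by fun_prop) (by fun_prop))
  have hmem : ∀ u, r < ‖Complex.exp u‖ ∧ ‖Complex.exp u‖ < R ↔ u ∈ V := fun u => by
    rw [Complex.norm_exp, ← Real.log_lt_iff_lt_exp hr, ← Real.lt_log_iff_exp_lt (hr.trans hR)]
    rfl
  have hgo : IsOpen {z : ℂ | r < ‖z‖ ∧ ‖z‖ < R} := IsOpen.and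
    (isOpen_lt (by fun_prop) (by fun_prop)) (isOpen_lt (by fun_prop) (by fun_prop))
  have hgd : ∀ u ∈ V, DifferentiableAt ℂ g (Complex.exp u) := fun u hu =>
    hg.differentiableAt (hgo.mem_nhds ((hmem u).mpr hu))
  -- The pullback of `g(z) dz` under `exp` to a convex strip, where a primitive `H` exists.
  set h : ℂ → ℂ := fun u => Complex.exp u * g (Complex.exp u) with hh
  have hhd : DifferentiableOn ℂ h V := fun u hu =>
    (Complex.differentiableAt_exp.mul
      ((hgd u hu).comp u Complex.differentiableAt_exp)).differentiableWithinAt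
  obtain ⟨H, hH'⟩ := hVc.exists_forall_hasDerivWithinAt hhd
  have hH : ∀ u ∈ V, HasDerivAt H (h u) u := fun u hu =>
    (hH' u hu).hasDerivAt (hVo.mem_nhds hu)
  have hshift : ∀ u ∈ V, u + 2 * Real.pi * Complex.I ∈ V := fun u hu => by simpa [hV] using hu
  have hper : ∀ u, h (u + 2 * Real.pi * Complex.I) = h u := fun u => by
    simp only [hh, Complex.exp_periodic u]
  have hdif : ∀ u ∈ V, HasDerivAt (fun u => H (u + 2 * Real.pi * Complex.I) - H u) 0 u := by
    intro u hu
    have h1 := (hH _ (hshift u hu)).comp_add_const u (2 * Real.pi * Complex.I)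
    rw [hper] at h1
    rw [← sub_self (h u)]
    exact h1.sub (hH u hu)
  -- The increment of `H` over the period `2πi` is independent of the base point; it is the common
  -- value of all the integrals.
  obtain ⟨C, hC⟩ : ∃ C, ∀ u ∈ V, H (u + 2 * Real.pi * Complex.I) - H u = C :=
    hVo.exists_is_const_of_deriv_eq_zero hVc.isPreconnected
      (fun u hu => (hdif u hu).differentiableAt.differentiableWithinAt) (fun u hu => (hdif u hu).deriv)
  refine ⟨C, fun γ hγ hc hγr hw => ?_⟩
  have hγ0 : ∀ x, γ x ≠ 0 := fun x => norm_pos_iff.mp (hr.trans (hγr x).1)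
  have hcd := hγ.continuous_deriv le_rfl
  have hcl : Continuous fun x => deriv γ x / γ x := hcd.div hγ.continuous hγ0
  -- A continuous logarithm of `γ`. Winding number `1` about `0` says precisely that it ends `2πi`
  -- above its start.
  set l : ℝ → ℂ := fun x => Complex.log (γ 0) + ∫ y in (0 : ℝ)..x, deriv γ y / γ y with hl
  have hld : ∀ x, HasDerivAt l (deriv γ x / γ x) x := fun x =>
    (intervalIntegral.integral_hasDerivAt_right (hcl.intervalIntegrable _ _)
      (hcl.stronglyMeasurableAtFilter _ _) hcl.continuousAt).const_add _
  have hexp : ∀ x, Complex.exp (l x) = γ x := by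
    have hd : ∀ x, HasDerivAt (fun x => Complex.exp (-l x) * γ x) 0 x := by
      intro x
      have h1 := ((hld x).neg.cexp).mul (hγ.differentiable one_ne_zero x).hasDerivAt
      convert! h1 using 1
      have := hγ0 x
      simp only [Pi.neg_apply]
      field_simp
      ring
    intro x
    have h1 := is_const_of_deriv_eq_zero (fun x => (hd x).differentiableAt) (fun x => (hd x).deriv) x 0
    have h2 : l 0 = Complex.log (γ 0) := by simp [hl]
    rw [h2, Complex.exp_neg, Complex.exp_neg, Complex.exp_log (hγ0 0), inv_mul_cancel₀ (hγ0 0)] at h1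
    rw [← mul_one (Complex.exp (l x)), ← h1, mul_inv_cancel_left₀ (Complex.exp_ne_zero _)]
  have hlV : ∀ x, l x ∈ V := fun x => (hmem _).mp (by rw [hexp]; exact hγr x)
  have hl1 : l 1 = l 0 + 2 * Real.pi * Complex.I := by
    have h1 : loopIntegral γ (fun z => (z - 0)⁻¹) = 2 * Real.pi * Complex.I := by
      rw [loopWinding, inv_mul_eq_one₀ Complex.two_pi_I_ne_zero] at hw
      exact hw.symm
    simp only [loopIntegral, sub_zero, ← div_eq_mul_inv] at h1
    simp [hl, h1]
  have hgγ : Continuous fun x => g (γ x) :=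
    continuous_comp_of_differentiableAt hγ.continuous fun x => by rw [← hexp]; exact hgd _ (hlV x)
  have key : loopIntegral γ g = H (l 1) - H (l 0) := by
    refine intervalIntegral.integral_eq_sub_of_hasDerivAt (f := fun x => H (l x)) (fun x _ => ?_)
      ((continuous_deriv_mul_comp hγ hgγ).intervalIntegrable _ _)
    have h1 := (hH _ (hlV x)).comp x (hld x)
    convert! h1 using 1
    have := hγ0 x
    simp only [hh, hexp]
    field_simp
  rw [key, hl1, hC _ (hlV 0)]

/-- Poles of order at least two have single-valued primitives, so only simple poles see the winding
number. -/
theorem loopIntegral_zpow_eq_zero {γ : ℝ → ℂ} (hγ : ContDiff ℝ 1 γ) (hc : γ 1 = γ 0) {a : ℂ}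
    (ha : ∀ x, γ x ≠ a) (n : ℕ) : loopIntegral γ (fun z => ((z - a) ^ (n + 2))⁻¹) = 0 := by
  have h0 : ∀ x, γ x - a ≠ 0 := fun x => sub_ne_zero.mpr (ha x)
  refine loopIntegral_eq_zero_of_hasDerivAt hγ hc
    (((hγ.continuous.sub continuous_const).pow _).inv₀ fun x => pow_ne_zero _ (h0 x))
    (H := fun z => -((n : ℂ) + 1)⁻¹ * ((z - a) ^ (n + 1))⁻¹) fun x => ?_
  have h1 := (((((hasDerivAt_id (γ x)).sub_const a).pow (n + 1)).inv
    (pow_ne_zero _ (h0 x))).const_mul (-((n : ℂ) + 1)⁻¹))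
  convert! h1 using 1
  have := h0 x
  have hn : (n : ℂ) + 1 ≠ 0 := by exact_mod_cast Nat.succ_ne_zero n
  simp only [id, Pi.pow_apply, Nat.cast_add, Nat.cast_one, add_tsub_cancel_right, mul_one]
  field_simp
  ring

/-- Two closed curves for which Cauchy's theorem holds in `U`, and which wind equally often around
the poles of a meromorphic function, give the same integral. -/
theorem loopIntegral_eq_of_meromorphic {γ₁ γ₂ : ℝ → ℂ} (h₁ : ContDiff ℝ 1 γ₁) (c₁ : γ₁ 1 = γ₁ 0)
    (h₂ : ContDiff ℝ 1 γ₂) (c₂ : γ₂ 1 = γ₂ 0) {U : Set ℂ} (hU : IsOpen U)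
    (m₁ : ∀ x, γ₁ x ∈ U) (m₂ : ∀ x, γ₂ x ∈ U)
    (hbase : ∀ g, DifferentiableOn ℂ g U → loopIntegral γ₁ g = loopIntegral γ₂ g)
    (S : Finset ℂ) (hS : ∀ a ∈ S, a ∈ U) (n₁ : ∀ x, γ₁ x ∉ S) (n₂ : ∀ x, γ₂ x ∉ S)
    (hw : ∀ a ∈ S, loopWinding γ₁ a = loopWinding γ₂ a) {f : ℂ → ℂ}
    (hf : DifferentiableOn ℂ f (U \ S)) (hm : ∀ a ∈ S, MeromorphicAt f a) :
    loopIntegral γ₁ f = loopIntegral γ₂ f := by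
  classical
  induction S using Finset.induction_on generalizing f with
  | empty => exact hbase f (by simpa using hf)
  | insert a S ha ih =>
    have hoS : IsOpen (U \ (S : Set ℂ)) := hU.sdiff S.finite_toSet.isClosed
    have hoI : IsOpen (U \ ((insert a S : Finset ℂ) : Set ℂ)) :=
      hU.sdiff (insert a S).finite_toSet.isClosed
    have haU : a ∈ U := hS a (by simp)
    have haS : a ∈ U \ (S : Set ℂ) := ⟨haU, by simpa using ha⟩
    have k₁ : ∀ x, γ₁ x ≠ a := fun x hx => n₁ x (by simp [hx])
    have k₂ : ∀ x, γ₂ x ≠ a := fun x hx => n₂ x (by simp [hx])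
    -- Induction on a bound `n` for the order of the pole at `a`: subtracting `φ(a) / (z - a)^(n +
    -- 1)` lowers the bound by one, with `dslope φ a` as the new regular part.
    have main : ∀ (n : ℕ) (f φ : ℂ → ℂ),
        DifferentiableOn ℂ f (U \ ((insert a S : Finset ℂ) : Set ℂ)) →
        (∀ b ∈ insert a S, MeromorphicAt f b) → DifferentiableOn ℂ φ (U \ S) →
        (∀ z ∈ U \ ((insert a S : Finset ℂ) : Set ℂ), (z - a) ^ n * f z = φ z) →
        loopIntegral γ₁ f = loopIntegral γ₂ f := by
      intro n
      induction n with
      | zero =>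
        intro f φ hf hm hφ hfφ
        simp only [pow_zero, one_mul] at hfφ
        rw [loopIntegral_congr (γ := γ₁) (g := φ) fun x => hfφ _ ⟨m₁ x, n₁ x⟩,
          loopIntegral_congr (γ := γ₂) (g := φ) fun x => hfφ _ ⟨m₂ x, n₂ x⟩]
        refine ih (fun b hb => hS b (by simp [hb])) (fun x hx => n₁ x (Finset.mem_insert_of_mem hx))
          (fun x hx => n₂ x (Finset.mem_insert_of_mem hx)) (fun b hb => hw b (by simp [hb])) hφ
          fun b hb => ?_
        refine (hm b (by simp [hb])).congr ?_
        have hbU : b ∈ U := hS b (by simp [hb])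
        have hfin : ((((insert a S).erase b : Finset ℂ) : Set ℂ))ᶜ ∈ 𝓝 b :=
          ((insert a S).erase b).finite_toSet.isClosed.isOpen_compl.mem_nhds (by simp)
        filter_upwards [nhdsWithin_le_nhds (hU.mem_nhds hbU), nhdsWithin_le_nhds hfin,
          self_mem_nhdsWithin] with z hz1 hz2 hz3
        refine hfφ z ⟨hz1, fun hz4 => hz2 ?_⟩
        simp only [Finset.mem_coe, Finset.mem_erase]
        exact ⟨hz3, by simpa using hz4⟩
      | succ n ihn =>
        intro f φ hf hm hφ hfφ
        set P : ℂ → ℂ := fun z => ((z - a) ^ (n + 1))⁻¹ with hP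
        have hPd : ∀ z, z ≠ a → DifferentiableAt ℂ P z := fun z hz =>
          (by fun_prop : DifferentiableAt ℂ (fun z => (z - a) ^ (n + 1)) z).inv
            (pow_ne_zero _ (sub_ne_zero.mpr hz))
        have hPm : ∀ z, MeromorphicAt P z := fun z =>
          ((by fun_prop : AnalyticAt ℂ (fun z => (z - a) ^ (n + 1)) z).meromorphicAt).inv
        have hfc : ∀ z ∈ U \ ((insert a S : Finset ℂ) : Set ℂ), DifferentiableAt ℂ f z :=
          fun z hz => hf.differentiableAt (hoI.mem_nhds hz)
        have hna : ∀ z ∈ U \ ((insert a S : Finset ℂ) : Set ℂ), z ≠ a := by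
          rintro z ⟨_, hz⟩ rfl
          simp at hz
        have hf1 := ihn (fun z => f z + (-φ a) * P z) (dslope φ a)
          (fun z hz => ((hfc z hz).add ((hPd z (hna z hz)).const_mul _)).differentiableWithinAt)
          (fun b hb => (hm b hb).add ((MeromorphicAt.const _ _).mul (hPm b)))
          ((Complex.differentiableOn_dslope (hoS.mem_nhds haS)).mpr hφ)
          (fun z hz => by
            have hza : z - a ≠ 0 := sub_ne_zero.mpr (hna z hz)
            have e := hfφ z hz
            rw [dslope_of_ne _ (hna z hz), slope_def_field, ← e, hP]
            field_simp
            ring)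
        have hsplit : ∀ γ : ℝ → ℂ, ContDiff ℝ 1 γ → (∀ x, γ x ∈ U) →
            (∀ x, γ x ∉ insert a S) → loopIntegral γ (fun z => f z + (-φ a) * P z) =
              loopIntegral γ f + (-φ a) * loopIntegral γ P := by
          intro γ hγ hγU hγS
          have hmem : ∀ x, γ x ∈ U \ ((insert a S : Finset ℂ) : Set ℂ) := fun x => ⟨hγU x, hγS x⟩
          rw [loopIntegral_add hγ, loopIntegral_const_mul]
          · exact continuous_comp_of_differentiableAt hγ.continuous fun x => hfc _ (hmem x)
          · exact continuous_const.mul (continuous_comp_of_differentiableAt hγ.continuous fun x =>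
              hPd _ (hna _ (hmem x)))
        -- For `n = 0` this is the equality of winding numbers; for higher powers both integrals
        -- vanish.
        have hPe : loopIntegral γ₁ P = loopIntegral γ₂ P := by
          rcases n with _ | n
          · have := hw a (by simp)
            simp only [loopWinding] at this
            have h2 := mul_left_cancel₀ (inv_ne_zero Complex.two_pi_I_ne_zero) this
            simpa [hP] using h2
          · rw [hP, loopIntegral_zpow_eq_zero h₁ c₁ k₁, loopIntegral_zpow_eq_zero h₂ c₂ k₂]
        rw [hsplit γ₁ h₁ m₁ n₁, hsplit γ₂ h₂ m₂ n₂, hPe] at hf1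
        exact add_right_cancel hf1
    obtain ⟨n, hn⟩ := hm a (by simp)
    refine main n f (fun z => (z - a) ^ n * f z) hf hm (fun z hz => ?_) fun z _ => rfl
    by_cases hza : z = a
    · subst hza
      exact hn.differentiableAt.differentiableWithinAt
    · have hz' : z ∈ U \ ((insert a S : Finset ℂ) : Set ℂ) :=
        ⟨hz.1, by simpa [hza] using hz.2⟩
      exact ((by fun_prop : DifferentiableAt ℂ (fun z => (z - a) ^ n) z).mul
        (hf.differentiableAt (hoI.mem_nhds hz'))).differentiableWithinAt

theorem exists_norm_bounds {γ : ℝ → ℂ} (hγ : Continuous γ) (hp : Function.Periodic γ 1)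
    (h0 : ∀ x, γ x ≠ 0) : ∃ r R : ℝ, 0 < r ∧ ∀ x, r < ‖γ x‖ ∧ ‖γ x‖ < R := by
  have hK : IsCompact (Set.range γ) := hp.compact_of_continuous one_ne_zero hγ
  obtain ⟨R, hR⟩ := hK.isBounded.exists_norm_le
  obtain ⟨w, ⟨y, rfl⟩, hy⟩ := hK.exists_isMinOn (Set.range_nonempty γ) continuous_norm.continuousOn
  refine ⟨‖γ y‖ / 2, R + 1, half_pos (norm_pos_iff.mpr (h0 y)), fun x => ⟨?_, ?_⟩⟩
  · have h1 : ‖γ y‖ ≤ ‖γ x‖ := hy (Set.mem_range_self x)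
    have := norm_pos_iff.mpr (h0 y)
    linarith
  · linarith [hR _ (Set.mem_range_self x)]

theorem IsSeparatingContour.closed {D E : Set ℂ} {γ : ℝ → ℂ} (h : IsSeparatingContour D E γ) :
    γ 1 = γ 0 := by
  simpa using h.periodic 0

/-- Independence of the contour. -/
theorem IsSeparatingContour.loopIntegral_eq {D E D' E' S : Set ℂ} {γ γ' : ℝ → ℂ}
    (h : IsSeparatingContour D E γ) (h' : IsSeparatingContour D' E' γ')
    (hS : ∀ z ∈ S, z ∈ D ∧ z ∈ D' ∨ z ∈ E ∧ z ∈ E')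
    (hfin : ∀ r R : ℝ, 0 < r → (S ∩ {z | r < ‖z‖ ∧ ‖z‖ < R}).Finite) {f : ℂ → ℂ}
    (hm : ∀ z, z ≠ 0 → MeromorphicAt f z) (hf : ∀ z, z ≠ 0 → z ∉ S → DifferentiableAt ℂ f z) :
    loopIntegral γ f = loopIntegral γ' f := by
  obtain ⟨r₁, R₁, hr₁, hb₁⟩ := exists_norm_bounds h.contDiff.continuous h.periodic h.ne_zero
  obtain ⟨r₂, R₂, hr₂, hb₂⟩ := exists_norm_bounds h'.contDiff.continuous h'.periodic h'.ne_zero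
  set r := min r₁ r₂ with hrdef
  set R := max R₁ R₂ with hRdef
  have hr : 0 < r := lt_min hr₁ hr₂
  have hb₁' : ∀ x, r < ‖γ x‖ ∧ ‖γ x‖ < R := fun x =>
    ⟨(min_le_left _ _).trans_lt (hb₁ x).1, (hb₁ x).2.trans_le (le_max_left _ _)⟩
  have hb₂' : ∀ x, r < ‖γ' x‖ ∧ ‖γ' x‖ < R := fun x =>
    ⟨(min_le_right _ _).trans_lt (hb₂ x).1, (hb₂ x).2.trans_le (le_max_right _ _)⟩
  have hne : ∀ z : ℂ, r < ‖z‖ ∧ ‖z‖ < R → z ≠ 0 := fun z hz => norm_pos_iff.mp (hr.trans hz.1)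
  have hF := hfin r R hr
  refine loopIntegral_eq_of_meromorphic h.contDiff h.closed h'.contDiff h'.closed
    (IsOpen.and (isOpen_lt (by fun_prop) (by fun_prop)) (isOpen_lt (by fun_prop) (by fun_prop)) :
      IsOpen {z : ℂ | r < ‖z‖ ∧ ‖z‖ < R}) hb₁' hb₂' (fun g hg => ?_) hF.toFinset
    (fun a ha => ((hF.mem_toFinset).mp ha).2) (fun x hx => ?_) (fun x hx => ?_) (fun a ha => ?_)
    (fun z hz => ?_) (fun a ha => ?_)
  · obtain ⟨C, hC⟩ := exists_loopIntegral_eq_of_annulus hr hg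
    rw [hC γ h.contDiff h.closed hb₁' h.winding_zero, hC γ' h'.contDiff h'.closed hb₂' h'.winding_zero]
  · rcases hS _ ((hF.mem_toFinset).mp hx).1 with hx | hx
    · exact h.notMem_included x hx.1
    · exact h.notMem_excluded x hx.1
  · rcases hS _ ((hF.mem_toFinset).mp hx).1 with hx | hx
    · exact h'.notMem_included x hx.2
    · exact h'.notMem_excluded x hx.2
  · rcases hS _ ((hF.mem_toFinset).mp ha).1 with ha | ha
    · rw [h.winding_included a ha.1, h'.winding_included a ha.2]
    · rw [h.winding_excluded a ha.1, h'.winding_excluded a ha.2]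
  · refine (hf z (hne z hz.1) fun hzS => hz.2 ?_).differentiableWithinAt
    simpa using ⟨hzS, hz.1⟩
  · exact hm a (hne a ((hF.mem_toFinset).mp ha).2)

/-! ### Operations on separating contours -/

/-- If the curve lies in `r < |z| < R`, points in the inner disc have the winding number of `0` and
points beyond `R` have winding number zero; hence `ε = min r R⁻¹`. This lets pole sequences that
shrink to `0` or escape to `∞` be added for free. -/
theorem IsSeparatingContour.exists_extend {D E : Set ℂ} {γ : ℝ → ℂ}
    (h : IsSeparatingContour D E γ) :
    ∃ ε : ℝ, 0 < ε ∧ ∀ D' E' : Set ℂ, (∀ z ∈ D', z ∈ D ∨ ‖z‖ < ε) →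
      (∀ z ∈ E', z ∈ E ∨ 1 < ε * ‖z‖) → IsSeparatingContour D' E' γ := by
  obtain ⟨r, R, hr, hb⟩ := exists_norm_bounds h.contDiff.continuous h.periodic h.ne_zero
  have hR : 0 < R := hr.trans ((hb 0).1.trans (hb 0).2)
  have hsm : ∀ z : ℂ, ‖z‖ < min r R⁻¹ → ∀ x, ‖z - 0‖ < ‖γ x - 0‖ := fun z hz x => by
    rw [sub_zero, sub_zero]
    exact (hz.trans_le (min_le_left _ _)).trans (hb x).1
  have hlg : ∀ z : ℂ, 1 < min r R⁻¹ * ‖z‖ → ∀ x, ‖γ x - 0‖ < ‖z - 0‖ := fun z hz x => by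
    rw [sub_zero, sub_zero]
    have h1 : 1 < R⁻¹ * ‖z‖ := hz.trans_le (by gcongr; exact min_le_right _ _)
    rw [inv_mul_eq_div, one_lt_div hR] at h1
    exact (hb x).2.trans h1
  refine ⟨min r R⁻¹, lt_min hr (inv_pos.mpr hR), fun D' E' hD hE =>
    ⟨h.contDiff, h.periodic, h.ne_zero, fun x hx => ?_, fun x hx => ?_, h.winding_zero,
      fun a ha => ?_, fun a ha => ?_⟩⟩
  · rcases hD _ hx with hx | hx
    · exact h.notMem_included x hx
    · exact lt_irrefl _ (hsm _ hx x)
  · rcases hE _ hx with hx | hx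
    · exact h.notMem_excluded x hx
    · exact lt_irrefl _ (hlg _ hx x)
  · rcases hD _ ha with ha | ha
    · exact h.winding_included a ha
    · rw [loopWinding_eq_of_norm_lt h.contDiff h.closed (hsm _ ha), h.winding_zero]
  · rcases hE _ ha with ha | ha
    · exact h.winding_excluded a ha
    · exact loopWinding_eq_zero_of_norm_lt h.contDiff h.closed (hlg _ ha)

theorem loopIntegral_const_mul_curve (c : ℂ) (γ : ℝ → ℂ) (f : ℂ → ℂ) :
    loopIntegral (fun x => c * γ x) f = loopIntegral γ (fun z => c * f (c * z)) := by
  unfold loopIntegral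
  simp only [deriv_const_mul_field']
  congr 1
  ext x
  ring

theorem IsSeparatingContour.const_mul {D E D' E' : Set ℂ} {γ : ℝ → ℂ}
    (h : IsSeparatingContour D E γ) {c : ℂ} (hc : c ≠ 0) (hD : ∀ z ∈ D', z / c ∈ D)
    (hE : ∀ z ∈ E', z / c ∈ E) : IsSeparatingContour D' E' (fun x => c * γ x) := by
  have hw : ∀ a, loopWinding (fun x => c * γ x) a = loopWinding γ (a / c) := by
    intro a
    unfold loopWinding
    rw [loopIntegral_const_mul_curve]
    congr 2
    ext z
    rw [show c * z - a = c * (z - a / c) by field_simp, mul_inv, mul_inv_cancel_left₀ hc]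
  refine ⟨contDiff_const.mul h.contDiff, fun x => ?_, fun x => mul_ne_zero hc (h.ne_zero x),
    fun x hx => ?_, fun x hx => ?_, ?_, fun a ha => ?_, fun a ha => ?_⟩
  · simp only [h.periodic x]
  · exact h.notMem_included x (by simpa [hc] using hD _ hx)
  · exact h.notMem_excluded x (by simpa [hc] using hE _ hx)
  · rw [hw, zero_div, h.winding_zero]
  · rw [hw, h.winding_included _ (hD a ha)]
  · rw [hw, h.winding_excluded _ (hE a ha)]

theorem loopIntegral_inv_curve {γ : ℝ → ℂ} (hγ : ContDiff ℝ 1 γ) (hp : Function.Periodic γ 1)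
    (h0 : ∀ x, γ x ≠ 0) (f : ℂ → ℂ) :
    loopIntegral (fun x => (γ (-x))⁻¹) f = loopIntegral γ (fun z => (z ^ 2)⁻¹ * f z⁻¹) := by
  unfold loopIntegral
  have hd : ∀ x, deriv (fun x => (γ (-x))⁻¹) x = deriv γ (-x) / γ (-x) ^ 2 := by
    intro x
    have h1 := (hγ.differentiable one_ne_zero (-x)).hasDerivAt
    have h2 := (h1.scomp x (hasDerivAt_neg x)).inv (h0 (-x))
    refine h2.deriv.trans ?_
    simp
  have hdp : Function.Periodic (deriv γ) 1 := fun x => by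
    rw [← deriv_comp_add_const]
    congr 1
    ext y
    exact hp y
  have hF : Function.Periodic (fun x => deriv γ x * ((γ x ^ 2)⁻¹ * f (γ x)⁻¹)) 1 := fun x => by
    simp only [hp x, hdp x]
  simp only [hd]
  have := intervalIntegral.integral_comp_neg (a := 0) (b := 1)
    (fun x => deriv γ x * ((γ x ^ 2)⁻¹ * f (γ x)⁻¹))
  -- Reversal moves the integral to `[-1, 0]`; periodicity brings it back. The sign from reversal
  -- cancels the one in `d(1/z) = -dz / z²`.
  have h3 := hF.intervalIntegral_add_eq (-1) 0
  rw [neg_add_cancel, zero_add] at h3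
  rw [neg_zero, h3] at this
  rw [← this]
  congr 1
  ext x
  rw [div_eq_mul_inv, mul_assoc]

/-- Inversion combined with reversal changes the winding number about `a` to that of `γ` about `0`
minus that about `a⁻¹`, so it exchanges included and excluded points. It realizes the substitution
`z ↦ 1 / z` in the symmetrization. -/
theorem IsSeparatingContour.inv {D E : Set ℂ} {γ : ℝ → ℂ}
    (h : IsSeparatingContour D E γ) {D' E' : Set ℂ} (hD : ∀ z ∈ D', z⁻¹ ∈ E)
    (hE : ∀ z ∈ E', z⁻¹ ∈ D) (hD0 : (0 : ℂ) ∉ D') (hE0 : (0 : ℂ) ∉ E') :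
    IsSeparatingContour D' E' (fun x => (γ (-x))⁻¹) := by
  have hw : ∀ a, a ≠ 0 → (∀ x, γ x ≠ a⁻¹) →
      loopWinding (fun x => (γ (-x))⁻¹) a = loopWinding γ 0 - loopWinding γ a⁻¹ := by
    intro a ha0 ha
    have hc0 : Continuous fun x => (γ x - 0)⁻¹ :=
      continuous_inv_sub_comp h.contDiff.continuous (by simpa using h.ne_zero)
    have hca := continuous_inv_sub_comp h.contDiff.continuous ha
    unfold loopWinding
    rw [loopIntegral_inv_curve h.contDiff h.periodic h.ne_zero, ← mul_sub, sub_eq_add_neg,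
      ← neg_one_mul, ← loopIntegral_const_mul γ (-1), ← loopIntegral_add (f := fun z => (z - 0)⁻¹)
      (g := fun z => (-1) * (z - a⁻¹)⁻¹) h.contDiff hc0 (continuous_const.mul hca)]
    congr 1
    refine loopIntegral_congr fun x => ?_
    have h1 := h.ne_zero x
    have h2 : γ x - a⁻¹ ≠ 0 := sub_ne_zero.mpr (ha x)
    have h6 : a * γ x - 1 ≠ 0 := by
      intro h4
      apply h2
      field_simp
      linear_combination h4
    have e1 : (γ x)⁻¹ - a = -(a * γ x - 1) / γ x := by
      field_simp
      ring
    have e2 : γ x - a⁻¹ = (a * γ x - 1) / a := by field_simp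
    rw [e1, e2, sub_zero]
    obtain ⟨u, hu⟩ : ∃ u, u = a * γ x - 1 := ⟨_, rfl⟩
    rw [← hu] at h6 ⊢
    field_simp
    linear_combination -hu
  have nD : ∀ x, (γ x)⁻¹ ∉ D' := fun x hx => h.notMem_excluded x (by simpa using hD _ hx)
  have nE : ∀ x, (γ x)⁻¹ ∉ E' := fun x hx => h.notMem_included x (by simpa using hE _ hx)
  refine ⟨(h.contDiff.comp contDiff_neg).inv fun x => h.ne_zero _, fun x => ?_,
    fun x => inv_ne_zero (h.ne_zero _), fun x => nD _, fun x => nE _, ?_, fun a ha => ?_,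
    fun a ha => ?_⟩
  · have := h.periodic (-(x + 1))
    simp only [neg_add_rev, neg_add_cancel_comm] at this ⊢
    rw [← this]
  · unfold loopWinding
    rw [loopIntegral_inv_curve h.contDiff h.periodic h.ne_zero]
    refine Eq.trans ?_ h.winding_zero
    unfold loopWinding
    congr 1
    refine loopIntegral_congr fun x => ?_
    have := h.ne_zero x
    field_simp
    simp
  · have ha0 : a ≠ 0 := fun h0 => hD0 (h0 ▸ ha)
    rw [hw a ha0 (fun x hx => nD x (by rwa [hx, inv_inv])), h.winding_zero,
      h.winding_excluded _ (hD a ha), sub_zero]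
  · have ha0 : a ≠ 0 := fun h0 => hE0 (h0 ▸ ha)
    rw [hw a ha0 (fun x hx => nE x (by rwa [hx, inv_inv])), h.winding_zero,
      h.winding_included _ (hE a ha), sub_self]

theorem continuous_loopIntegral {X : Type*} [TopologicalSpace X] {γ : ℝ → ℂ}
    (hγ : ContDiff ℝ 1 γ) {K : X → ℂ → ℂ} (hK : Continuous fun y : X × ℝ => K y.1 (γ y.2)) :
    Continuous fun x => loopIntegral γ (K x) := by
  unfold loopIntegral
  refine intervalIntegral.continuous_parametric_intervalIntegral_of_continuous' ?_ 0 1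
  exact ((hγ.continuous_deriv le_rfl).comp continuous_snd).mul hK

/-! ### Existence of separating contours -/

/-- A continuously differentiable path in `U` from `u` to `v` that rests outside `[0, 1]`. -/
structure IsRestingPath (U : Set ℂ) (u v : ℂ) (γ : ℝ → ℂ) : Prop where
  contDiff : ContDiff ℝ 1 γ
  left : ∀ x, x ≤ 0 → γ x = u
  right : ∀ x, 1 ≤ x → γ x = v
  mem : ∀ x, γ x ∈ U

namespace IsRestingPath

variable {U : Set ℂ} {u v w : ℂ} {γ γ' : ℝ → ℂ}

theorem deriv_left (h : IsRestingPath U u v γ) {x : ℝ} (hx : x ≤ 0) : deriv γ x = 0 := by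
  have h1 := (h.contDiff.differentiable one_ne_zero x).hasDerivAt.hasDerivWithinAt (s := Set.Iic 0)
  have h2 : HasDerivWithinAt γ 0 (Set.Iic 0) x :=
    (hasDerivWithinAt_const x (Set.Iic 0) u).congr (fun y hy => h.left y hy) (h.left x hx)
  exact (uniqueDiffOn_Iic (0 : ℝ) x hx).eq_deriv _ h1 h2

theorem deriv_right (h : IsRestingPath U u v γ) {x : ℝ} (hx : 1 ≤ x) : deriv γ x = 0 := by
  have h1 := (h.contDiff.differentiable one_ne_zero x).hasDerivAt.hasDerivWithinAt (s := Set.Ici 1)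
  have h2 : HasDerivWithinAt γ 0 (Set.Ici 1) x :=
    (hasDerivWithinAt_const x (Set.Ici 1) v).congr (fun y hy => h.right y hy) (h.right x hx)
  exact (uniqueDiffOn_Ici (1 : ℝ) x hx).eq_deriv _ h1 h2

/-- While one path moves, the other rests at `v`; the sum minus `v` is therefore the concatenation,
and it is `C¹` without any gluing at the junction. -/
theorem concat (h : IsRestingPath U u v γ) (h' : IsRestingPath U v w γ') :
    IsRestingPath U u w (fun x => γ (2 * x) + γ' (2 * x - 1) - v) := by
  refine ⟨?_, fun x hx => ?_, fun x hx => ?_, fun x => ?_⟩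
  · exact ((h.contDiff.comp (contDiff_const.mul contDiff_id)).add
      (h'.contDiff.comp ((contDiff_const.mul contDiff_id).sub contDiff_const))).sub contDiff_const
  · rw [h.left _ (by linarith), h'.left _ (by linarith), add_sub_cancel_right]
  · rw [h.right _ (by linarith), h'.right _ (by linarith), add_sub_cancel_left]
  · rcases le_total (2 * x) 1 with hx | hx
    · rw [h'.left _ (by linarith), add_sub_cancel_right]
      exact h.mem _
    · rw [h.right _ hx, add_sub_cancel_left]
      exact h'.mem _

theorem loopIntegral_concat (h : IsRestingPath U u v γ) (h' : IsRestingPath U v w γ') {f : ℂ → ℂ}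
    (hf : Continuous fun x => f (γ x)) (hf' : Continuous fun x => f (γ' x)) :
    loopIntegral (fun x => γ (2 * x) + γ' (2 * x - 1) - v) f =
      loopIntegral γ f + loopIntegral γ' f := by
  set g : ℝ → ℂ := fun x => deriv γ x * f (γ x) with hg
  set g' : ℝ → ℂ := fun x => deriv γ' x * f (γ' x) with hg'
  have cg : Continuous g := continuous_deriv_mul_comp h.contDiff hf
  have cg' : Continuous g' := continuous_deriv_mul_comp h'.contDiff hf'
  have hd : ∀ x : ℝ, deriv (fun x => γ (2 * x) + γ' (2 * x - 1) - v) x =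
      2 * deriv γ (2 * x) + 2 * deriv γ' (2 * x - 1) := by
    intro x
    have e1 := (h.contDiff.differentiable one_ne_zero (2 * x)).hasDerivAt.scomp x
      ((hasDerivAt_id x).const_mul 2)
    have e2 := (h'.contDiff.differentiable one_ne_zero (2 * x - 1)).hasDerivAt.scomp x
      (((hasDerivAt_id x).const_mul 2).sub_const 1)
    refine ((e1.add e2).sub_const v).deriv.trans ?_
    simp
  have hpt : ∀ x : ℝ, deriv (fun x => γ (2 * x) + γ' (2 * x - 1) - v) x *
      f (γ (2 * x) + γ' (2 * x - 1) - v) = 2 * g (2 * x) + 2 * g' (2 * x - 1) := by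
    intro x
    rw [hd]
    rcases le_total (2 * x) 1 with hx | hx
    · rw [h'.left _ (by linarith), add_sub_cancel_right, hg', hg]
      simp only [h'.deriv_left (show 2 * x - 1 ≤ 0 by linarith)]
      ring
    · rw [h.right _ hx, add_sub_cancel_left, hg', hg]
      simp only [h.deriv_right hx]
      ring
  have i1 : ∫ x in (0 : ℝ)..1, 2 * g (2 * x) = ∫ x in (0 : ℝ)..1, g x := by
    have e := intervalIntegral.smul_integral_comp_mul_left (a := 0) (b := 1) g 2
    have e2 := intervalIntegral.integral_add_adjacent_intervals
      (cg.intervalIntegrable (μ := MeasureTheory.volume) 0 1) (cg.intervalIntegrable 1 2)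
    -- After the substitution the range is `[0, 2]`, but the velocity is zero on `[1, 2]`.
    have e3 : ∫ x in (1 : ℝ)..2, g x = 0 := by
      rw [intervalIntegral.integral_congr (g := fun _ => 0), intervalIntegral.integral_zero]
      intro x hx
      rw [Set.uIcc_of_le (by norm_num)] at hx
      simp [hg, h.deriv_right hx.1]
    rw [e3, add_zero] at e2
    rw [mul_zero, mul_one] at e
    rw [e2, ← e, intervalIntegral.integral_const_mul, Complex.real_smul, Complex.ofReal_ofNat]
  have i2 : ∫ x in (0 : ℝ)..1, 2 * g' (2 * x - 1) = ∫ x in (0 : ℝ)..1, g' x := by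
    have e := intervalIntegral.smul_integral_comp_mul_sub (a := 0) (b := 1) g' 2 1
    have e2 := intervalIntegral.integral_add_adjacent_intervals
      (cg'.intervalIntegrable (μ := MeasureTheory.volume) (-1) 0) (cg'.intervalIntegrable 0 1)
    have e3 : ∫ x in (-1 : ℝ)..0, g' x = 0 := by
      rw [intervalIntegral.integral_congr (g := fun _ => 0), intervalIntegral.integral_zero]
      intro x hx
      rw [Set.uIcc_of_le (by norm_num)] at hx
      simp [hg', h'.deriv_left hx.2]
    rw [e3, zero_add] at e2
    rw [show (2 : ℝ) * 0 - 1 = -1 by norm_num, show (2 : ℝ) * 1 - 1 = 1 by norm_num] at e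
    rw [e2, ← e, intervalIntegral.integral_const_mul, Complex.real_smul, Complex.ofReal_ofNat]
  unfold loopIntegral
  simp only [hpt]
  rw [intervalIntegral.integral_add, i1, i2]
  · exact Continuous.intervalIntegrable (by fun_prop) _ _
  · exact Continuous.intervalIntegrable (by fun_prop) _ _

theorem reverse (h : IsRestingPath U u v γ) : IsRestingPath U v u (fun x => γ (1 - x)) :=
  ⟨h.contDiff.comp (contDiff_const.sub contDiff_id), fun x hx => h.right _ (by linarith),
    fun x hx => h.left _ (by linarith), fun x => h.mem _⟩

theorem _root_.loopIntegral_reverse (γ : ℝ → ℂ) (f : ℂ → ℂ) :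
    loopIntegral (fun x => γ (1 - x)) f = -loopIntegral γ f := by
  unfold loopIntegral
  simp only [deriv_comp_const_sub, neg_mul, intervalIntegral.integral_neg]
  rw [intervalIntegral.integral_comp_sub_left (fun x => deriv γ x * f (γ x)) 1]
  simp

theorem exists_segment {ε : ℝ} (hU : Metric.ball u ε ⊆ U) (hv : v ∈ Metric.ball u ε) :
    ∃ γ, IsRestingPath U u v γ := by
  refine ⟨fun x => u + Real.smoothTransition x * (v - u), ?_, fun x hx => ?_, fun x hx => ?_,
    fun x => hU ?_⟩
  · exact contDiff_const.add ((Complex.ofRealCLM.contDiff.comp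
      Real.smoothTransition.contDiff).mul contDiff_const)
  · simp [Real.smoothTransition.zero_of_nonpos hx]
  · simp [Real.smoothTransition.one_of_one_le hx]
  · rw [mem_ball_iff_norm] at hv ⊢
    rw [add_sub_cancel_left, norm_mul, Complex.norm_real, Real.norm_of_nonneg
      (Real.smoothTransition.nonneg x)]
    exact (mul_le_of_le_one_left (norm_nonneg _) (Real.smoothTransition.le_one x)).trans_lt hv

/-- Being joined by a resting path is symmetric, transitive and locally satisfied in an open set. -/
theorem exists_of_isPreconnected (hU : IsOpen U) (hc : IsPreconnected U) (hu : u ∈ U)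
    (hv : v ∈ U) : ∃ γ, IsRestingPath U u v γ := by
  refine hc.induction₂ (fun u v => ∃ γ, IsRestingPath U u v γ) (fun x hx => ?_) ?_ ?_ hu hv
  · obtain ⟨ε, hε, hb⟩ := Metric.isOpen_iff.mp hU x hx
    exact nhdsWithin_le_nhds (mem_of_superset (Metric.ball_mem_nhds x hε) fun y hy =>
      exists_segment hb hy)
  · rintro x y z _ _ _ ⟨γ, h⟩ ⟨γ', h'⟩
    exact ⟨_, h.concat h'⟩
  · rintro x y _ _ ⟨γ, h⟩
    exact ⟨_, h.reverse⟩

/-- The circle through `b` with center `c`, as a resting path. -/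
theorem circle {b c : ℂ} (hU : Metric.sphere c ‖b - c‖ ⊆ U) :
    IsRestingPath U b b (fun x =>
      c + Complex.exp (2 * Real.pi * Complex.I * Real.smoothTransition x) * (b - c)) := by
  refine ⟨?_, fun x hx => ?_, fun x hx => ?_, fun x => hU ?_⟩
  · exact contDiff_const.add (((contDiff_const.mul (Complex.ofRealCLM.contDiff.comp
      Real.smoothTransition.contDiff)).cexp).mul contDiff_const)
  · simp [Real.smoothTransition.zero_of_nonpos hx]
  · simp [Real.smoothTransition.one_of_one_le hx]
  · rw [mem_sphere_iff_norm, add_sub_cancel_left, norm_mul, Complex.norm_exp]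
    simp

theorem loopWinding_circle {b c : ℂ} (hb : b ≠ c) (x : ℂ) (hx : ‖x - c‖ ≠ ‖b - c‖) :
    loopWinding (fun x =>
      c + Complex.exp (2 * Real.pi * Complex.I * Real.smoothTransition x) * (b - c)) x =
      if ‖x - c‖ < ‖b - c‖ then 1 else 0 := by
  set γ : ℝ → ℂ := fun x =>
      c + Complex.exp (2 * Real.pi * Complex.I * Real.smoothTransition x) * (b - c) with hγ
  have h : IsRestingPath (Metric.sphere c ‖b - c‖) b b γ := circle subset_rfl
  have hn : ∀ y, ‖γ y - c‖ = ‖b - c‖ := fun y => mem_sphere_iff_norm.mp (h.mem y)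
  have hcl : γ 1 = γ 0 := by rw [h.left 0 le_rfl, h.right 1 le_rfl]
  split_ifs with hlt
  · rw [loopWinding_eq_of_norm_lt h.contDiff hcl (c := c) fun y => by rw [hn]; exact hlt]
    unfold loopWinding loopIntegral
    rw [inv_mul_eq_one₀ Complex.two_pi_I_ne_zero]
    have hd : ∀ y, HasDerivAt (fun y : ℝ => 2 * Real.pi * Complex.I * Real.smoothTransition y)
        (2 * Real.pi * Complex.I * (deriv Real.smoothTransition y : ℝ)) y := fun y =>
      (((Real.smoothTransition.contDiff (n := 1)).differentiable one_ne_zero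
        y).hasDerivAt.ofReal_comp).const_mul _
    have hpt : ∀ y, deriv γ y * (γ y - c)⁻¹ =
        2 * Real.pi * Complex.I * (deriv Real.smoothTransition y : ℝ) := by
      intro y
      have e : deriv γ y = _ := (((hd y).cexp.mul_const (b - c)).const_add c).deriv
      rw [e, hγ, add_sub_cancel_left]
      have := sub_ne_zero.mpr hb
      field_simp
    simp only [hpt]
    rw [intervalIntegral.integral_eq_sub_of_hasDerivAt (fun y _ => hd y)]
    · simp [Real.smoothTransition.zero, Real.smoothTransition.one]
    · refine Continuous.intervalIntegrable ?_ _ _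
      have := (Real.smoothTransition.contDiff (n := 1)).continuous_deriv le_rfl
      fun_prop
  · refine loopWinding_eq_zero_of_norm_lt h.contDiff hcl (c := c) fun y => ?_
    rw [hn]
    exact lt_of_le_of_ne (not_lt.mp hlt) hx.symm

/-- The periodic extension of a closed resting path. -/
theorem periodize (h : IsRestingPath U u u γ) :
    ContDiff ℝ 1 (fun x => γ (Int.fract x)) ∧ Function.Periodic (fun x => γ (Int.fract x)) 1 ∧
      ∀ f, loopIntegral (fun x => γ (Int.fract x)) f = loopIntegral γ f := by
  refine ⟨?_, fun x => ?_, fun f => ?_⟩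
  · rw [contDiff_iff_contDiffAt]
    intro x
    -- This local formula also covers integers `x`, where `Int.fract` jumps: one summand rests at
    -- `u` on either side.
    have hev : (fun x => γ (Int.fract x)) =ᶠ[𝓝 x]
        fun y => γ (y - ⌊x⌋) + γ (y - ⌊x⌋ + 1) - u := by
      have hm : x ∈ Set.Ioo ((⌊x⌋ : ℝ) - 1) (⌊x⌋ + 1) :=
        ⟨by linarith [Int.floor_le x], Int.lt_floor_add_one x⟩
      filter_upwards [isOpen_Ioo.mem_nhds hm] with y hy
      rcases le_or_gt (⌊x⌋ : ℝ) y with hxy | hxy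
      · have : ⌊y⌋ = ⌊x⌋ := Int.floor_eq_iff.mpr ⟨hxy, hy.2⟩
        rw [h.right (y - ⌊x⌋ + 1) (by linarith), Int.fract, this, add_sub_cancel_right]
      · have : ⌊y⌋ = ⌊x⌋ - 1 :=
          Int.floor_eq_iff.mpr ⟨by push_cast; exact hy.1.le, by push_cast; linarith⟩
        rw [h.left (y - ⌊x⌋) (by linarith), Int.fract, this, add_sub_cancel_left]
        congr 1
        push_cast
        ring
    refine ContDiffAt.congr_of_eventuallyEq ?_ hev
    refine ContDiff.contDiffAt ?_
    exact ((h.contDiff.comp (contDiff_id.sub contDiff_const)).add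
      (h.contDiff.comp ((contDiff_id.sub contDiff_const).add contDiff_const))).sub contDiff_const
  · simp
  · refine intervalIntegral.integral_congr_ae ?_
    have h1 : ∀ᵐ x : ℝ, x ≠ 1 := by simp [MeasureTheory.ae_iff]
    filter_upwards [h1] with x hx1 hx
    rw [Set.uIoc_of_le zero_le_one] at hx
    have hm : x ∈ Set.Ioo (0 : ℝ) 1 := ⟨hx.1, lt_of_le_of_ne hx.2 hx1⟩
    have hev : (fun x => γ (Int.fract x)) =ᶠ[𝓝 x] γ := by
      filter_upwards [isOpen_Ioo.mem_nhds hm] with y hy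
      rw [Int.fract_eq_self.mpr ⟨hy.1.le, hy.2⟩]
    rw [hev.deriv_eq, hev.eq_of_nhds]

end IsRestingPath

/-- `n` is the winding number function on the complement of `U` of a closed path in `U` with base
point `b`. -/
def IsWindingFunction (U : Set ℂ) (b : ℂ) (n : ℂ → ℂ) : Prop :=
  ∃ γ, IsRestingPath U b b γ ∧ ∀ a ∉ U, loopWinding γ a = n a

namespace IsWindingFunction

variable {U : Set ℂ} {b b' : ℂ} {n n' : ℂ → ℂ}

theorem continuous_aux {γ : ℝ → ℂ} (h : IsRestingPath U b b' γ) {a : ℂ} (ha : a ∉ U) :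
    Continuous fun x => (γ x - a)⁻¹ :=
  continuous_inv_sub_comp h.contDiff.continuous fun x hx => ha (hx ▸ h.mem x)

theorem add (h : IsWindingFunction U b n) (h' : IsWindingFunction U b n') :
    IsWindingFunction U b (n + n') := by
  obtain ⟨γ, hγ, hn⟩ := h
  obtain ⟨γ', hγ', hn'⟩ := h'
  refine ⟨_, hγ.concat hγ', fun a ha => ?_⟩
  rw [loopWinding, hγ.loopIntegral_concat hγ' (continuous_aux hγ ha) (continuous_aux hγ' ha), mul_add]
  exact congrArg₂ _ (hn a ha) (hn' a ha)

theorem neg (h : IsWindingFunction U b n) : IsWindingFunction U b (-n) := by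
  obtain ⟨γ, hγ, hn⟩ := h
  refine ⟨_, hγ.reverse, fun a ha => ?_⟩
  rw [loopWinding, loopIntegral_reverse, mul_neg]
  exact congrArg _ (hn a ha)

theorem zero (hb : b ∈ U) : IsWindingFunction U b 0 :=
  ⟨fun _ => b, ⟨contDiff_const, fun _ _ => rfl, fun _ _ => rfl, fun _ => hb⟩, fun a _ => by
    simp [loopWinding, loopIntegral]⟩

theorem sum (hb : b ∈ U) {ι : Type*} (s : Finset ι) {n : ι → ℂ → ℂ}
    (h : ∀ i ∈ s, IsWindingFunction U b (n i)) : IsWindingFunction U b (∑ i ∈ s, n i) :=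
  Finset.sum_induction _ _ (fun _ _ => add) (zero hb) h

/-- Conjugation by a path from `b` to `b'`: its two traversals cancel in every integral. -/
theorem change_base (hU : IsOpen U) (hc : IsPreconnected U) (hb : b ∈ U)
    (h : IsWindingFunction U b' n) : IsWindingFunction U b n := by
  obtain ⟨γ, hγ, hn⟩ := h
  obtain ⟨δ, hδ⟩ := IsRestingPath.exists_of_isPreconnected hU hc hb (hγ.left 0 le_rfl ▸ hγ.mem 0)
  refine ⟨_, (hδ.concat hγ).concat hδ.reverse, fun a ha => ?_⟩
  rw [loopWinding, (hδ.concat hγ).loopIntegral_concat hδ.reverse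
    (continuous_aux (hδ.concat hγ) ha) (continuous_aux hδ.reverse ha),
    hδ.loopIntegral_concat hγ (continuous_aux hδ ha) (continuous_aux hγ ha), loopIntegral_reverse,
    ← hn a ha, loopWinding]
  ring

end IsWindingFunction

/-- Separating contours exist if `D` only accumulates at `0`, `E` only accumulates at `∞`, and the
two sets are disjoint. -/
theorem exists_isSeparatingContour {D E : Set ℂ} (hD0 : (0 : ℂ) ∉ D) (hE0 : (0 : ℂ) ∉ E)
    (hDE : Disjoint D E) (hD : ∀ r : ℝ, 0 < r → (D ∩ {z | r < ‖z‖}).Finite)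
    (hE : ∀ R : ℝ, (E ∩ {z | ‖z‖ < R}).Finite) : ∃ γ, IsSeparatingContour D E γ := by
  classical
  set U : Set ℂ := (insert 0 (D ∪ E))ᶜ with hUdef
  have hiso : ∀ z : ℂ, z ≠ 0 → ∀ᶠ w in 𝓝 z, w ∈ U ∨ w = z := by
    intro z hz
    have hzp := norm_pos_iff.mpr hz
    have hf : (((D ∩ {w | ‖z‖ / 2 < ‖w‖}) ∪ (E ∩ {w | ‖w‖ < ‖z‖ + 1})) \ {z}).Finite :=
      ((hD _ (half_pos hzp)).union (hE _)).sdiff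
    have h1 : ∀ᶠ w : ℂ in 𝓝 z, ‖z‖ / 2 < ‖w‖ :=
      continuous_norm.continuousAt.eventually (lt_mem_nhds (half_lt_self hzp))
    have h2 : ∀ᶠ w : ℂ in 𝓝 z, ‖w‖ < ‖z‖ + 1 :=
      continuous_norm.continuousAt.eventually (gt_mem_nhds (lt_add_one ‖z‖))
    filter_upwards [h1, h2, hf.isClosed.isOpen_compl.mem_nhds (by simp)] with w hw1 hw2 hw3
    by_contra! hc
    have hw0 : w ≠ 0 := by
      rintro rfl
      simp at hw1
      linarith
    have hwU : w ∈ insert 0 (D ∪ E) := not_not.mp hc.1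
    rcases hwU with hw | hw | hw
    · exact hw0 hw
    · exact hw3 ⟨Or.inl ⟨hw, hw1⟩, hc.2⟩
    · exact hw3 ⟨Or.inr ⟨hw, hw2⟩, hc.2⟩
  have hUo : IsOpen U := by
    rw [isOpen_iff_mem_nhds]
    intro z hz
    filter_upwards [hiso z fun h => hz (by simp [h])] with w hw
    rcases hw with hw | rfl
    · exact hw
    · exact hz
  have hcount : (D ∪ E).Countable := by
    have h1 : D ∪ E ⊆ ⋃ n : ℕ, ((D ∩ {z | 1 / ((n : ℝ) + 1) < ‖z‖}) ∪ (E ∩ {z | ‖z‖ < n})) := by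
      rintro z (hz | hz)
      · have hz0 : z ≠ 0 := fun h => hD0 (h ▸ hz)
        obtain ⟨n, hn⟩ := exists_nat_one_div_lt (norm_pos_iff.mpr hz0)
        exact Set.mem_iUnion.mpr ⟨n, Or.inl ⟨hz, hn⟩⟩
      · obtain ⟨n, hn⟩ := exists_nat_gt ‖z‖
        exact Set.mem_iUnion.mpr ⟨n, Or.inr ⟨hz, hn⟩⟩
    exact (Set.countable_iUnion fun n => ((hD _ (by positivity)).union (hE _)).countable).mono h1
  have hUc : IsPreconnected U :=
    ((hcount.insert 0).isConnected_compl_of_one_lt_rank (by simp)).isPreconnected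
  -- The moduli of points of `D ∪ E` form a countable set, so some circle about `0` avoids them all.
  obtain ⟨r, hr, hr1⟩ := ((hcount.image norm).dense_compl ℝ).exists_mem_open
    (isOpen_Ioo (a := (0 : ℝ)) (b := 1)) ⟨1 / 2, by norm_num⟩
  have hr0 : 0 < r := hr1.1
  have hrn : ∀ z ∈ D ∪ E, ‖z‖ ≠ r := fun z hz h => hr ⟨z, hz, h⟩
  have hrU : ∀ z : ℂ, ‖z‖ = r → z ∈ U := by
    rintro z hz (h | h)
    · rw [h, norm_zero] at hz
      exact hr0.ne hz
    · exact hrn z h hz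
  have hnr : ‖(r : ℂ)‖ = r := by simp [abs_of_pos hr0]
  have hbU : (r : ℂ) ∈ U := hrU _ hnr
  have hcirc : IsWindingFunction U r (fun a => if ‖a‖ < r then 1 else 0) := by
    refine ⟨_, IsRestingPath.circle (c := 0) fun z hz => hrU z (by simpa [abs_of_pos hr0] using hz),
      fun a ha => ?_⟩
    rw [IsRestingPath.loopWinding_circle (by simpa using hr0.ne')]
    · simp [abs_of_pos hr0]
    · rw [sub_zero, sub_zero, hnr]
      exact fun h => ha (hrU a h)
  -- A small circle about the isolated point `c`, transported to the base point; `U` is connected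
  -- because its complement is countable.
  have hsingle : ∀ c ∈ D ∪ E, IsWindingFunction U r (fun a => if a = c then 1 else 0) := by
    intro c hc
    have hc0 : c ≠ 0 := by
      rintro rfl
      exact hc.elim hD0 hE0
    have hcU : c ∉ U := fun h => h (Or.inr hc)
    obtain ⟨ε, hε, hb⟩ := Metric.nhds_basis_closedBall.mem_iff.mp (hiso c hc0)
    have hn : ‖c + (ε : ℂ) - c‖ = ε := by simp [abs_of_pos hε]
    refine IsWindingFunction.change_base (b' := c + ε) hUo hUc hbU
      ⟨_, IsRestingPath.circle (c := c) fun z hz => ?_, fun a ha => ?_⟩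
    · rw [hn] at hz
      refine (hb (Metric.sphere_subset_closedBall hz)).resolve_right ?_
      rintro rfl
      simp at hz
      exact hε.ne hz
    · have hne : ¬ ‖a - c‖ ≤ ε ∨ a = c := by
        by_contra! h
        rcases hb (show a ∈ Metric.closedBall c ε from mem_closedBall_iff_norm.mpr h.1) with h' | h'
        · exact ha h'
        · exact h.2 h'
      rw [IsRestingPath.loopWinding_circle (by simpa using hε.ne'), hn]
      · rcases hne with h | rfl
        · dsimp only
          rw [if_neg (by linarith), if_neg]
          rintro rfl
          simp [hε.le] at h
        · simp [hε]
      · rw [hn]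
        rcases hne with h | rfl
        · exact fun h' => h h'.le
        · simpa using hε.ne
  have hfD := hD r hr0
  have hfE := hE r
  -- The circle of radius `r` is wrong only at finitely many points: those of `D` outside it need
  -- `+1`, those of `E` inside it need `-1`.
  obtain ⟨γ, hγ, hw⟩ := (hcirc.add (IsWindingFunction.sum hbU hfD.toFinset
    (n := fun c a => if a = c then 1 else 0) fun c hc =>
      hsingle c (Or.inl (hfD.mem_toFinset.mp hc).1))).add
    (IsWindingFunction.sum hbU hfE.toFinset (n := fun c a => if a = c then 1 else 0) fun c hc =>
      hsingle c (Or.inr (hfE.mem_toFinset.mp hc).1)).neg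
  have hw' : ∀ a ∉ U, loopWinding γ a = (if ‖a‖ < r then 1 else 0) +
      (if a ∈ D ∧ r < ‖a‖ then 1 else 0) - (if a ∈ E ∧ ‖a‖ < r then 1 else 0) := by
    intro a ha
    rw [hw a ha]
    simp [Finset.sum_apply, sub_eq_add_neg]
  obtain ⟨c1, c2, c3⟩ := hγ.periodize
  have hwp : ∀ a, loopWinding (fun x => γ (Int.fract x)) a = loopWinding γ a := fun a => by
    rw [loopWinding, c3, loopWinding]
  refine ⟨_, c1, c2, fun x h => hγ.mem _ (Or.inl h), fun x h => hγ.mem _ (Or.inr (Or.inl h)),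
    fun x h => hγ.mem _ (Or.inr (Or.inr h)), ?_, fun a ha => ?_, fun a ha => ?_⟩
  · rw [hwp, hw' 0 fun h => h (Or.inl rfl)]
    simp [hr0, hD0, hE0]
  · have haE : a ∉ E := Set.disjoint_left.mp hDE ha
    rw [hwp, hw' a fun h => h (Or.inr (Or.inl ha))]
    rcases lt_or_gt_of_ne (hrn a (Or.inl ha)) with h | h
    · simp [h, h.not_gt, haE]
    · simp [h, h.not_gt, haE, ha]
  · have haD : a ∉ D := Set.disjoint_right.mp hDE ha
    rw [hwp, hw' a fun h => h (Or.inr (Or.inr ha))]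
    rcases lt_or_gt_of_ne (hrn a (Or.inr ha)) with h | h
    · simp [h, ha, haD]
    · simp [h.not_gt, haD]

/-! ### Integrands with two families of pole sequences -/

/-- The double geometric series converges, so only finitely many terms exceed `r`. The case `p = 0`
is allowed and covers the trigonometric sequences. -/
theorem finite_norm_gt_inter {p q : ℂ} (hp : ‖p‖ < 1) (hq : ‖q‖ < 1) (c : Fin 8 → ℂ) {D : Set ℂ}
    (hD : ∀ z ∈ D, ∃ (j : Fin 8) (a b : ℕ), z = c j * p ^ a * q ^ b) {r : ℝ} (hr : 0 < r) :
    (D ∩ {z | r < ‖z‖}).Finite := by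
  have h1 : ∀ j : Fin 8, {m : ℕ × ℕ | r < ‖c j * p ^ m.1 * q ^ m.2‖}.Finite := fun j => by
    have h2 := (summable_norm_mul_pow_mul_pow (c j) hp hq).tendsto_cofinite_zero.eventually
      (gt_mem_nhds hr)
    exact h2.subset fun m hm h3 =>
      lt_asymm (show r < ‖c j * p ^ m.1 * q ^ m.2‖ from hm) h3
  refine (Set.finite_iUnion fun j => (h1 j).image fun m => c j * p ^ m.1 * q ^ m.2).subset ?_
  rintro z ⟨hz, hzr⟩
  obtain ⟨j, a, b, rfl⟩ := hD z hz
  exact Set.mem_iUnion.mpr ⟨j, (a, b), hzr, rfl⟩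

theorem finite_norm_lt_inter {p q : ℂ} (hp : ‖p‖ < 1) (hq : ‖q‖ < 1) (c : Fin 8 → ℂ) {E : Set ℂ}
    (hE : ∀ z ∈ E, ∃ (j : Fin 8) (a b : ℕ), z = (c j * p ^ a * q ^ b)⁻¹) (hE0 : (0 : ℂ) ∉ E)
    (R : ℝ) : (E ∩ {z | ‖z‖ < R}).Finite := by
  rcases le_or_gt R 0 with hR | hR
  · convert Set.finite_empty using 1
    ext z
    simp only [Set.mem_inter_iff, Set.mem_ofPred_eq, Set.mem_empty_iff_false, iff_false]
    rintro ⟨_, h⟩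
    linarith [norm_nonneg z]
  have h := finite_norm_gt_inter hp hq c (D := Inv.inv '' E)
    (by
      rintro _ ⟨z, hz, rfl⟩
      obtain ⟨j, a, b, rfl⟩ := hE z hz
      exact ⟨j, a, b, by simp⟩) (inv_pos.mpr hR)
  refine (h.image Inv.inv).subset ?_
  rintro z ⟨hz, hzR⟩
  have hz0 : z ≠ 0 := fun h => hE0 (h ▸ hz)
  refine ⟨z⁻¹, ⟨⟨z, hz, rfl⟩, ?_⟩, inv_inv z⟩
  change R⁻¹ < ‖z⁻¹‖
  rw [norm_inv]
  exact (inv_lt_inv₀ hR (norm_pos_iff.mpr hz0)).mpr hzR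

theorem zero_notMem_ellipticDownward {p q : ℂ} (hp : p ≠ 0) (hq : q ≠ 0) {c : Fin 8 → ℂ}
    (hc : ∀ j, c j ≠ 0) : (0 : ℂ) ∉ ellipticDownward p q c := by
  rintro ⟨j, a, b, h⟩
  have := hc j
  have : c j * p ^ a * q ^ b ≠ 0 := by positivity
  exact this h.symm

theorem zero_notMem_ellipticUpward {p q : ℂ} (hp : p ≠ 0) (hq : q ≠ 0) {c : Fin 8 → ℂ}
    (hc : ∀ j, c j ≠ 0) : (0 : ℂ) ∉ ellipticUpward p q c := by
  rintro ⟨j, a, b, h⟩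
  have := hc j
  have : (c j * p ^ a * q ^ b)⁻¹ ≠ 0 := by positivity
  exact this h.symm

theorem exists_isSeparatingContour_elliptic {p q : ℂ} (hp0 : p ≠ 0) (hp : ‖p‖ < 1) (hq0 : q ≠ 0)
    (hq : ‖q‖ < 1) {t : Fin 8 → ℂ} (ht : ∀ j, t j ≠ 0) (hadm : EllipticAdmissible p q t) :
    ∃ γ, IsSeparatingContour (ellipticDownward p q t) (ellipticUpward p q t) γ := by
  have hE0 := zero_notMem_ellipticUpward hp0 hq0 ht
  refine exists_isSeparatingContour (zero_notMem_ellipticDownward hp0 hq0 ht) hE0 ?_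
    (fun r hr => finite_norm_gt_inter hp hq t (fun z hz => hz) hr)
    (fun R => finite_norm_lt_inter hp hq t (fun z hz => hz) hE0 R)
  rw [Set.disjoint_left]
  rintro z ⟨i, a, b, rfl⟩ ⟨j, a', b', h⟩
  have := ht j
  refine hadm i j (a + a') (b + b') ?_
  have h1 : t i * p ^ a * q ^ b * (t j * p ^ a' * q ^ b') = 1 := by
    rw [h]
    exact inv_mul_cancel₀ (by positivity)
  rw [← h1]
  ring

/-- The product of the denominators `(α_j z, β_j / z; p, q)_∞`. -/
noncomputable def poleProduct (p q : ℂ) (α β : Fin 8 → ℂ) (z : ℂ) : ℂ :=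
  ∏ j, doubleShifted (α j * z) p q * doubleShifted (β j / z) p q

theorem poleProduct_ne_zero {p q : ℂ} (hp : ‖p‖ < 1) (hq : ‖q‖ < 1) {α β : Fin 8 → ℂ} {z : ℂ}
    (hα : ∀ (j : Fin 8) (a b : ℕ), α j * p ^ a * q ^ b * z ≠ 1)
    (hβ : ∀ (j : Fin 8) (a b : ℕ), z ≠ β j * p ^ a * q ^ b) (hz : z ≠ 0) :
    poleProduct p q α β z ≠ 0 := by
  refine Finset.prod_ne_zero_iff.mpr fun j _ => mul_ne_zero ?_ ?_
  · rw [Ne, doubleShifted_eq_zero_iff hp hq]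
    rintro ⟨a, b, h⟩
    refine hα j a b ?_
    rw [← h]
    ring
  · rw [Ne, doubleShifted_eq_zero_iff hp hq]
    rintro ⟨a, b, h⟩
    refine hβ j a b ?_
    field_simp at h
    exact h.symm

theorem poleProduct_ne_zero_of_notMem {p q : ℂ} (hp : ‖p‖ < 1) (hq : ‖q‖ < 1) {α β : Fin 8 → ℂ}
    {z : ℂ} (hα : z ∉ ellipticUpward p q α) (hβ : z ∉ ellipticDownward p q β) (hz : z ≠ 0) :
    poleProduct p q α β z ≠ 0 :=
  poleProduct_ne_zero hp hq (fun j a b h => hα ⟨j, a, b, eq_inv_of_mul_eq_one_right h⟩)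
    (fun j a b h => hβ ⟨j, a, b, h⟩) hz

theorem differentiableAt_poleProduct {p q : ℂ} (hp : ‖p‖ < 1) (hq : ‖q‖ < 1) (α β : Fin 8 → ℂ)
    {z : ℂ} (hz : z ≠ 0) : DifferentiableAt ℂ (poleProduct p q α β) z := by
  have hd := differentiable_doubleShifted hp hq
  refine DifferentiableAt.fun_finsetProd fun j _ => ?_
  exact ((hd _).comp (f := fun z => α j * z) z (by fun_prop)).mul
    ((hd _).comp (f := fun z => β j / z) z
      ((differentiableAt_const _).div differentiableAt_id hz))

/-- Independence of the contour for integrands `N / ∏_j (α_j z, β_j / z; p, q)_∞`. -/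
theorem loopIntegral_div_poleProduct_eq {p q : ℂ} (hp : ‖p‖ < 1) (hq : ‖q‖ < 1)
    {α β : Fin 8 → ℂ} {D E D' E' : Set ℂ} {γ γ' : ℝ → ℂ}
    (h : IsSeparatingContour D E γ) (h' : IsSeparatingContour D' E' γ')
    (hD : ellipticDownward p q β ⊆ D) (hD' : ellipticDownward p q β ⊆ D')
    (hE : ellipticUpward p q α ⊆ E) (hE' : ellipticUpward p q α ⊆ E')
    (h0 : (0 : ℂ) ∉ ellipticUpward p q α) {N : ℂ → ℂ} (hN : ∀ z, z ≠ 0 → DifferentiableAt ℂ N z) :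
    loopIntegral γ (fun z => N z / poleProduct p q α β z / z) =
      loopIntegral γ' (fun z => N z / poleProduct p q α β z / z) := by
  have han : ∀ {f : ℂ → ℂ}, (∀ z, z ≠ 0 → DifferentiableAt ℂ f z) →
      ∀ z, z ≠ 0 → MeromorphicAt f z := fun {f} hf z hz =>
    (DifferentiableOn.analyticAt (s := {0}ᶜ) (fun w hw => (hf w hw).differentiableWithinAt)
      (isOpen_compl_singleton.mem_nhds hz)).meromorphicAt
  refine h.loopIntegral_eq h' (S := ellipticDownward p q β ∪ ellipticUpward p q α) ?_ ?_ ?_ ?_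
  · rintro z (hz | hz)
    · exact Or.inl ⟨hD hz, hD' hz⟩
    · exact Or.inr ⟨hE hz, hE' hz⟩
  · intro r R hr
    refine ((finite_norm_gt_inter hp hq β (fun z hz => hz) hr).union
      (finite_norm_lt_inter hp hq α (fun z hz => hz) h0 R)).subset ?_
    rintro z ⟨hz | hz, hr, hR⟩
    · exact Or.inl ⟨hz, hr⟩
    · exact Or.inr ⟨hz, hR⟩
  · intro z hz
    exact ((han hN z hz).div (han (fun w hw => differentiableAt_poleProduct hp hq α β hw) z hz)).div
      (MeromorphicAt.id z)
  · intro z hz hzS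
    simp only [Set.mem_union, not_or] at hzS
    exact ((hN z hz).div (differentiableAt_poleProduct hp hq α β hz)
      (poleProduct_ne_zero_of_notMem hp hq hzS.2 hzS.1 hz)).div differentiableAt_id hz

/-! ### Continuity in the elliptic nome -/

theorem ContinuousAt.doubleShifted {X : Type*} [TopologicalSpace X] {u v : X → ℂ} {x : X} {q : ℂ}
    (hu : ContinuousAt u x) (hv : ContinuousAt v x) (hv1 : ‖v x‖ < 1) (hq : ‖q‖ < 1) :
    ContinuousAt (fun y => doubleShifted (u y) (v y) q) x :=
  ContinuousAt.comp (f := fun y => (u y, v y)) (continuousAt_doubleShifted hv1 hq) (hu.prodMk hv)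

theorem ContinuousAt.qShiftedFactorial {X : Type*} [TopologicalSpace X] {u v : X → ℂ} {x : X}
    (hu : ContinuousAt u x) (hv : ContinuousAt v x) (hv1 : ‖v x‖ < 1) :
    ContinuousAt (fun y => qShiftedFactorial (u y) (v y)) x :=
  ContinuousAt.comp (f := fun y => (u y, v y)) (continuousAt_qShiftedFactorial hv1) (hu.prodMk hv)

/-- The parameters `p ^ (e_j) c_j`. -/
def nomeParams (e : Fin 8 → ℕ) (c : Fin 8 → ℂ) (p : ℂ) : Fin 8 → ℂ := fun j => p ^ e j * c j

theorem nomeParams_ne_zero {e : Fin 8 → ℕ} {c : Fin 8 → ℂ} (hc : ∀ j, c j ≠ 0) {p : ℂ} (hp : p ≠ 0)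
    (j : Fin 8) : nomeParams e c p j ≠ 0 :=
  mul_ne_zero (pow_ne_zero _ hp) (hc j)

/-- Dichotomy by the total exponent `e j + a` of `p`: either it is zero and the point does not
depend on `p`, or a factor `p` makes the point small. -/
theorem nomeParams_mem_or_norm_lt {p q : ℂ} (hp : ‖p‖ < 1) (hq : ‖q‖ < 1) {e : Fin 8 → ℕ}
    {c : Fin 8 → ℂ} {M ε : ℝ} (hM : ∀ j, ‖c j‖ ≤ M) (hpM : M * ‖p‖ < ε) {P : ℂ → Prop}
    (hP : ∀ j, e j = 0 → ∀ b : ℕ, P (c j * q ^ b)) (j : Fin 8) (a b : ℕ) :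
    P (nomeParams e c p j * p ^ a * q ^ b) ∨ ‖nomeParams e c p j * p ^ a * q ^ b‖ < ε := by
  rcases Nat.eq_zero_or_pos (e j + a) with h | h
  · left
    have h1 : e j = 0 := by omega
    have h2 : a = 0 := by omega
    simpa [nomeParams, h1, h2] using hP j h1 b
  · right
    refine lt_of_le_of_lt ?_ hpM
    have h1 : nomeParams e c p j * p ^ a * q ^ b = c j * p ^ (e j + a) * q ^ b := by
      rw [nomeParams, pow_add]
      ring
    rw [h1, norm_mul, norm_mul, norm_pow, norm_pow]
    have h2 : ‖q‖ ^ b ≤ 1 := pow_le_one₀ (norm_nonneg _) hq.le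
    have h3 : ‖p‖ ^ (e j + a) ≤ ‖p‖ := pow_le_of_le_one (norm_nonneg _) hp.le h.ne'
    have hM0 : 0 ≤ M := (norm_nonneg _).trans (hM j)
    calc ‖c j‖ * ‖p‖ ^ (e j + a) * ‖q‖ ^ b ≤ M * ‖p‖ * 1 := by
          gcongr
          exact hM j
      _ = M * ‖p‖ := mul_one _

/-- The degeneration principle: a separating contour at `p = 0` can be used for all small `p`, and
the integral along it depends continuously on `p`. -/
theorem exists_degeneration {q : ℂ} (hq0 : q ≠ 0) (hq : ‖q‖ < 1) {D E : Set ℂ} {γ : ℝ → ℂ}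
    (h : IsSeparatingContour D E γ) {e e' : Fin 8 → ℕ} {c c' : Fin 8 → ℂ} (hc : ∀ j, c j ≠ 0)
    (hD : ∀ j, e' j = 0 → ∀ b : ℕ, c' j * q ^ b ∈ D)
    (hE : ∀ j, e j = 0 → ∀ b : ℕ, (c j * q ^ b)⁻¹ ∈ E) {N : ℂ → ℂ → ℂ}
    (hN : ∀ p z : ℂ, ‖p‖ < 1 → z ≠ 0 → ContinuousAt (fun y : ℂ × ℂ => N y.1 y.2) (p, z)) :
    ∃ δ : ℝ, 0 < δ ∧ δ < 1 ∧
      (∀ p : ℂ, p ≠ 0 → ‖p‖ < δ → IsSeparatingContour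
        (ellipticDownward p q (nomeParams e' c' p)) (ellipticUpward p q (nomeParams e c p)) γ) ∧
      ContinuousOn (fun p => loopIntegral γ (fun z =>
        N p z / poleProduct p q (nomeParams e c p) (nomeParams e' c' p) z / z))
        (Metric.ball 0 δ) := by
  obtain ⟨ε, hε, hext⟩ := h.exists_extend
  obtain ⟨M, hM0, hM, hM'⟩ : ∃ M : ℝ, 0 < M ∧ (∀ j, ‖c j‖ ≤ M) ∧ ∀ j, ‖c' j‖ ≤ M := by
    refine ⟨∑ j, ‖c j‖ + ∑ j, ‖c' j‖ + 1, by positivity, fun j => ?_, fun j => ?_⟩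
    · have h1 := Finset.single_le_sum (f := fun j => ‖c j‖) (fun _ _ => norm_nonneg _)
        (Finset.mem_univ j)
      have h2 : 0 ≤ ∑ j, ‖c' j‖ := Finset.sum_nonneg fun _ _ => norm_nonneg _
      linarith
    · have h1 := Finset.single_le_sum (f := fun j => ‖c' j‖) (fun _ _ => norm_nonneg _)
        (Finset.mem_univ j)
      have h2 : 0 ≤ ∑ j, ‖c j‖ := Finset.sum_nonneg fun _ _ => norm_nonneg _
      linarith
  -- The first bound keeps `|p| < 1`; the second gives `M |p| < ε`, so every `p`-dependent point
  -- falls under `exists_extend`.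
  set δ : ℝ := min (1 / 2) (ε / M) with hδ
  have hδ1 : δ < 1 := (min_le_left _ _).trans_lt (by norm_num)
  have hMp : ∀ p : ℂ, ‖p‖ < δ → M * ‖p‖ < ε := fun p hp => by
    have := hp.trans_le (min_le_right _ _)
    rwa [lt_div_iff₀ hM0, mul_comm] at this
  have hdown : ∀ p : ℂ, ‖p‖ < δ → ∀ (j : Fin 8) (a b : ℕ),
      nomeParams e' c' p j * p ^ a * q ^ b ∈ D ∨ ‖nomeParams e' c' p j * p ^ a * q ^ b‖ < ε :=
    fun p hp => nomeParams_mem_or_norm_lt (hp.trans hδ1) hq hM' (hMp p hp) (P := (· ∈ D)) hD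
  have hup : ∀ p : ℂ, ‖p‖ < δ → ∀ (j : Fin 8) (a b : ℕ),
      (nomeParams e c p j * p ^ a * q ^ b)⁻¹ ∈ E ∨ ‖nomeParams e c p j * p ^ a * q ^ b‖ < ε :=
    fun p hp => nomeParams_mem_or_norm_lt (hp.trans hδ1) hq hM (hMp p hp) (P := (·⁻¹ ∈ E)) hE
  have hinv : ∀ w : ℂ, w ≠ 0 → ‖w‖ < ε → 1 < ε * ‖w⁻¹‖ := fun w hw hwε => by
    rw [norm_inv, ← div_eq_mul_inv, one_lt_div (norm_pos_iff.mpr hw)]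
    exact hwε
  refine ⟨δ, lt_min (by norm_num) (div_pos hε hM0), hδ1, fun p hp0 hp => ?_, ?_⟩
  · refine hext _ _ ?_ ?_
    · rintro _ ⟨j, a, b, rfl⟩
      exact hdown p hp j a b
    · rintro _ ⟨j, a, b, rfl⟩
      refine (hup p hp j a b).imp_right (hinv _ ?_)
      exact mul_ne_zero (mul_ne_zero (nomeParams_ne_zero hc hp0 j) (pow_ne_zero _ hp0))
        (pow_ne_zero _ hq0)
  · have hne : ∀ p : ℂ, ‖p‖ < δ → ∀ x,
        poleProduct p q (nomeParams e c p) (nomeParams e' c' p) (γ x) ≠ 0 := by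
      intro p hp x
      refine poleProduct_ne_zero (hp.trans hδ1) hq (fun j a b hab => ?_) (fun j a b hab => ?_)
        (h.ne_zero x)
      -- Zeros are excluded one point at a time because `p = 0` is allowed here, and the full
      -- sequences may then contain `0`. The equation itself shows that the point in question is
      -- nonzero.
      · have hw0 := left_ne_zero_of_mul (hab.trans_ne one_ne_zero)
        refine (hext ∅ {(nomeParams e c p j * p ^ a * q ^ b)⁻¹} (by simp) ?_).notMem_excluded x ?_
        · rintro _ rfl
          exact (hup p hp j a b).imp_right (hinv _ hw0)
        · exact eq_inv_of_mul_eq_one_right hab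
      · refine (hext {nomeParams e' c' p j * p ^ a * q ^ b} ∅ ?_ (by simp)).notMem_included x hab
        rintro _ rfl
        exact hdown p hp j a b
    rw [continuousOn_iff_continuous_domRestrict]
    refine continuous_loopIntegral (X := Metric.ball (0 : ℂ) δ) h.contDiff
      (K := fun p z => N p z / poleProduct p q (nomeParams e c p) (nomeParams e' c' p) z / z) ?_
    rw [continuous_iff_continuousAt]
    rintro ⟨⟨p, hp⟩, x⟩
    have hpδ : ‖p‖ < δ := by simpa using hp
    have hp1 := hpδ.trans hδ1
    have hcp : ContinuousAt (fun y : Metric.ball (0 : ℂ) δ × ℝ => (y.1 : ℂ)) (⟨p, hp⟩, x) := by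
      fun_prop
    have hcγ : ContinuousAt (fun y : Metric.ball (0 : ℂ) δ × ℝ => γ y.2) (⟨p, hp⟩, x) :=
      (h.contDiff.continuous.comp continuous_snd).continuousAt
    have hcN : ContinuousAt (fun y : Metric.ball (0 : ℂ) δ × ℝ => N (y.1 : ℂ) (γ y.2))
        (⟨p, hp⟩, x) :=
      ContinuousAt.comp (g := fun y : ℂ × ℂ => N y.1 y.2)
        (f := fun y : Metric.ball (0 : ℂ) δ × ℝ => ((y.1 : ℂ), γ y.2))
        (hN p (γ x) hp1 (h.ne_zero x)) (hcp.prodMk hcγ)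
    refine (hcN.div ?_ (hne p hpδ x)).div hcγ (h.ne_zero x)
    refine tendsto_finsetProd _ fun j _ => ?_
    refine ContinuousAt.mul ?_ ?_
    · exact ContinuousAt.doubleShifted (((hcp.pow _).mul_const _).mul hcγ) hcp hp1 hq
    · exact ContinuousAt.doubleShifted (((hcp.pow _).mul_const _).div hcγ (h.ne_zero x)) hcp hp1 hq

/-- Nothing more is known about the chosen contour; in particular it may pass through removable
singularities of the integrand, where the formal quotient takes the value of a division by zero. -/
theorem separatedIntegral_eq {D E : Set ℂ} (h : ∃ γ, IsSeparatingContour D E γ) (f : ℂ → ℂ) :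
    ∃ γ, IsSeparatingContour D E γ ∧
      separatedIntegral D E f = (2 * Real.pi * Complex.I)⁻¹ * loopIntegral γ (fun z => f z / z) :=
  ⟨h.choose, h.choose_spec, dif_pos h⟩

/-- Each factor of the product vanishes at finitely many `z`. This supplies the exceptional sets for
`loopIntegral_congr_of_countable`. -/
theorem countable_doubleShifted_eq_zero {p q : ℂ} (hp : ‖p‖ < 1) (hq : ‖q‖ < 1) (c : ℂ)
    {k : ℤ} (hk : k ≠ 0) : {z : ℂ | doubleShifted (c * z ^ k) p q = 0}.Countable := by
  have hfin : ∀ v : ℂ, {z : ℂ | c * z ^ k * v = 1}.Finite := by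
    intro v
    by_cases hcv : c * v = 0
    · convert Set.finite_empty using 1
      ext z
      simp only [Set.mem_ofPred_eq, Set.mem_empty_iff_false, iff_false]
      intro h
      rw [mul_right_comm, hcv, zero_mul] at h
      exact zero_ne_one h
    obtain ⟨n, rfl | rfl⟩ := k.eq_nat_or_neg
    · have hn : 0 < n := by omega
      refine (Polynomial.nthRootsFinset n (c * v)⁻¹).finite_toSet.subset fun z hz => ?_
      rw [Finset.mem_coe, Polynomial.mem_nthRootsFinset hn]
      refine eq_inv_of_mul_eq_one_left ?_
      have : c * z ^ (n : ℤ) * v = 1 := hz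
      rw [zpow_natCast] at this
      linear_combination this
    · have hn : 0 < n := by omega
      refine (Polynomial.nthRootsFinset n (c * v)).finite_toSet.subset fun z hz => ?_
      rw [Finset.mem_coe, Polynomial.mem_nthRootsFinset hn]
      have h1 : c * z ^ (-(n : ℤ)) * v = 1 := hz
      rw [zpow_neg, zpow_natCast] at h1
      have h2 : z ^ n ≠ 0 := by
        intro h0
        simp [h0] at h1
      field_simp at h1
      exact h1.symm
  refine (Set.countable_iUnion fun m : ℕ × ℕ => (hfin (p ^ m.1 * q ^ m.2)).countable).mono ?_
  intro z hz
  obtain ⟨a, b, hab⟩ := (doubleShifted_eq_zero_iff hp hq).mp hz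
  refine Set.mem_iUnion.mpr ⟨(a, b), ?_⟩
  change c * z ^ k * (p ^ a * q ^ b) = 1
  rw [← hab]
  ring

theorem prod_univ_eq_end_mul_mid (f : Fin 8 → ℂ) :
    ∏ j, f j = (∏ j ∈ endIdx, f j) * ∏ j ∈ midIdx, f j := by
  rw [← Finset.prod_union (by decide)]
  congr 1
  decide

theorem ellipticIntegrand_eq (p q : ℂ) (t : Fin 8 → ℂ) (z : ℂ) :
    ellipticIntegrand p q t z =
      (∏ j, doubleShifted (p * q / (t j * z)) p q * doubleShifted (p * q / (t j / z)) p q) /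
        poleProduct p q t t z *
        (doubleShifted (z ^ 2) p q / doubleShifted (p * q / z ^ 2) p q *
          (doubleShifted (z ^ 2)⁻¹ p q / doubleShifted (p * q * z ^ 2) p q)) := by
  unfold ellipticIntegrand poleProduct
  simp only [ellipticGamma_eq]
  rw [← Finset.prod_div_distrib, div_eq_mul_inv, mul_inv, inv_div, inv_div, div_inv_eq_mul]
  congr 1
  refine Finset.prod_congr rfl fun j _ => ?_
  rw [div_mul_div_comm]

/-! ### The first degeneration -/

theorem exists_isSeparatingContour_trigS {q : ℂ} (hq0 : q ≠ 0) (hq : ‖q‖ < 1) {t : Fin 8 → ℂ}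
    (ht : ∀ j, t j ≠ 0) (hgen : GenericS q t) :
    ∃ γ, IsSeparatingContour {z | ∃ j ∈ midIdx, ∃ n : ℕ, z = t j * q ^ n}
      {z | ∃ j ∈ midIdx, ∃ n : ℕ, z = (t j * q ^ n)⁻¹} γ := by
  -- The finiteness lemmas are applied with nome `0`, the exponent `0` of the nome giving `0 ^ 0 =
  -- 1`.
  have hz : ‖(0 : ℂ)‖ < 1 := by simp
  have h0 : ∀ (j : Fin 8) (n : ℕ), t j * q ^ n ≠ 0 := fun j n =>
    mul_ne_zero (ht j) (pow_ne_zero _ hq0)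
  have hE0 : (0 : ℂ) ∉ {z | ∃ j ∈ midIdx, ∃ n : ℕ, z = (t j * q ^ n)⁻¹} := by
    rintro ⟨j, _, n, h⟩
    exact inv_ne_zero (h0 j n) h.symm
  refine exists_isSeparatingContour ?_ hE0 ?_
    (fun r hr => finite_norm_gt_inter hz hq t ?_ hr)
    (fun R => finite_norm_lt_inter hz hq t ?_ hE0 R)
  · rintro ⟨j, _, n, h⟩
    exact h0 j n h.symm
  · rw [Set.disjoint_left]
    rintro z ⟨i, hi, n, rfl⟩ ⟨j, hj, m, h⟩
    refine hgen i hi j hj (n + m) ?_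
    have h1 : t i * q ^ n * (t j * q ^ m) = 1 := by
      rw [h]
      exact inv_mul_cancel₀ (h0 j m)
    rw [← h1]
    ring
  · rintro z ⟨j, _, n, rfl⟩
    exact ⟨j, 0, n, by simp⟩
  · rintro z ⟨j, _, n, rfl⟩
    exact ⟨j, 0, n, by simp⟩

/-- The numerator of the integrand of `S_e (p q t_1, t_2, …, t_7, p q t_8)`. -/
noncomputable def numeratorS (q : ℂ) (t : Fin 8 → ℂ) (p z : ℂ) : ℂ :=
  qShiftedFactorial (z ^ 2) q * qShiftedFactorial (z ^ 2 * p) p *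
    (qShiftedFactorial (z ^ 2)⁻¹ q * qShiftedFactorial ((z ^ 2)⁻¹ * p) p) *
    ((∏ j ∈ endIdx, doubleShifted ((t j)⁻¹ / z) p q * doubleShifted ((t j)⁻¹ * z) p q) *
      ∏ j ∈ midIdx, doubleShifted (p * q / (t j * z)) p q * doubleShifted (p * q / (t j / z)) p q)

theorem differentiableAt_numeratorS {p q : ℂ} (hp : ‖p‖ < 1) (hq : ‖q‖ < 1) {t : Fin 8 → ℂ}
    (ht : ∀ j, t j ≠ 0) {z : ℂ} (hz : z ≠ 0) : DifferentiableAt ℂ (numeratorS q t p) z := by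
  have hd := differentiable_doubleShifted hp hq
  have h1 : ∀ u : ℂ → ℂ, DifferentiableAt ℂ u z →
      DifferentiableAt ℂ (fun z => doubleShifted (u z) p q) z := fun u hu => (hd _).comp z hu
  have h2 : ∀ (u : ℂ → ℂ), DifferentiableAt ℂ u z →
      DifferentiableAt ℂ (fun z => qShiftedFactorial (u z) q) z := fun u hu =>
    (differentiable_qShiftedFactorial hq _).comp z hu
  have h3 : ∀ (u : ℂ → ℂ), DifferentiableAt ℂ u z →
      DifferentiableAt ℂ (fun z => qShiftedFactorial (u z) p) z := fun u hu =>
    (differentiable_qShiftedFactorial hp _).comp z hu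
  have hz2 : z ^ 2 ≠ 0 := pow_ne_zero _ hz
  unfold numeratorS
  refine DifferentiableAt.mul (((h2 _ ?_).mul (h3 _ ?_)).mul ((h2 _ ?_).mul (h3 _ ?_))) ((?_ :
    DifferentiableAt ℂ (fun z => ∏ j ∈ endIdx, _) z).mul ?_)
  · fun_prop
  · fun_prop
  · fun_prop (disch := assumption)
  · fun_prop (disch := assumption)
  · refine DifferentiableAt.fun_finsetProd fun j _ => (h1 _ ?_).mul (h1 _ ?_)
    · fun_prop (disch := assumption)
    · fun_prop (disch := assumption)
  · refine DifferentiableAt.fun_finsetProd fun j _ => (h1 _ ?_).mul (h1 _ ?_)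
    · have := mul_ne_zero (ht j) hz
      fun_prop (disch := assumption)
    · have := div_ne_zero (ht j) hz
      fun_prop (disch := assumption)

theorem continuousAt_numeratorS {p q : ℂ} (hp : ‖p‖ < 1) (hq : ‖q‖ < 1) {t : Fin 8 → ℂ}
    (ht : ∀ j, t j ≠ 0) {z : ℂ} (hz : z ≠ 0) :
    ContinuousAt (fun y : ℂ × ℂ => numeratorS q t y.1 y.2) (p, z) := by
  have h1 : ∀ u : ℂ × ℂ → ℂ, ContinuousAt u (p, z) →
      ContinuousAt (fun y : ℂ × ℂ => doubleShifted (u y) y.1 q) (p, z) := fun u hu =>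
    hu.doubleShifted continuousAt_fst hp hq
  have h2 : ∀ u : ℂ × ℂ → ℂ, ContinuousAt u (p, z) →
      ContinuousAt (fun y : ℂ × ℂ => qShiftedFactorial (u y) q) (p, z) := fun u hu =>
    hu.qShiftedFactorial continuousAt_const hq
  have h3 : ∀ u : ℂ × ℂ → ℂ, ContinuousAt u (p, z) →
      ContinuousAt (fun y : ℂ × ℂ => qShiftedFactorial (u y) y.1) (p, z) := fun u hu =>
    hu.qShiftedFactorial continuousAt_fst hp
  have hz2 : (p, z).2 ^ 2 ≠ 0 := pow_ne_zero _ hz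
  have hz' : (p, z).2 ≠ 0 := hz
  unfold numeratorS
  refine ContinuousAt.mul (((h2 _ ?_).mul (h3 _ ?_)).mul ((h2 _ ?_).mul (h3 _ ?_))) ((?_ :
    ContinuousAt (fun y : ℂ × ℂ => ∏ j ∈ endIdx, _) (p, z)).mul ?_)
  · fun_prop
  · fun_prop
  · fun_prop (disch := assumption)
  · fun_prop (disch := assumption)
  · refine tendsto_finsetProd _ fun j _ => (h1 _ ?_).mul (h1 _ ?_)
    · fun_prop (disch := assumption)
    · fun_prop (disch := assumption)
  · refine tendsto_finsetProd _ fun j _ => (h1 _ ?_).mul (h1 _ ?_)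
    · have : t j * (p, z).2 ≠ 0 := mul_ne_zero (ht j) hz
      fun_prop (disch := assumption)
    · have : t j / (p, z).2 ≠ 0 := div_ne_zero (ht j) hz
      fun_prop (disch := assumption)

/-- Removing the row `j = 0` and then the column `k = 0` turns `x` into `p q x`. Hence `1 /
Γ_e(z^{±2})` contributes no poles, although its formal denominator has zeros. -/
theorem doubleShifted_div_doubleShifted {p q : ℂ} (hp : ‖p‖ < 1) (hq : ‖q‖ < 1) {x : ℂ}
    (hx : doubleShifted (p * q * x) p q ≠ 0) :
    doubleShifted x p q / doubleShifted (p * q * x) p q =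
      qShiftedFactorial x q * qShiftedFactorial (x * p) p := by
  rw [show p * q * x = x * p * q by ring] at hx ⊢
  rw [doubleShifted_rec x hp hq, doubleShifted_rec' (x * p) hp hq]
  field_simp

/-- The exponents of `p` in the parameters of the first degeneration. -/
def exponentEnd (j : Fin 8) : ℕ := if j ∈ endIdx then 1 else 0

/-- The coefficients of the parameters of the first degeneration. -/
noncomputable def coeffEnd (q : ℂ) (t : Fin 8 → ℂ) (j : Fin 8) : ℂ :=
  if j ∈ endIdx then q * t j else t j

theorem notMem_endIdx_of_mem_midIdx {j : Fin 8} (hj : j ∈ midIdx) : j ∉ endIdx := by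
  revert j
  decide

theorem mem_midIdx_of_notMem_endIdx {j : Fin 8} (hj : j ∉ endIdx) : j ∈ midIdx := by
  revert j
  decide

theorem nomeParams_end (q : ℂ) (t : Fin 8 → ℂ) (p : ℂ) {j : Fin 8} (hj : j ∈ endIdx) :
    nomeParams exponentEnd (coeffEnd q t) p j = p * q * t j := by
  simp [nomeParams, exponentEnd, coeffEnd, hj, mul_assoc]

theorem nomeParams_mid (q : ℂ) (t : Fin 8 → ℂ) (p : ℂ) {j : Fin 8} (hj : j ∈ midIdx) :
    nomeParams exponentEnd (coeffEnd q t) p j = t j := by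
  simp [nomeParams, exponentEnd, coeffEnd, notMem_endIdx_of_mem_midIdx hj]

theorem paramsS_eq (p q : ℂ) (t : Fin 8 → ℂ) :
    paramsS p q t = nomeParams exponentEnd (coeffEnd q t) p := by
  funext j
  fin_cases j <;> simp [paramsS, nomeParams, exponentEnd, coeffEnd, endIdx, mul_assoc]

theorem coeffEnd_ne_zero {q : ℂ} (hq0 : q ≠ 0) {t : Fin 8 → ℂ} (ht : ∀ j, t j ≠ 0) (j : Fin 8) :
    coeffEnd q t j ≠ 0 := by
  unfold coeffEnd
  split_ifs
  · exact mul_ne_zero hq0 (ht j)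
  · exact ht j

/-- For a parameter `p q t_j` the numerator argument `p q / (p q t_j z)` loses its dependence on
`p`. The hypotheses `h1` and `h2` exclude the removable points. -/
theorem ellipticIntegrand_paramsS {p q : ℂ} (hp0 : p ≠ 0) (hp : ‖p‖ < 1) (hq0 : q ≠ 0)
    (hq : ‖q‖ < 1) (t : Fin 8 → ℂ) {z : ℂ}
    (h1 : doubleShifted (p * q * z ^ 2) p q ≠ 0) (h2 : doubleShifted (p * q / z ^ 2) p q ≠ 0) :
    ellipticIntegrand p q (paramsS p q t) z =
      numeratorS q t p z / poleProduct p q (paramsS p q t) (paramsS p q t) z := by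
  have e2 : doubleShifted (z ^ 2)⁻¹ p q / doubleShifted (p * q / z ^ 2) p q = _ :=
    doubleShifted_div_doubleShifted (x := (z ^ 2)⁻¹) hp hq h2
  have e3 : (∏ j, doubleShifted (p * q / (paramsS p q t j * z)) p q *
      doubleShifted (p * q / (paramsS p q t j / z)) p q) =
      (∏ j ∈ endIdx, doubleShifted ((t j)⁻¹ / z) p q * doubleShifted ((t j)⁻¹ * z) p q) *
      ∏ j ∈ midIdx, doubleShifted (p * q / (t j * z)) p q *
        doubleShifted (p * q / (t j / z)) p q := by
    rw [prod_univ_eq_end_mul_mid, paramsS_eq]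
    have hpq := mul_ne_zero hp0 hq0
    congr 1
    · refine Finset.prod_congr rfl fun j hj => ?_
      rw [nomeParams_end q t p hj, mul_assoc _ (t j) z, mul_div_assoc _ (t j) z,
        div_mul_cancel_left₀ hpq, div_mul_cancel_left₀ hpq]
      congr 2
      · rw [mul_inv, div_eq_mul_inv]
      · rw [inv_div, div_eq_mul_inv, mul_comm]
    · refine Finset.prod_congr rfl fun j hj => ?_
      rw [nomeParams_mid q t p hj]
  rw [ellipticIntegrand_eq, numeratorS, ← e3, ← e2, ← doubleShifted_div_doubleShifted hp hq h1]
  ring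

/-- At `p = 0` the pole factors of `t_1, t_8`, the numerators of `t_2, …, t_7` and the base-`p`
factorials all become `1`. -/
theorem numeratorS_zero {q : ℂ} (hq : ‖q‖ < 1) (t : Fin 8 → ℂ) (z : ℂ) :
    numeratorS q t 0 z / poleProduct 0 q (nomeParams exponentEnd (coeffEnd q t) 0)
      (nomeParams exponentEnd (coeffEnd q t) 0) z = trigIntegrandS q t z := by
  have e1 : poleProduct 0 q (nomeParams exponentEnd (coeffEnd q t) 0)
      (nomeParams exponentEnd (coeffEnd q t) 0) z =
      ∏ j ∈ midIdx, qShiftedFactorial (t j * z) q * qShiftedFactorial (t j / z) q := by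
    rw [poleProduct, prod_univ_eq_end_mul_mid, Finset.prod_eq_one, one_mul]
    · refine Finset.prod_congr rfl fun j hj => ?_
      rw [nomeParams_mid q t 0 hj, doubleShifted_zero_mid _ hq, doubleShifted_zero_mid _ hq]
    · intro j hj
      rw [nomeParams_end q t 0 hj]
      simp [doubleShifted_zero_left]
  rw [e1, trigIntegrandS, numeratorS]
  simp only [mul_zero, zero_mul, zero_div, qShiftedFactorial_zero_right,
    doubleShifted_zero_mid _ hq, qShiftedFactorial_zero_left, sub_zero, mul_one,
    Finset.prod_const_one]
  congr 2
  exact Finset.prod_congr rfl fun j _ => by rw [mul_comm]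

theorem tendsto_ellipticS_paramsS {q : ℂ} (hq0 : q ≠ 0) (hq : ‖q‖ < 1) {t : Fin 8 → ℂ}
    (ht : ∀ j, t j ≠ 0) (hgen : GenericS q t) :
    Tendsto (fun p => ellipticS p q (paramsS p q t)) (𝓝[≠] 0) (𝓝 (trigS q t)) := by
  obtain ⟨γ₀, hγ₀, hval⟩ := separatedIntegral_eq
    (exists_isSeparatingContour_trigS hq0 hq ht hgen) (trigIntegrandS q t)
  have hmid : ∀ j, exponentEnd j = 0 → j ∈ midIdx := fun j hj => by
    refine mem_midIdx_of_notMem_endIdx fun h => ?_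
    simp [exponentEnd, h] at hj
  have hcoeff : ∀ j, exponentEnd j = 0 → coeffEnd q t j = t j := fun j hj => by
    simp [coeffEnd, notMem_endIdx_of_mem_midIdx (hmid j hj)]
  obtain ⟨δ, hδ, hδ1, hsep, hcont⟩ := exists_degeneration (N := numeratorS q t) hq0 hq hγ₀
    (coeffEnd_ne_zero hq0 ht) (e := exponentEnd) (e' := exponentEnd) (c' := coeffEnd q t)
    (fun j hj b => ⟨j, hmid j hj, b, by rw [hcoeff j hj]⟩)
    (fun j hj b => ⟨j, hmid j hj, b, by rw [hcoeff j hj]⟩)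
    (fun p z hp hz => continuousAt_numeratorS hp hq ht hz)
  set F : ℂ → ℂ := fun p => loopIntegral γ₀ (fun z => numeratorS q t p z /
    poleProduct p q (nomeParams exponentEnd (coeffEnd q t) p)
      (nomeParams exponentEnd (coeffEnd q t) p) z / z) with hF
  have hF0 : (2 * Real.pi * Complex.I)⁻¹ * F 0 = trigS q t := by
    rw [trigS, hval, hF]
    simp only [numeratorS_zero hq]
  rw [← hF0]
  have hlim : Tendsto F (𝓝[≠] 0) (𝓝 (F 0)) :=
    (hcont.continuousAt (Metric.isOpen_ball.mem_nhds (by simpa using hδ))).tendsto.mono_left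
      nhdsWithin_le_nhds
  refine (hlim.const_mul _).congr' ?_
  filter_upwards [self_mem_nhdsWithin, nhdsWithin_le_nhds (Metric.ball_mem_nhds 0 hδ)] with p hp0' hpδ
  have hp0 : p ≠ 0 := hp0'
  have hpδ' : ‖p‖ < δ := by simpa using hpδ
  have hp : ‖p‖ < 1 := hpδ'.trans hδ1
  have hs := hsep p hp0 hpδ'
  obtain ⟨γ, hγ, hv⟩ := separatedIntegral_eq ⟨γ₀, hs⟩ (ellipticIntegrand p q (paramsS p q t))
  rw [ellipticS, paramsS_eq]
  rw [paramsS_eq] at hv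
  rw [hv]
  congr 1
  -- The contour behind `ellipticS` may meet the zeros of the cancelled factors, so the two forms of
  -- the integrand are compared off a countable set.
  have hc1 := countable_doubleShifted_eq_zero hp hq (p * q) (k := 2) (by norm_num)
  have hc2 := countable_doubleShifted_eq_zero hp hq (p * q) (k := -2) (by norm_num)
  rw [loopIntegral_congr_of_countable (γ := γ) (hγ.contDiff.differentiable one_ne_zero)
    (hc1.union hc2) (g := fun z => numeratorS q t p z /
    poleProduct p q (nomeParams exponentEnd (coeffEnd q t) p)
      (nomeParams exponentEnd (coeffEnd q t) p) z / z)]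
  · exact loopIntegral_div_poleProduct_eq hp hq hs hγ subset_rfl subset_rfl subset_rfl subset_rfl
      (zero_notMem_ellipticUpward hp0 hq0 (nomeParams_ne_zero (coeffEnd_ne_zero hq0 ht) hp0))
      fun z hz => differentiableAt_numeratorS hp hq ht hz
  · intro x hx
    simp only [Set.mem_union, Set.mem_ofPred_eq, not_or] at hx
    rw [← paramsS_eq, ellipticIntegrand_paramsS hp0 hp hq0 hq t]
    · exact_mod_cast hx.1
    · have := hx.2
      rwa [zpow_neg, ← div_eq_mul_inv] at this

theorem eventually_ellipticAdmissible_paramsS {q : ℂ} (hq : ‖q‖ < 1) {t : Fin 8 → ℂ}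
    (hgen : GenericS q t) : ∀ᶠ p in 𝓝[≠] (0 : ℂ), EllipticAdmissible p q (paramsS p q t) := by
  -- With all coefficients bounded by `M`, a product containing a factor `p` has norm at most `M²
  -- |p| < 1`; the products without one are covered by `GenericS`.
  set M : ℝ := 1 + ∑ j, ‖coeffEnd q t j‖ with hM
  have hM1 : ∀ j, ‖coeffEnd q t j‖ ≤ M := fun j => by
    have := Finset.single_le_sum (f := fun j => ‖coeffEnd q t j‖) (fun _ _ => norm_nonneg _)
      (Finset.mem_univ j)
    linarith
  have hM0 : 1 ≤ M := by
    have : 0 ≤ ∑ j, ‖coeffEnd q t j‖ := Finset.sum_nonneg fun _ _ => norm_nonneg _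
    linarith
  have hsmall : ∀ᶠ p in 𝓝[≠] (0 : ℂ), ‖p‖ < (M ^ 2)⁻¹ := by
    refine nhdsWithin_le_nhds ?_
    have := Metric.ball_mem_nhds (0 : ℂ) (ε := (M ^ 2)⁻¹) (by positivity)
    filter_upwards [this] with p hp
    simpa using hp
  filter_upwards [hsmall] with p hp i j a b
  have hM2 : 1 ≤ M ^ 2 := one_le_pow₀ hM0
  have hp1 : ‖p‖ < 1 := hp.trans_le (inv_le_one_of_one_le₀ hM2)
  rw [paramsS_eq]
  intro h
  rcases Nat.eq_zero_or_pos (exponentEnd i + exponentEnd j + a) with h0 | h0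
  · have hi : i ∈ midIdx := mem_midIdx_of_notMem_endIdx fun h => by
      simp [exponentEnd, h] at h0
    have hj : j ∈ midIdx := mem_midIdx_of_notMem_endIdx fun h => by
      simp [exponentEnd, h] at h0
    have ha : a = 0 := by omega
    rw [nomeParams_mid q t p hi, nomeParams_mid q t p hj, ha, pow_zero, mul_one] at h
    exact hgen i hi j hj b h
  · have h1 : nomeParams exponentEnd (coeffEnd q t) p i * nomeParams exponentEnd (coeffEnd q t) p j *
        p ^ a * q ^ b = coeffEnd q t i * coeffEnd q t j *
        p ^ (exponentEnd i + exponentEnd j + a) * q ^ b := by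
      rw [nomeParams, nomeParams, pow_add, pow_add]
      ring
    rw [h1] at h
    have h2 := congrArg norm h
    rw [norm_mul, norm_mul, norm_mul, norm_pow, norm_pow, norm_one] at h2
    have h3 : ‖q‖ ^ b ≤ 1 := pow_le_one₀ (norm_nonneg _) hq.le
    have h4 : ‖p‖ ^ (exponentEnd i + exponentEnd j + a) ≤ ‖p‖ :=
      pow_le_of_le_one (norm_nonneg _) hp1.le h0.ne'
    have h5 : ‖coeffEnd q t i‖ * ‖coeffEnd q t j‖ * ‖p‖ ^ (exponentEnd i + exponentEnd j + a) *
        ‖q‖ ^ b ≤ M * M * ‖p‖ * 1 := by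
      gcongr
      · exact hM1 i
      · exact hM1 j
    rw [h2, mul_one, ← sq] at h5
    have h6 : M ^ 2 * ‖p‖ < 1 := by
      calc M ^ 2 * ‖p‖ < M ^ 2 * (M ^ 2)⁻¹ := by gcongr
        _ = 1 := mul_inv_cancel₀ (by positivity)
    linarith

/-! ### The second degeneration -/

theorem exists_isSeparatingContour_trigU {q : ℂ} (hq0 : q ≠ 0) (hq : ‖q‖ < 1) {t : Fin 8 → ℂ}
    (ht : ∀ j, t j ≠ 0) (hgen : GenericU q t) :
    ∃ γ, IsSeparatingContour {z | ∃ j ∈ endIdx, ∃ n : ℕ, z = t j * q ^ n}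
      ({z | ∃ j ∈ endIdx, ∃ n : ℕ, z = q * (t j * q ^ n)⁻¹} ∪
        {z | ∃ i ∈ midIdx, ∃ n : ℕ, z = (t i * q ^ n)⁻¹}) γ := by
  have hz : ‖(0 : ℂ)‖ < 1 := by simp
  have h0 : ∀ (j : Fin 8) (n : ℕ), t j * q ^ n ≠ 0 := fun j n =>
    mul_ne_zero (ht j) (pow_ne_zero _ hq0)
  have hE0 : (0 : ℂ) ∉ ({z | ∃ j ∈ endIdx, ∃ n : ℕ, z = q * (t j * q ^ n)⁻¹} ∪
      {z | ∃ i ∈ midIdx, ∃ n : ℕ, z = (t i * q ^ n)⁻¹} : Set ℂ) := by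
    rintro (⟨j, _, n, h⟩ | ⟨j, _, n, h⟩)
    · exact mul_ne_zero hq0 (inv_ne_zero (h0 j n)) h.symm
    · exact inv_ne_zero (h0 j n) h.symm
  refine exists_isSeparatingContour ?_ hE0 ?_
    (fun r hr => finite_norm_gt_inter hz hq t ?_ hr)
    -- The sequence `q / (t_j q^n)` is the upward sequence of the parameter `t_j / q`.
    (fun R => finite_norm_lt_inter hz hq (fun j => if j ∈ endIdx then t j / q else t j) ?_ hE0 R)
  · rintro ⟨j, _, n, h⟩
    exact h0 j n h.symm
  · rw [Set.disjoint_left]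
    rintro z ⟨i, hi, n, rfl⟩ (⟨j, hj, m, h⟩ | ⟨j, hj, m, h⟩)
    · refine hgen.1 i hi j hj (n + m) ?_
      have h1 : t i * q ^ n * (t j * q ^ m) = q := by
        rw [h]
        exact inv_mul_cancel_right₀ (h0 j m) q
      rw [pow_add, ← mul_mul_mul_comm, h1]
    · refine hgen.2 i hi j hj (n + m) ?_
      have h1 : t i * q ^ n * (t j * q ^ m) = 1 := by
        rw [h]
        exact inv_mul_cancel₀ (h0 j m)
      rw [pow_add, ← mul_mul_mul_comm, h1]
  · rintro z ⟨j, _, n, rfl⟩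
    exact ⟨j, 0, n, by simp⟩
  · rintro z (⟨j, hj, n, rfl⟩ | ⟨j, hj, n, rfl⟩)
    · refine ⟨j, 0, n, ?_⟩
      have := ht j
      simp only [hj, if_true, pow_zero, mul_one]
      field_simp
    · exact ⟨j, 0, n, by simp [notMem_endIdx_of_mem_midIdx hj]⟩

/-- The exponents of `p` in the included pole sequences of the second degeneration. -/
def exponentMid (j : Fin 8) : ℕ := if j ∈ endIdx then 0 else 1

/-- The coefficients of the included pole sequences of the second degeneration. -/
noncomputable def coeffMid (q : ℂ) (t : Fin 8 → ℂ) (j : Fin 8) : ℂ :=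
  if j ∈ endIdx then t j else q * t j

/-- The coefficients of the excluded pole sequences of the second degeneration. -/
noncomputable def coeffDiv (q : ℂ) (t : Fin 8 → ℂ) (j : Fin 8) : ℂ :=
  if j ∈ endIdx then t j / q else t j

theorem coeffMid_ne_zero {q : ℂ} (hq0 : q ≠ 0) {t : Fin 8 → ℂ} (ht : ∀ j, t j ≠ 0) (j : Fin 8) :
    coeffMid q t j ≠ 0 := by
  unfold coeffMid
  split_ifs
  · exact ht j
  · exact mul_ne_zero hq0 (ht j)

theorem coeffDiv_ne_zero {q : ℂ} (hq0 : q ≠ 0) {t : Fin 8 → ℂ} (ht : ∀ j, t j ≠ 0) (j : Fin 8) :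
    coeffDiv q t j ≠ 0 := by
  unfold coeffDiv
  split_ifs
  · exact div_ne_zero (ht j) hq0
  · exact ht j

theorem nomeParams_zero_exponent (c : Fin 8 → ℂ) (p : ℂ) : nomeParams (fun _ => 0) c p = c := by
  funext j
  simp [nomeParams]

/-- The numerator of the symmetry-broken integrand of the second degeneration. -/
noncomputable def numeratorU (q μ : ℂ) (t : Fin 8 → ℂ) (p z : ℂ) : ℂ :=
  2 * ((jacobiThetaR (t 0 * t 7 / (μ * z)) q * jacobiThetaR (z / μ) q) /
      (jacobiThetaR (t 0 / μ) q * jacobiThetaR (t 7 / μ) q)) *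
    (qShiftedFactorial (z ^ 2 / q) p * qShiftedFactorial (p * q / z ^ 2) p) *
    ((∏ j ∈ endIdx, doubleShifted (p * q / (t j / q * z)) p q *
        doubleShifted (p * q / (t j / z)) p q) *
      ∏ j ∈ midIdx, doubleShifted (p * q / (t j * z)) p q * doubleShifted (z / t j) p q)

theorem differentiableAt_theta_factor {q μ : ℂ} (hq : ‖q‖ < 1) (hμ : μ ≠ 0) {t : Fin 8 → ℂ}
    (ht : ∀ j, t j ≠ 0) {z : ℂ} (hz : z ≠ 0) :
    DifferentiableAt ℂ (fun z =>
      2 * ((jacobiThetaR (t 0 * t 7 / (μ * z)) q * jacobiThetaR (z / μ) q) /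
        (jacobiThetaR (t 0 / μ) q * jacobiThetaR (t 7 / μ) q))) z := by
  have hμz := mul_ne_zero hμ hz
  refine (DifferentiableAt.div_const (DifferentiableAt.mul ?_ ?_) _).const_mul _
  · refine (differentiableAt_jacobiThetaR hq (div_ne_zero (mul_ne_zero (ht 0) (ht 7)) hμz)).comp
      (f := fun z => t 0 * t 7 / (μ * z)) z ?_
    fun_prop (disch := assumption)
  · refine (differentiableAt_jacobiThetaR hq (div_ne_zero hz hμ)).comp (f := fun z => z / μ) z ?_
    fun_prop (disch := assumption)

theorem differentiableAt_numeratorU {p q μ : ℂ} (hp : ‖p‖ < 1) (hq0 : q ≠ 0) (hq : ‖q‖ < 1)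
    (hμ : μ ≠ 0) {t : Fin 8 → ℂ} (ht : ∀ j, t j ≠ 0) {z : ℂ} (hz : z ≠ 0) :
    DifferentiableAt ℂ (numeratorU q μ t p) z := by
  have hd := differentiable_doubleShifted hp hq
  have h1 : ∀ u : ℂ → ℂ, DifferentiableAt ℂ u z →
      DifferentiableAt ℂ (fun z => doubleShifted (u z) p q) z := fun u hu => (hd _).comp z hu
  have h3 : ∀ (u : ℂ → ℂ), DifferentiableAt ℂ u z →
      DifferentiableAt ℂ (fun z => qShiftedFactorial (u z) p) z := fun u hu =>
    (differentiable_qShiftedFactorial hp _).comp z hu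
  have hz2 : z ^ 2 ≠ 0 := pow_ne_zero _ hz
  unfold numeratorU
  refine DifferentiableAt.mul ((differentiableAt_theta_factor hq hμ ht hz).mul ((h3 _ ?_).mul
    (h3 _ ?_))) ((?_ : DifferentiableAt ℂ (fun z => ∏ j ∈ endIdx, _) z).mul ?_)
  · fun_prop
  · fun_prop (disch := assumption)
  · refine DifferentiableAt.fun_finsetProd fun j _ => (h1 _ ?_).mul (h1 _ ?_)
    · have := mul_ne_zero (div_ne_zero (ht j) hq0) hz
      fun_prop (disch := assumption)
    · have := div_ne_zero (ht j) hz
      fun_prop (disch := assumption)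
  · refine DifferentiableAt.fun_finsetProd fun j _ => (h1 _ ?_).mul (h1 _ ?_)
    · have := mul_ne_zero (ht j) hz
      fun_prop (disch := assumption)
    · fun_prop

theorem continuousAt_numeratorU {p q μ : ℂ} (hp : ‖p‖ < 1) (hq0 : q ≠ 0) (hq : ‖q‖ < 1)
    (hμ : μ ≠ 0) {t : Fin 8 → ℂ} (ht : ∀ j, t j ≠ 0) {z : ℂ} (hz : z ≠ 0) :
    ContinuousAt (fun y : ℂ × ℂ => numeratorU q μ t y.1 y.2) (p, z) := by
  have h1 : ∀ u : ℂ × ℂ → ℂ, ContinuousAt u (p, z) →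
      ContinuousAt (fun y : ℂ × ℂ => doubleShifted (u y) y.1 q) (p, z) := fun u hu =>
    hu.doubleShifted continuousAt_fst hp hq
  have h3 : ∀ u : ℂ × ℂ → ℂ, ContinuousAt u (p, z) →
      ContinuousAt (fun y : ℂ × ℂ => qShiftedFactorial (u y) y.1) (p, z) := fun u hu =>
    hu.qShiftedFactorial continuousAt_fst hp
  have hz2 : (p, z).2 ^ 2 ≠ 0 := pow_ne_zero _ hz
  have hz' : (p, z).2 ≠ 0 := hz
  have hθ := ContinuousAt.comp (f := fun y : ℂ × ℂ => y.2) (x := (p, z))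
    (differentiableAt_theta_factor hq hμ ht hz).continuousAt continuousAt_snd
  unfold numeratorU
  refine ContinuousAt.mul (hθ.mul ((h3 _ ?_).mul (h3 _ ?_))) ((?_ :
    ContinuousAt (fun y : ℂ × ℂ => ∏ j ∈ endIdx, _) (p, z)).mul ?_)
  · fun_prop
  · fun_prop (disch := assumption)
  · refine tendsto_finsetProd _ fun j _ => (h1 _ ?_).mul (h1 _ ?_)
    · have : t j / q * (p, z).2 ≠ 0 := mul_ne_zero (div_ne_zero (ht j) hq0) hz
      fun_prop (disch := assumption)
    · have : t j / (p, z).2 ≠ 0 := div_ne_zero (ht j) hz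
      fun_prop (disch := assumption)
  · refine tendsto_finsetProd _ fun j _ => (h1 _ ?_).mul (h1 _ ?_)
    · have : t j * (p, z).2 ≠ 0 := mul_ne_zero (ht j) hz
      fun_prop (disch := assumption)
    · fun_prop

/-- The factor `1 - z² / q` arises as `(z² / q; p)_∞` at `p = 0`; its companion `(p q / z²; p)_∞`
becomes `1`. -/
theorem numeratorU_zero {q : ℂ} (hq : ‖q‖ < 1) (μ : ℂ) (t : Fin 8 → ℂ) (z : ℂ) :
    numeratorU q μ t 0 z / poleProduct 0 q (nomeParams (fun _ => 0) (coeffDiv q t) 0)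
      (nomeParams exponentMid (coeffMid q t) 0) z = trigIntegrandU q μ t z := by
  have e1 : poleProduct 0 q (nomeParams (fun _ => 0) (coeffDiv q t) 0)
      (nomeParams exponentMid (coeffMid q t) 0) z =
      (∏ j ∈ endIdx, qShiftedFactorial (t j * z / q) q * qShiftedFactorial (t j / z) q) *
      ∏ j ∈ midIdx, qShiftedFactorial (t j * z) q := by
    rw [poleProduct, prod_univ_eq_end_mul_mid, nomeParams_zero_exponent]
    congr 1
    · refine Finset.prod_congr rfl fun j hj => ?_
      rw [doubleShifted_zero_mid _ hq, doubleShifted_zero_mid _ hq]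
      simp [coeffDiv, nomeParams, exponentMid, coeffMid, hj, div_mul_eq_mul_div]
    · refine Finset.prod_congr rfl fun j hj => ?_
      have hj' := notMem_endIdx_of_mem_midIdx hj
      rw [doubleShifted_zero_mid _ hq, doubleShifted_zero_mid _ hq]
      simp [coeffDiv, nomeParams, exponentMid, coeffMid, hj', qShiftedFactorial_zero_left]
  rw [e1, trigIntegrandU, numeratorU]
  simp only [zero_mul, zero_div, qShiftedFactorial_zero_right,
    doubleShifted_zero_mid _ hq, qShiftedFactorial_zero_left, sub_zero, mul_one, one_mul,
    Finset.prod_const_one, Finset.prod_div_distrib]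
  rw [mul_comm (∏ j ∈ endIdx, _) (∏ j ∈ midIdx, _), ← div_mul_div_comm, mul_div_assoc,
    mul_div_assoc]
  ring

/-- This is `Γ_e(x) θ(x; q) = Γ_e(p x)`: the theta function removes the row of poles without a
factor `p`, which is the one that would pinch the contour. -/
theorem gamma_mul_theta {p q : ℂ} (hp0 : p ≠ 0) (hp : ‖p‖ < 1) (hq : ‖q‖ < 1) {x : ℂ}
    (hx : doubleShifted x p q ≠ 0) :
    doubleShifted (p * q / x) p q / doubleShifted x p q * jacobiThetaR x q =
      doubleShifted (p * q / (p * x)) p q / doubleShifted (p * x) p q := by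
  rw [mul_div_mul_left _ _ hp0, doubleShifted_rec (q / x) hp hq, jacobiThetaR]
  rw [doubleShifted_rec x hp hq] at hx ⊢
  have h1 := left_ne_zero_of_mul hx
  have h2 := right_ne_zero_of_mul hx
  rw [mul_comm p x, show p * q / x = q / x * p by ring]
  field_simp

/-- This is `1 / (Γ_e(x) Γ_e(1 / x)) = θ(x; q) θ(1 / x; p)` divided by `θ(x; q)`. Hence the
denominator `θ(w²; q)` of the symmetry-breaking factor creates no poles. -/
theorem gamma_sq_div_theta {p q : ℂ} (hp : ‖p‖ < 1) (hq : ‖q‖ < 1) {x : ℂ}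
    (h1 : doubleShifted (p * q / x) p q ≠ 0) (h2 : doubleShifted (p * q * x) p q ≠ 0)
    (h3 : jacobiThetaR x q ≠ 0) :
    doubleShifted x p q / doubleShifted (p * q / x) p q *
      (doubleShifted x⁻¹ p q / doubleShifted (p * q * x) p q) / jacobiThetaR x q =
      qShiftedFactorial (p * x) p * qShiftedFactorial x⁻¹ p := by
  have e1 : doubleShifted x p q = qShiftedFactorial x q *
      (qShiftedFactorial (p * x) p * doubleShifted (p * q * x) p q) := by
    rw [doubleShifted_rec x hp hq, doubleShifted_rec' (x * p) hp hq, mul_comm x p,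
      mul_right_comm p x q]
  have e2 : doubleShifted x⁻¹ p q = qShiftedFactorial x⁻¹ p *
      (qShiftedFactorial (q / x) q * doubleShifted (p * q / x) p q) := by
    rw [doubleShifted_rec' x⁻¹ hp hq, inv_mul_eq_div, doubleShifted_rec (q / x) hp hq,
      show q / x * p = p * q / x by ring]
  rw [e1, e2]
  rw [jacobiThetaR] at h3 ⊢
  have h4 := left_ne_zero_of_mul h3
  have h5 := right_ne_zero_of_mul h3
  generalize doubleShifted (p * q * x) p q = X at *
  generalize doubleShifted (p * q / x) p q = Y at *
  field_simp

theorem paramsU_end (s : ℂ) (t : Fin 8 → ℂ) {j : Fin 8} (hj : j ∈ endIdx) :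
    paramsU s t j = s⁻¹ * t j := by
  simp only [endIdx, Finset.mem_insert, Finset.mem_singleton] at hj
  rcases hj with rfl | rfl <;> rfl

theorem paramsU_mid (s : ℂ) (t : Fin 8 → ℂ) {j : Fin 8} (hj : j ∈ midIdx) :
    paramsU s t j = s * t j := by
  simp only [midIdx, Finset.mem_insert, Finset.mem_singleton] at hj
  rcases hj with rfl | rfl | rfl | rfl | rfl | rfl <;> rfl

theorem paramsU_ne_zero {s : ℂ} (hs : s ≠ 0) {t : Fin 8 → ℂ} (ht : ∀ j, t j ≠ 0) (j : Fin 8) :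
    paramsU s t j ≠ 0 := by
  by_cases hj : j ∈ endIdx
  · rw [paramsU_end s t hj]
    exact mul_ne_zero (inv_ne_zero hs) (ht j)
  · rw [paramsU_mid s t (mem_midIdx_of_notMem_endIdx hj)]
    exact mul_ne_zero hs (ht j)

theorem mul_ellipticDownward_paramsU {p q s : ℂ} (hs : s ≠ 0) (hsq : s ^ 2 = p * q)
    (t : Fin 8 → ℂ) : ∀ z ∈ ellipticDownward p q (nomeParams exponentMid (coeffMid q t) p),
      z / s ∈ ellipticDownward p q (paramsU s t) := by
  rintro _ ⟨j, a, b, rfl⟩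
  refine ⟨j, a, b, ?_⟩
  by_cases hj : j ∈ endIdx
  · rw [paramsU_end s t hj]
    simp only [nomeParams, exponentMid, coeffMid, hj, if_true]
    field_simp
  · rw [paramsU_mid s t (mem_midIdx_of_notMem_endIdx hj)]
    simp only [nomeParams, exponentMid, coeffMid, hj, if_false, pow_one]
    rw [← mul_assoc, ← hsq]
    field_simp

theorem mul_ellipticUpward_paramsU {p q s : ℂ} (hp0 : p ≠ 0) (hq0 : q ≠ 0) (hs : s ≠ 0)
    (hsq : s ^ 2 = p * q) {t : Fin 8 → ℂ} (ht : ∀ j, t j ≠ 0) :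
    ∀ z ∈ ellipticUpward p q (nomeParams (fun _ => 0) (coeffDiv q t) p),
      z / s ∈ ellipticUpward p q (paramsU s t) := by
  rintro _ ⟨j, a, b, rfl⟩
  have := ht j
  by_cases hj : j ∈ endIdx
  -- The index starts at `a + 1` because the row `a = 0` has been cancelled by the theta factor.
  · refine ⟨j, a + 1, b, ?_⟩
    rw [paramsU_end s t hj]
    simp only [nomeParams, coeffDiv, hj, if_true, pow_zero, one_mul]
    field_simp
    linear_combination (-p ^ a) * hsq
  · refine ⟨j, a, b, ?_⟩
    rw [paramsU_mid s t (mem_midIdx_of_notMem_endIdx hj)]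
    simp only [nomeParams, coeffDiv, hj, if_false, pow_zero, one_mul]
    field_simp

theorem ellipticIntegrand_inv (p q : ℂ) (t : Fin 8 → ℂ) (z : ℂ) :
    ellipticIntegrand p q t z⁻¹ = ellipticIntegrand p q t z := by
  unfold ellipticIntegrand
  rw [inv_pow, inv_inv, mul_comm (ellipticGamma (z ^ 2)⁻¹ p q)]
  congr 1
  refine Finset.prod_congr rfl fun j _ => ?_
  rw [div_inv_eq_mul, ← div_eq_mul_inv, mul_comm]

/-- Multiplication of the elliptic integrand by a ratio of theta functions cancels one of its
excluded pole sequences. -/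
theorem ellipticIntegrand_mul_theta {p q s μ : ℂ} (hp0 : p ≠ 0) (hp : ‖p‖ < 1) (hq0 : q ≠ 0)
    (hq : ‖q‖ < 1) (hs : s ≠ 0) (hsq : s ^ 2 = p * q) (hμ : μ ≠ 0) {t : Fin 8 → ℂ}
    (ht : ∀ j, t j ≠ 0) (hθ : jacobiThetaR (t 0 / μ) q * jacobiThetaR (t 7 / μ) q ≠ 0) {w : ℂ}
    (hw : w ≠ 0) (h1 : ∀ j ∈ endIdx, doubleShifted (paramsU s t j * w) p q ≠ 0)
    (h2 : doubleShifted (p * q * w ^ 2) p q ≠ 0) (h3 : doubleShifted (p * q / w ^ 2) p q ≠ 0)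
    (h4 : jacobiThetaR (w ^ 2) q ≠ 0) :
    ellipticIntegrand p q (paramsU s t) w *
        (jacobiThetaR (paramsU s t 0 * w) q * jacobiThetaR (paramsU s t 7 * w) q *
          jacobiThetaR (s / μ * w) q * jacobiThetaR (q * s * μ / (t 0 * t 7) * w) q /
          jacobiThetaR (w ^ 2) q) =
      jacobiThetaR (t 0 / μ) q * jacobiThetaR (t 7 / μ) q / 2 *
        (numeratorU q μ t p (s * w) /
          poleProduct p q (nomeParams (fun _ => 0) (coeffDiv q t) p)
            (nomeParams exponentMid (coeffMid q t) p) (s * w)) := by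
  set T := paramsU s t with hT
  have hpq : p * q ≠ 0 := mul_ne_zero hp0 hq0
  -- the integrand as a product of elliptic gamma functions
  have eI : ellipticIntegrand p q T w =
      ((∏ j ∈ endIdx, doubleShifted (p * q / (T j * w)) p q / doubleShifted (T j * w) p q *
        (doubleShifted (p * q / (T j / w)) p q / doubleShifted (T j / w) p q)) *
      ∏ j ∈ midIdx, doubleShifted (p * q / (T j * w)) p q / doubleShifted (T j * w) p q *
        (doubleShifted (p * q / (T j / w)) p q / doubleShifted (T j / w) p q)) *
        (doubleShifted (w ^ 2) p q / doubleShifted (p * q / w ^ 2) p q *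
          (doubleShifted (w ^ 2)⁻¹ p q / doubleShifted (p * q * w ^ 2) p q)) := by
    rw [ellipticIntegrand_eq, ← prod_univ_eq_end_mul_mid, poleProduct, ← Finset.prod_div_distrib]
    congr 1
    exact Finset.prod_congr rfl fun j _ => mul_div_mul_comm _ _ _ _
  have eθ : jacobiThetaR (T 0 * w) q * jacobiThetaR (T 7 * w) q =
      ∏ j ∈ endIdx, jacobiThetaR (T j * w) q := by
    rw [endIdx, Finset.prod_insert (by decide), Finset.prod_singleton]
  have eend : (∏ j ∈ endIdx, doubleShifted (p * q / (T j * w)) p q / doubleShifted (T j * w) p q *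
        (doubleShifted (p * q / (T j / w)) p q / doubleShifted (T j / w) p q)) *
      ∏ j ∈ endIdx, jacobiThetaR (T j * w) q =
      (∏ j ∈ endIdx, doubleShifted (p * q / (t j / q * (s * w))) p q *
        doubleShifted (p * q / (t j / (s * w))) p q) /
      ∏ j ∈ endIdx, doubleShifted (t j / q * (s * w)) p q * doubleShifted (t j / (s * w)) p q := by
    rw [← Finset.prod_mul_distrib, ← Finset.prod_div_distrib]
    refine Finset.prod_congr rfl fun j hj => ?_
    have e := gamma_mul_theta hp0 hp hq (h1 j hj)
    have e1 : p * (T j * w) = t j / q * (s * w) := by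
      rw [hT, paramsU_end s t hj]
      field_simp
      linear_combination (-t j) * hsq
    have e2 : T j / w = t j / (s * w) := by
      rw [hT, paramsU_end s t hj]
      field_simp
    rw [mul_right_comm, e, e1, e2, div_mul_div_comm]
  have emid : (∏ j ∈ midIdx, doubleShifted (p * q / (T j * w)) p q / doubleShifted (T j * w) p q *
        (doubleShifted (p * q / (T j / w)) p q / doubleShifted (T j / w) p q)) =
      (∏ j ∈ midIdx, doubleShifted (p * q / (t j * (s * w))) p q *
        doubleShifted (s * w / t j) p q) /
      ∏ j ∈ midIdx, doubleShifted (t j * (s * w)) p q *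
        doubleShifted (p * (q * t j) / (s * w)) p q := by
    rw [← Finset.prod_div_distrib]
    refine Finset.prod_congr rfl fun j hj => ?_
    have := ht j
    have e1 : T j * w = t j * (s * w) := by
      rw [hT, paramsU_mid s t hj]
      ring
    have e2 : T j / w = p * (q * t j) / (s * w) := by
      rw [hT, paramsU_mid s t hj, ← mul_assoc, ← hsq]
      field_simp
    have e3 : p * q / (p * (q * t j) / (s * w)) = s * w / t j := by
      field_simp
    rw [e1, e2, e3, div_mul_div_comm]
  have epole : poleProduct p q (nomeParams (fun _ => 0) (coeffDiv q t) p)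
      (nomeParams exponentMid (coeffMid q t) p) (s * w) =
      (∏ j ∈ endIdx, doubleShifted (t j / q * (s * w)) p q * doubleShifted (t j / (s * w)) p q) *
      ∏ j ∈ midIdx, doubleShifted (t j * (s * w)) p q *
        doubleShifted (p * (q * t j) / (s * w)) p q := by
    rw [poleProduct, prod_univ_eq_end_mul_mid, nomeParams_zero_exponent]
    congr 1
    · refine Finset.prod_congr rfl fun j hj => ?_
      simp [coeffDiv, nomeParams, exponentMid, coeffMid, hj]
    · refine Finset.prod_congr rfl fun j hj => ?_
      have hj' := notMem_endIdx_of_mem_midIdx hj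
      simp [coeffDiv, nomeParams, exponentMid, coeffMid, hj']
  have esq := gamma_sq_div_theta hp hq h3 h2 h4
  have e5 : (s * w) ^ 2 / q = p * w ^ 2 := by
    rw [mul_pow, hsq]
    field_simp
  have e6 : p * q / (s * w) ^ 2 = (w ^ 2)⁻¹ := by
    rw [mul_pow, hsq]
    field_simp
  have e7 : s / μ * w = s * w / μ := by ring
  -- The fourth theta argument is forced by the balancing condition; `θ(q / x) = θ(x)` brings it to
  -- the form in `trigIntegrandU`.
  have e8 : jacobiThetaR (q * s * μ / (t 0 * t 7) * w) q =
      jacobiThetaR (t 0 * t 7 / (μ * (s * w))) q := by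
    rw [← jacobiThetaR_q_div _ hq0]
    congr 1
    have := ht 0
    have := ht 7
    field_simp
  rw [numeratorU, e5, e6, ← esq, eI, epole, eθ, e7, e8, emid]
  obtain ⟨X, hX⟩ : ∃ X, X = jacobiThetaR (t 0 / μ) q * jacobiThetaR (t 7 / μ) q := ⟨_, rfl⟩
  rw [← hX] at hθ ⊢
  generalize (∏ j ∈ endIdx, doubleShifted (p * q / (T j * w)) p q / doubleShifted (T j * w) p q *
    (doubleShifted (p * q / (T j / w)) p q / doubleShifted (T j / w) p q)) = E at *
  generalize (∏ j ∈ endIdx, jacobiThetaR (T j * w) q) = Θ at *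
  generalize (∏ j ∈ endIdx, doubleShifted (p * q / (t j / q * (s * w))) p q *
    doubleShifted (p * q / (t j / (s * w))) p q) = En at *
  generalize (∏ j ∈ endIdx, doubleShifted (t j / q * (s * w)) p q *
    doubleShifted (t j / (s * w)) p q) = Ed at *
  generalize doubleShifted (w ^ 2) p q / doubleShifted (p * q / w ^ 2) p q *
    (doubleShifted (w ^ 2)⁻¹ p q / doubleShifted (p * q * w ^ 2) p q) = S at *
  generalize (∏ j ∈ midIdx, doubleShifted (p * q / (t j * (s * w))) p q *
    doubleShifted (s * w / t j) p q) = Mn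
  generalize (∏ j ∈ midIdx, doubleShifted (t j * (s * w)) p q *
    doubleShifted (p * (q * t j) / (s * w)) p q) = Md
  generalize jacobiThetaR (t 0 * t 7 / (μ * (s * w))) q = θ₁
  generalize jacobiThetaR (s * w / μ) q = θ₂
  generalize jacobiThetaR (w ^ 2) q = θ₃ at *
  calc E * (Mn / Md) * S * (Θ * θ₂ * θ₁ / θ₃) = E * Θ * (Mn / Md) * S * (θ₂ * θ₁ / θ₃) := by ring
    _ = (X * X⁻¹) * (En / Ed * (Mn / Md) * S * (θ₂ * θ₁ / θ₃)) := by
      rw [eend, mul_inv_cancel₀ hθ, one_mul]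
    _ = X / 2 * (2 * (θ₁ * θ₂ / X) * (S / θ₃) * (En * Mn) / (Ed * Md)) := by ring

/-- Nonpositive powers of `q` contradict admissibility; a nonnegative power would give `t_1² = p
q^(m + 1)`, impossible for `|p| < |t_1|²`. This is the condition `A² ∉ q^ℤ` of the four term
identity. -/
theorem paramsU_zero_sq_ne_zpow {p q s : ℂ} (hp0 : p ≠ 0) (hq0 : q ≠ 0) (hq : ‖q‖ < 1)
    (hsq : s ^ 2 = p * q) {t : Fin 8 → ℂ} (hpt : ‖p‖ < ‖t 0‖ ^ 2)
    (hadm : EllipticAdmissible p q (paramsU s t)) (n : ℤ) : paramsU s t 0 ^ 2 ≠ q ^ n := by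
  intro h
  have hqp : 0 < ‖q‖ := norm_pos_iff.mpr hq0
  have hpp : 0 < ‖p‖ := norm_pos_iff.mpr hp0
  obtain ⟨m, rfl | rfl⟩ := n.eq_nat_or_neg
  · have h1 : t 0 ^ 2 = q ^ m * (p * q) := by
      have h2 : paramsU s t 0 ^ 2 = (s ^ 2)⁻¹ * t 0 ^ 2 := by
        rw [paramsU_end s t (by decide), mul_pow, inv_pow]
      rw [h2, hsq, zpow_natCast, inv_mul_eq_iff_eq_mul₀ (mul_ne_zero hp0 hq0)] at h
      rw [h, mul_comm]
    have h2 := congrArg norm h1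
    rw [norm_pow, norm_mul, norm_mul, norm_pow] at h2
    have h3 : ‖q‖ ^ m ≤ 1 := pow_le_one₀ hqp.le hq.le
    have h4 : ‖q‖ ^ m * (‖p‖ * ‖q‖) ≤ 1 * (‖p‖ * 1) := by gcongr
    linarith
  · refine hadm 0 0 0 m ?_
    rw [pow_zero, mul_one, ← sq, h, zpow_neg, zpow_natCast, inv_mul_cancel₀ (pow_ne_zero _ hq0)]

theorem countable_theta_sq_or {p q : ℂ} (hp : ‖p‖ < 1) (hq : ‖q‖ < 1) (T : Fin 8 → ℂ) :
    {w : ℂ | ¬ ((∀ j ∈ endIdx, doubleShifted (T j * w) p q ≠ 0) ∧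
      doubleShifted (p * q * w ^ 2) p q ≠ 0 ∧ doubleShifted (p * q / w ^ 2) p q ≠ 0 ∧
      jacobiThetaR (w ^ 2) q ≠ 0)}.Countable := by
  have hc := fun c {k : ℤ} (hk : k ≠ 0) => countable_doubleShifted_eq_zero hp hq c hk
  -- The zeros of `θ(w²; q)` are among those of `(w²; p, q)_∞` and `(q / w²; p, q)_∞`, which is why
  -- the coefficients `1` and `q` occur.
  refine ((Set.countable_iUnion fun j : Fin 8 => hc (T j) one_ne_zero).union
    ((hc (p * q) (k := 2) (by norm_num)).union ((hc (p * q) (k := -2) (by norm_num)).union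
    ((hc 1 (k := 2) (by norm_num)).union (hc q (k := -2) (by norm_num)))))).mono ?_
  intro w hw
  by_contra hcon
  simp only [Set.mem_union, Set.mem_iUnion, Set.mem_ofPred_eq, not_or, not_exists, zpow_one,
    zpow_neg, one_mul, ← div_eq_mul_inv] at hcon
  obtain ⟨h1, h2, h3, h4, h5⟩ := hcon
  refine hw ⟨fun j _ => h1 j, by exact_mod_cast h2, by exact_mod_cast h3, mul_ne_zero ?_ ?_⟩
  · have h4' : doubleShifted (w ^ 2) p q ≠ 0 := by exact_mod_cast h4
    rw [doubleShifted_rec _ hp hq] at h4'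
    exact left_ne_zero_of_mul h4'
  · have h5' : doubleShifted (q / w ^ 2) p q ≠ 0 := by exact_mod_cast h5
    rw [doubleShifted_rec _ hp hq] at h5'
    exact left_ne_zero_of_mul h5'

/-- The four term identity with `A, B = T 0, T 7` and `ν = s / μ` splits the integrand into two
terms exchanged by `w ↦ 1 / w`. Reflection of the contour makes their integrals equal, which
explains the factor `2` in the integrand, and the rescaling `z = s w` leads to `γ₀`. -/
theorem theta_mul_ellipticS_paramsU {p q s μ : ℂ} (hp0 : p ≠ 0) (hp : ‖p‖ < 1) (hq0 : q ≠ 0)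
    (hq : ‖q‖ < 1) (hsq : s ^ 2 = p * q) (hμ : μ ≠ 0) {t : Fin 8 → ℂ} (ht : ∀ j, t j ≠ 0)
    (hθ : jacobiThetaR (t 0 / μ) q * jacobiThetaR (t 7 / μ) q ≠ 0) (hpt : ‖p‖ < ‖t 0‖ ^ 2)
    (hadm : EllipticAdmissible p q (paramsU s t)) {γ₀ : ℝ → ℂ}
    (hγ₀ : IsSeparatingContour (ellipticDownward p q (nomeParams exponentMid (coeffMid q t) p))
      (ellipticUpward p q (nomeParams (fun _ => 0) (coeffDiv q t) p)) γ₀) :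
    jacobiThetaR (t 0 * t 7 / (p * q)) q * ellipticS p q (paramsU s t) =
      (2 * Real.pi * Complex.I)⁻¹ * loopIntegral γ₀ (fun z => numeratorU q μ t p z /
        poleProduct p q (nomeParams (fun _ => 0) (coeffDiv q t) p)
          (nomeParams exponentMid (coeffMid q t) p) z / z) := by
  have hs : s ≠ 0 := by
    rintro rfl
    exact mul_ne_zero hp0 hq0 (by simpa using hsq.symm)
  set T := paramsU s t with hT
  have hT0 : ∀ j, T j ≠ 0 := paramsU_ne_zero hs ht
  set α := nomeParams (fun _ => 0) (coeffDiv q t) p with hα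
  set β := nomeParams exponentMid (coeffMid q t) p with hβ
  have hα0 : ∀ j, α j ≠ 0 := nomeParams_ne_zero (coeffDiv_ne_zero hq0 ht) hp0
  have hβ0 : ∀ j, β j ≠ 0 := nomeParams_ne_zero (coeffMid_ne_zero hq0 ht) hp0
  obtain ⟨γ, hγ, hval⟩ := separatedIntegral_eq
    (exists_isSeparatingContour_elliptic hp0 hp hq0 hq hT0 hadm) (ellipticIntegrand p q T)
  -- the reflected contour
  have hγ' : IsSeparatingContour (ellipticDownward p q T) (ellipticUpward p q T)
      (fun x => (γ (-x))⁻¹) := by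
    refine hγ.inv ?_ ?_ (zero_notMem_ellipticDownward hp0 hq0 hT0)
      (zero_notMem_ellipticUpward hp0 hq0 hT0)
    · rintro _ ⟨j, a, b, rfl⟩
      exact ⟨j, a, b, rfl⟩
    · rintro _ ⟨j, a, b, rfl⟩
      exact ⟨j, a, b, inv_inv _⟩
  have hscale : ∀ {δ : ℝ → ℂ}, IsSeparatingContour (ellipticDownward p q T) (ellipticUpward p q T) δ →
      IsSeparatingContour (ellipticDownward p q β) (ellipticUpward p q α) (fun x => s * δ x) :=
    fun h => h.const_mul hs (mul_ellipticDownward_paramsU hs hsq t)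
      (mul_ellipticUpward_paramsU hp0 hq0 hs hsq ht)
  set K : ℂ → ℂ := fun z => numeratorU q μ t p z / poleProduct p q α β z with hK
  -- The measure `dw / w` is invariant under scaling, and the broken integrand has fewer excluded
  -- poles than the original one, so any admissible contour may be replaced by `γ₀`.
  have hind : ∀ {δ : ℝ → ℂ}, IsSeparatingContour (ellipticDownward p q T) (ellipticUpward p q T) δ →
      loopIntegral δ (fun w => K (s * w) / w) = loopIntegral γ₀ (fun z => K z / z) := by
    intro δ hδ
    rw [← loopIntegral_div_poleProduct_eq hp hq (hscale hδ) hγ₀ subset_rfl subset_rfl subset_rfl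
      subset_rfl (zero_notMem_ellipticUpward hp0 hq0 hα0)
      (fun z hz => differentiableAt_numeratorU hp hq0 hq hμ ht hz), loopIntegral_const_mul_curve]
    refine loopIntegral_congr fun x => ?_
    have := hδ.ne_zero x
    simp only [hK]
    field_simp
  have hKd : ∀ {δ : ℝ → ℂ}, IsSeparatingContour (ellipticDownward p q T) (ellipticUpward p q T) δ →
      Continuous fun x => K (s * δ x) := by
    intro δ hδ
    refine continuous_comp_of_differentiableAt (hscale hδ).contDiff.continuous fun x => ?_
    have h0 := (hscale hδ).ne_zero x
    exact (differentiableAt_numeratorU hp hq0 hq hμ ht h0).div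
      (differentiableAt_poleProduct hp hq α β h0)
      (poleProduct_ne_zero_of_notMem hp hq ((hscale hδ).notMem_excluded x)
        ((hscale hδ).notMem_included x) h0)
  have hγinv : Continuous fun x => K (s * (γ x)⁻¹) := by
    have := (hKd hγ').comp continuous_neg
    simpa [Function.comp_def] using this
  set κ := jacobiThetaR (t 0 / μ) q * jacobiThetaR (t 7 / μ) q with hκ
  have hAB : jacobiThetaR (T 0 * T 7) q * jacobiThetaR (s / μ * T 0) q *
      jacobiThetaR (s / μ * T 7) q = jacobiThetaR (t 0 * t 7 / (p * q)) q * κ := by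
    have e0 : T 0 = s⁻¹ * t 0 := paramsU_end s t (by decide)
    have e7 : T 7 = s⁻¹ * t 7 := paramsU_end s t (by decide)
    have h1 : T 0 * T 7 = t 0 * t 7 / (p * q) := by
      rw [e0, e7, ← hsq]
      field_simp
    have h2 : s / μ * T 0 = t 0 / μ := by
      rw [e0]
      field_simp
    have h3 : s / μ * T 7 = t 7 / μ := by
      rw [e7]
      field_simp
    rw [h1, h2, h3, hκ, mul_assoc]
  -- symmetrization of the integrand
  have hpt : ∀ w : ℂ, w ≠ 0 →
      ((∀ j ∈ endIdx, doubleShifted (T j * w) p q ≠ 0) ∧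
        doubleShifted (p * q * w ^ 2) p q ≠ 0 ∧ doubleShifted (p * q / w ^ 2) p q ≠ 0 ∧
        jacobiThetaR (w ^ 2) q ≠ 0) →
      ((∀ j ∈ endIdx, doubleShifted (T j * w⁻¹) p q ≠ 0) ∧
        doubleShifted (p * q * w⁻¹ ^ 2) p q ≠ 0 ∧ doubleShifted (p * q / w⁻¹ ^ 2) p q ≠ 0 ∧
        jacobiThetaR (w⁻¹ ^ 2) q ≠ 0) →
      jacobiThetaR (t 0 * t 7 / (p * q)) q * κ * ellipticIntegrand p q T w =
        κ / 2 * K (s * w) + κ / 2 * K (s * w⁻¹) := by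
    intro w hw h h'
    have i1 := ellipticIntegrand_mul_theta hp0 hp hq0 hq hs hsq hμ ht hθ hw h.1 h.2.1 h.2.2.1 h.2.2.2
    have i2 := ellipticIntegrand_mul_theta hp0 hp hq0 hq hs hsq hμ ht hθ (inv_ne_zero hw) h'.1 h'.2.1
      h'.2.2.1 h'.2.2.2
    have hν : s / μ ≠ 0 := div_ne_zero hs hμ
    have hbal : T 0 * T 7 * (s / μ) * (q * s * μ / (t 0 * t 7)) = q := by
      have e0 : T 0 = s⁻¹ * t 0 := paramsU_end s t (by decide)
      have e7 : T 7 = s⁻¹ * t 7 := paramsU_end s t (by decide)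
      have := ht 0
      have := ht 7
      rw [e0, e7]
      field_simp
    have i3 := jacobiThetaR_four_term hq0 hq (hT0 0) (hT0 7) hν hbal
      (paramsU_zero_sq_ne_zpow hp0 hq0 hq hsq hpt hadm) hw
    rw [hAB] at i3
    have hθw := h.2.2.2
    have hθw' : jacobiThetaR (w⁻¹ ^ 2) q = -(w ^ 2)⁻¹ * jacobiThetaR (w ^ 2) q := by
      rw [inv_pow, jacobiThetaR_inv hq (pow_ne_zero 2 hw)]
    rw [← hκ] at i1 i2
    rw [hK]
    dsimp only
    rw [← i1, ← i2, ellipticIntegrand_inv, ← hT, hθw']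
    generalize jacobiThetaR (T 0 * w) q * jacobiThetaR (T 7 * w) q *
      jacobiThetaR (s / μ * w) q * jacobiThetaR (q * s * μ / (t 0 * t 7) * w) q = X at *
    generalize jacobiThetaR (T 0 * w⁻¹) q * jacobiThetaR (T 7 * w⁻¹) q *
      jacobiThetaR (s / μ * w⁻¹) q * jacobiThetaR (q * s * μ / (t 0 * t 7) * w⁻¹) q = Y at *
    rw [← mul_add]
    have e : X / jacobiThetaR (w ^ 2) q + Y / (-(w ^ 2)⁻¹ * jacobiThetaR (w ^ 2) q) =
        jacobiThetaR (t 0 * t 7 / (p * q)) q * κ := by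
      generalize jacobiThetaR (w ^ 2) q = Z at *
      field_simp
      linear_combination i3
    rw [e, mul_comm]
  have hcount := countable_theta_sq_or hp hq T
  have hI : jacobiThetaR (t 0 * t 7 / (p * q)) q * κ *
      loopIntegral γ (fun w => ellipticIntegrand p q T w / w) =
      κ * loopIntegral γ₀ (fun z => K z / z) := by
    rw [← loopIntegral_const_mul, loopIntegral_congr_of_countable
      (hγ.contDiff.differentiable one_ne_zero) (hcount.union (hcount.image Inv.inv))
      (g := fun w => κ / 2 * (K (s * w) / w) + κ / 2 * (K (s * w⁻¹) / w))]
    · have c1 : Continuous fun x => K (s * γ x) / γ x :=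
        (hKd hγ).div hγ.contDiff.continuous hγ.ne_zero
      have c2 : Continuous fun x => K (s * (γ x)⁻¹) / γ x :=
        hγinv.div hγ.contDiff.continuous hγ.ne_zero
      rw [loopIntegral_add (f := fun w => κ / 2 * (K (s * w) / w))
        (g := fun w => κ / 2 * (K (s * w⁻¹) / w)) hγ.contDiff (continuous_const.mul c1)
        (continuous_const.mul c2), loopIntegral_const_mul, loopIntegral_const_mul, hind hγ,
        ← hind hγ', loopIntegral_inv_curve hγ.contDiff hγ.periodic hγ.ne_zero]
      have e : loopIntegral γ (fun z => (z ^ 2)⁻¹ * (K (s * z⁻¹) / z⁻¹)) =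
          loopIntegral γ (fun z => K (s * z⁻¹) / z) := by
        refine loopIntegral_congr fun x => ?_
        have := hγ.ne_zero x
        field_simp
      rw [e]
      ring
    · intro x hx
      rw [Set.mem_union, not_or] at hx
      have h1 := not_not.mp hx.1
      -- The exceptional set was enlarged by its image under inversion so that the product formula
      -- is available at both `γ x` and `(γ x)⁻¹`.
      have h3 := fun h => hx.2 ⟨(γ x)⁻¹, h, inv_inv _⟩
      have := hpt (γ x) (hγ.ne_zero x) h1 (not_not.mp h3)
      rw [← mul_div_assoc, this]
      ring
  rw [ellipticS, hval, mul_left_comm]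
  congr 1
  refine mul_left_cancel₀ hθ ?_
  rw [← hI]
  ring

theorem exists_continuousOn_theta_mul_ellipticS {q : ℂ} (hq0 : q ≠ 0) (hq : ‖q‖ < 1)
    {t : Fin 8 → ℂ} (ht : ∀ j, t j ≠ 0) (hgen : GenericU q t) {μ : ℂ} (hμ : GenericMu q μ t) :
    ∃ δ : ℝ, 0 < δ ∧ ∃ F : ℂ → ℂ,
      ContinuousOn F {p | 0 < ‖p‖ ∧ ‖p‖ < δ} ∧
      (∀ p s : ℂ, 0 < ‖p‖ → ‖p‖ < δ → s ^ 2 = p * q →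
        EllipticAdmissible p q (paramsU s t) →
        F p = jacobiThetaR (t 0 * t 7 / (p * q)) q * ellipticS p q (paramsU s t)) ∧
      Tendsto F (𝓝[≠] 0) (𝓝 (trigU q μ t)) := by
  obtain ⟨hμ0, hμt⟩ := hμ
  have hθj : ∀ j ∈ endIdx, jacobiThetaR (t j / μ) q ≠ 0 := by
    intro j hj h
    rw [jacobiThetaR_eq_zero_iff hq0 hq (div_ne_zero (ht j) hμ0)] at h
    obtain ⟨n, hn⟩ := h
    refine hμt j hj (-n) ?_
    rw [zpow_neg, ← hn, inv_div, mul_div_cancel₀ _ (ht j)]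
  have hθ : jacobiThetaR (t 0 / μ) q * jacobiThetaR (t 7 / μ) q ≠ 0 :=
    mul_ne_zero (hθj 0 (by decide)) (hθj 7 (by decide))
  obtain ⟨γ₀, hγ₀, hval⟩ := separatedIntegral_eq
    (exists_isSeparatingContour_trigU hq0 hq ht hgen) (trigIntegrandU q μ t)
  obtain ⟨δ, hδ, hδ1, hsep, hcont⟩ := exists_degeneration (N := numeratorU q μ t) hq0 hq hγ₀
    (coeffDiv_ne_zero hq0 ht) (e := fun _ => 0) (e' := exponentMid) (c' := coeffMid q t)
    (fun j hj b => by
      have hj' : j ∈ endIdx := by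
        by_contra h
        simp [exponentMid, h] at hj
      exact ⟨j, hj', b, by simp [coeffMid, hj']⟩)
    (fun j _ b => by
      by_cases hj : j ∈ endIdx
      · refine Or.inl ⟨j, hj, b, ?_⟩
        have := ht j
        simp only [coeffDiv, hj, if_true]
        field_simp
      · exact Or.inr ⟨j, mem_midIdx_of_notMem_endIdx hj, b, by simp [coeffDiv, hj]⟩)
    (fun p z hp hz => continuousAt_numeratorU hp hq0 hq hμ0 ht hz)
  have ht0 : 0 < ‖t 0‖ ^ 2 := pow_pos (norm_pos_iff.mpr (ht 0)) 2
  have hcont' := hcont.const_smul ((2 * Real.pi * Complex.I)⁻¹)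
  -- The extension is the integral along `γ₀`, defined on the whole disc without reference to `s`.
  -- The bound `|t_1|²` serves `paramsU_zero_sq_ne_zpow`.
  refine ⟨min δ (‖t 0‖ ^ 2), lt_min hδ ht0, _, hcont'.mono fun p hp => ?_,
    fun p s hp0 hp hsq hadm => ?_, ?_⟩
  · simpa using hp.2.trans_le (min_le_left _ _)
  · have hpδ := hp.trans_le (min_le_left _ _)
    have hp0' := norm_pos_iff.mp hp0
    exact (theta_mul_ellipticS_paramsU hp0' (hpδ.trans hδ1) hq0 hq hsq hμ0 ht hθ
      (hp.trans_le (min_le_right _ _)) hadm (hsep p hp0' hpδ)).symm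
  · have h0 := (hcont'.continuousAt (Metric.isOpen_ball.mem_nhds
      (Metric.mem_ball_self hδ))).tendsto.mono_left (nhdsWithin_le_nhds (s := {0}ᶜ))
    have e : trigU q μ t = ((2 * Real.pi * Complex.I)⁻¹ : ℂ) • loopIntegral γ₀ (fun z =>
        numeratorU q μ t 0 z / poleProduct 0 q (nomeParams (fun _ => 0) (coeffDiv q t) 0)
          (nomeParams exponentMid (coeffMid q t) 0) z / z) := by
      simp only [numeratorU_zero hq, smul_eq_mul]
      exact hval
    rw [e]
    exact h0

/-- In the second part the function `p ↦ θ(t_1 t_8 / (p q); q) S_e(…)` is given by the contour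
integral for all small `p ≠ 0` outside three sequences that converge to `0`; there it is extended
by continuity. Both square roots `s` of `p q` are allowed. -/
theorem proposition5p4 (q : ℂ) (hq0 : q ≠ 0) (hq1 : ‖q‖ < 1)
    (t : Fin 8 → ℂ) (ht : ∏ j, t j = 1) :
    (GenericS q t →
      (∀ᶠ p in 𝓝[≠] (0 : ℂ), EllipticAdmissible p q (paramsS p q t)) ∧
      Tendsto (fun p => ellipticS p q (paramsS p q t)) (𝓝[≠] 0) (𝓝 (trigS q t))) ∧
    (GenericU q t → ∀ μ : ℂ, GenericMu q μ t →
      ∃ δ : ℝ, 0 < δ ∧ ∃ F : ℂ → ℂ,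
        ContinuousOn F {p | 0 < ‖p‖ ∧ ‖p‖ < δ} ∧
        (∀ p s : ℂ, 0 < ‖p‖ → ‖p‖ < δ → s ^ 2 = p * q →
          EllipticAdmissible p q (paramsU s t) →
          F p = jacobiThetaR (t 0 * t 7 / (p * q)) q * ellipticS p q (paramsU s t)) ∧
        Tendsto F (𝓝[≠] 0) (𝓝 (trigU q μ t))) := by
  -- The balancing condition enters only through the nonvanishing of the parameters.
  have ht0 : ∀ j, t j ≠ 0 := fun j =>
    Finset.prod_ne_zero_iff.mp (ht ▸ one_ne_zero) j (Finset.mem_univ j)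
  exact ⟨fun h => ⟨eventually_ellipticAdmissible_paramsS hq1 h,
    tendsto_ellipticS_paramsS hq0 hq1 ht0 h⟩,
    fun h μ hμ => exists_continuousOn_theta_mul_ellipticS hq0 hq1 ht0 h hμ⟩
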